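/- Let $K$ be a field; all vector spaces are over $K$ and $\otimes=\otimes_K$. **Setting.** A *braided vector space* $(V,c)$ is a vector space with a linear map $c:V\otimes V\to V\otimes V$ (not assumed invertible) such that $c_1c_2c_1=c_2c_1c_2$ on $V^{\otimes 3}$, where $c_1=c\otimes V$, $c_2=V\otimes c$. A *braided bialgebra* is an algebra and coalgebra $B$ with a braiding $c_B$ commuting with multiplication, unit, comultiplication and counit, such that $\Delta$ and $\varepsilon$ are algebra maps, where $B\otimes B$ has the multiplication $(m\otimes m)(B\otimes c_B\otimes B)$. Put $P(B)=\{x\mid\Delta(x)=x\otimes 1+1\otimes x\}$. The *braided tensor algebra* $T=T(V,c)$ is the tensor algebra of $V$ with the braiding extending $c$ and the comultiplication for which the elements of $V$ are primitive. A *bracket* $b=(b^{[n]})_{n\ge 0}$ on $(V,c)$ consists of linear maps $b^{[n]}:P^{[n]}\to V$, $P^{[n]}=P(U^{[n]})$, where $U^{[0]}=T(V,c)$, $U^{[n+1]}$ is the quotient braided bialgebra of $U^{[n]}$ by the two-sided ideal generated by all $p-i^{[n]}b^{[n]}(p)$ with $p\in P^{[n]}$, $i^{[n]}:V\to P^{[n]}$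 is the canonical map with image $V^{[n]}$, and, for restrictions of the braiding of $U^{[n]}$, $$c_{V^{[n]}}(i^{[n]}b^{[n]}\otimes V^{[n]})=(V^{[n]}\otimes i^{[n]}b^{[n]})\,c_{P^{[n]},V^{[n]}},\qquad c_{V^{[n]}}(V^{[n]}\otimes i^{[n]}b^{[n]})=(i^{[n]}b^{[n]}\otimes V^{[n]})\,c_{V^{[n]},P^{[n]}}.$$ The *universal enveloping algebra* $U=U(V,c,b)$ is the direct limit of $U^{[0]}\to U^{[1]}\to\cdots$, with projection $\pi_U:T(V,c)\to U$; $(V,c,b)$ is a *braided Lie algebra* if $V\to U$ is injective. The *standard filtration* of $U$ is $U_{(n)}=\pi_U\big(\bigoplus_{i\le n}V^{\otimes i}\big)$; the *coradical filtration* has $U_0$ equal to the sum of all simple subcoalgebras of $U$ and $U_{n+1}=\Delta^{-1}(U\otimes U_n+U_0\otimes U)$. Put $U_{(-1)}=U_{-1}=0$. $U$ is *strictly generated by $V$* if $U_n=U_{(n)}$ for all $n\in\mathbb N$. **Proposition.** Let $(V,c,b)$ be a braided Lie algebra and $U=U(V,c,b)$. Then $U$ is a braided bialgebra, the structure of $U$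 induces structures of graded braided bialgebra on $\mathfrak G(U)=\bigoplus_n U_{(n)}/U_{(n-1)}$ and on $\mathrm{gr}\,U=\bigoplus_n U_n/U_{n-1}$, one has $U_{(n)}\subseteq U_n$ for all $n$, and the identity of $U$ induces a graded braided bialgebra homomorphism $\xi_U:\mathfrak G(U)\to\mathrm{gr}\,U$. Moreover the following assertions are equivalent. 1. $\xi_U$ is bijective. 2. $\xi_U$ is surjective. 3. $\xi_U$ is injective. 4. $U_{(n)}\cap U_{n-1}=U_{(n-1)}$ for all $n\in\mathbb N$. 5. $U_n=U_{(n)}+U_{n-1}$ for all $n\in\mathbb N$. 6. $U$ is strictly generated by $V$. 7. $P(\mathfrak G(U))=U_{(1)}/U_{(0)}$. 8. $\pi_U(V)^n\cap U_{n-1}\subseteq U_{(n-1)}$ for all $n\in\mathbb N$. -/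

import Mathlib

open scoped TensorProduct DirectSum

noncomputable section

namespace BraidedLie

universe u v w

/-! ## Braided vector spaces and braided bialgebras -/

section Braided

variable {K : Type u} [Field K] {B : Type v} [AddCommGroup B] [Module K B]

/-- `c₁ = c ⊗ B` on `B ⊗ B ⊗ B` (bracketed to the right). -/
def braidFst (c : B ⊗[K] B →ₗ[K] B ⊗[K] B) :
    B ⊗[K] (B ⊗[K] B) →ₗ[K] B ⊗[K] (B ⊗[K] B) :=
  (TensorProduct.assoc K B B B).toLinearMap ∘ₗ c.rTensor B ∘ₗ
    (TensorProduct.assoc K B B B).symm.toLinearMap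

/-- `c₂ = B ⊗ c` on `B ⊗ B ⊗ B` (bracketed to the right). -/
def braidSnd (c : B ⊗[K] B →ₗ[K] B ⊗[K] B) :
    B ⊗[K] (B ⊗[K] B) →ₗ[K] B ⊗[K] (B ⊗[K] B) :=
  c.lTensor B

/-- The quantum Yang-Baxter equation `c₁ c₂ c₁ = c₂ c₁ c₂`; a braiding is a linear map
satisfying it (no invertibility is required). -/
def IsBraiding (c : B ⊗[K] B →ₗ[K] B ⊗[K] B) : Prop :=
  braidFst c ∘ₗ braidSnd c ∘ₗ braidFst c = braidSnd c ∘ₗ braidFst c ∘ₗ braidSnd c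

/-- `B ⊗ c ⊗ B` on `(B ⊗ B) ⊗ (B ⊗ B)`. -/
def midBraid (c : B ⊗[K] B →ₗ[K] B ⊗[K] B) :
    (B ⊗[K] B) ⊗[K] (B ⊗[K] B) →ₗ[K] (B ⊗[K] B) ⊗[K] (B ⊗[K] B) :=
  (TensorProduct.assoc K B B (B ⊗[K] B)).symm.toLinearMap ∘ₗ
    (braidFst c).lTensor B ∘ₗ
    (TensorProduct.assoc K B B (B ⊗[K] B)).toLinearMap

end Braided

/-- The six pieces of data `(B, m, u, Δ, ε, c)`, without any law. -/
@[ext]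
structure BraidedBialgebraData (K : Type u) [Field K] (B : Type v) [AddCommGroup B]
    [Module K B] where
  mul : B ⊗[K] B →ₗ[K] B
  unit : K →ₗ[K] B
  comul : B →ₗ[K] B ⊗[K] B
  counit : B →ₗ[K] K
  braid : B ⊗[K] B →ₗ[K] B ⊗[K] B

namespace BraidedBialgebraData

variable {K : Type u} [Field K] {B : Type v} [AddCommGroup B] [Module K B]

/-- The unit element `1_B`. -/
def one (D : BraidedBialgebraData K B) : B := D.unit 1

/-- The multiplication `(m ⊗ m)(B ⊗ c ⊗ B)` of the braided tensor square `B ⊗_c B`. -/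
def braidedMul (D : BraidedBialgebraData K B) :
    (B ⊗[K] B) ⊗[K] (B ⊗[K] B) →ₗ[K] B ⊗[K] B :=
  TensorProduct.map D.mul D.mul ∘ₗ midBraid D.braid

/-- The laws of a braided bialgebra: an associative unital algebra, a coassociative counital
coalgebra, a braiding commuting with all four structure maps, and `Δ` and `ε` are multiplicative
and unital (for the braided multiplication on `B ⊗ B`). -/
structure IsBraidedBialgebra (D : BraidedBialgebraData K B) : Prop where
  mul_assoc : ∀ x y z : B,
    D.mul (D.mul (x ⊗ₜ y) ⊗ₜ z) = D.mul (x ⊗ₜ D.mul (y ⊗ₜ z))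
  one_mul : ∀ x : B, D.mul (D.one ⊗ₜ x) = x
  mul_one : ∀ x : B, D.mul (x ⊗ₜ D.one) = x
  coassoc : (TensorProduct.assoc K B B B).toLinearMap ∘ₗ D.comul.rTensor B ∘ₗ D.comul =
    D.comul.lTensor B ∘ₗ D.comul
  counit_left : ∀ x : B, D.counit.rTensor B (D.comul x) = 1 ⊗ₜ x
  counit_right : ∀ x : B, D.counit.lTensor B (D.comul x) = x ⊗ₜ 1
  braiding : IsBraiding D.braid
  /-- `c (m ⊗ B) = (B ⊗ m)(c ⊗ B)(B ⊗ c)` -/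
  braid_mul_left : D.braid ∘ₗ D.mul.rTensor B ∘ₗ (TensorProduct.assoc K B B B).symm.toLinearMap =
    D.mul.lTensor B ∘ₗ braidFst D.braid ∘ₗ braidSnd D.braid
  /-- `c (B ⊗ m) = (m ⊗ B)(B ⊗ c)(c ⊗ B)` -/
  braid_mul_right : D.braid ∘ₗ D.mul.lTensor B =
    D.mul.rTensor B ∘ₗ (TensorProduct.assoc K B B B).symm.toLinearMap ∘ₗ
      braidSnd D.braid ∘ₗ braidFst D.braid
  braid_one_left : ∀ x : B, D.braid (D.one ⊗ₜ x) = x ⊗ₜ D.one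
  braid_one_right : ∀ x : B, D.braid (x ⊗ₜ D.one) = D.one ⊗ₜ x
  /-- `(B ⊗ Δ) c = (c ⊗ B)(B ⊗ c)(Δ ⊗ B)` -/
  braid_comul_left : D.comul.lTensor B ∘ₗ D.braid =
    braidFst D.braid ∘ₗ braidSnd D.braid ∘ₗ (TensorProduct.assoc K B B B).toLinearMap ∘ₗ
      D.comul.rTensor B
  /-- `(Δ ⊗ B) c = (B ⊗ c)(c ⊗ B)(B ⊗ Δ)` -/
  braid_comul_right : (TensorProduct.assoc K B B B).toLinearMap ∘ₗ D.comul.rTensor B ∘ₗ D.braid =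
    braidSnd D.braid ∘ₗ braidFst D.braid ∘ₗ D.comul.lTensor B
  braid_counit_left : ∀ x y : B,
    D.counit.lTensor B (D.braid (x ⊗ₜ y)) = y ⊗ₜ D.counit x
  braid_counit_right : ∀ x y : B,
    D.counit.rTensor B (D.braid (x ⊗ₜ y)) = D.counit y ⊗ₜ x
  /-- `Δ m = (m ⊗ m)(B ⊗ c ⊗ B)(Δ ⊗ Δ)` -/
  comul_mul : D.comul ∘ₗ D.mul = D.braidedMul ∘ₗ TensorProduct.map D.comul D.comul
  comul_one : D.comul D.one = D.one ⊗ₜ D.one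
  counit_mul : ∀ x y : B, D.counit (D.mul (x ⊗ₜ y)) = D.counit x * D.counit y
  counit_one : D.counit D.one = 1

/-- A morphism of braided bialgebras: a map of algebras, of coalgebras and of braided vector
spaces. -/
structure IsHom {B' : Type w} [AddCommGroup B'] [Module K B'] (D : BraidedBialgebraData K B)
    (D' : BraidedBialgebraData K B') (f : B →ₗ[K] B') : Prop where
  map_mul : f ∘ₗ D.mul = D'.mul ∘ₗ TensorProduct.map f f
  map_unit : f ∘ₗ D.unit = D'.unit
  map_comul : TensorProduct.map f f ∘ₗ D.comul = D'.comul ∘ₗ f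
  map_counit : D'.counit ∘ₗ f = D.counit
  map_braid : TensorProduct.map f f ∘ₗ D.braid = D'.braid ∘ₗ TensorProduct.map f f

/-- The space of primitive elements `{b | Δ b = b ⊗ 1 + 1 ⊗ b}`. -/
def primitives (D : BraidedBialgebraData K B) : Submodule K B :=
  LinearMap.eqLocus D.comul
    ((TensorProduct.mk K B B).flip D.one + TensorProduct.mk K B B D.one)

/-- A (positively) graded braided bialgebra: the structure lives on a direct sum `⨁ n, A n`, is a
braided bialgebra, and all structure maps are homogeneous of degree zero. -/
structure IsGradedBraidedBialgebra {A : ℕ → Type w} [∀ n, AddCommGroup (A n)]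
    [∀ n, Module K (A n)] (D : BraidedBialgebraData K (⨁ n, A n)) : Prop where
  isBraidedBialgebra : D.IsBraidedBialgebra
  mul_mem : ∀ i j (x : A i) (y : A j),
    D.mul (DirectSum.lof K ℕ A i x ⊗ₜ DirectSum.lof K ℕ A j y) ∈
      LinearMap.range (DirectSum.lof K ℕ A (i + j))
  one_mem : D.one ∈ LinearMap.range (DirectSum.lof K ℕ A 0)
  comul_mem : ∀ n (x : A n), D.comul (DirectSum.lof K ℕ A n x) ∈
    ⨆ p ∈ Finset.HasAntidiagonal.antidiagonal n,
      LinearMap.range (TensorProduct.map (DirectSum.lof K ℕ A p.1) (DirectSum.lof K ℕ A p.2))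
  counit_eq_zero : ∀ n (x : A n), n ≠ 0 → D.counit (DirectSum.lof K ℕ A n x) = 0
  braid_mem : ∀ i j (x : A i) (y : A j),
    D.braid (DirectSum.lof K ℕ A i x ⊗ₜ DirectSum.lof K ℕ A j y) ∈
      LinearMap.range (TensorProduct.map (DirectSum.lof K ℕ A j) (DirectSum.lof K ℕ A i))

end BraidedBialgebraData

/-! ## The braided tensor algebra `T(V,c)` -/

section TensorAlgebra

variable {K : Type u} [Field K] {V : Type v} [AddCommGroup V] [Module K V]

/-- The linear map `V → End(T ⊗ V)` sending `w` to `t ⊗ v ↦ t · c(v ⊗ w)`. -/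
def crossRight (c : V ⊗[K] V →ₗ[K] V ⊗[K] V) :
    V →ₗ[K] Module.End K (TensorAlgebra K V ⊗[K] V) :=
  (TensorProduct.curry
    ((LinearMap.mul' K (TensorAlgebra K V)).rTensor V ∘ₗ
      (TensorProduct.assoc K (TensorAlgebra K V) (TensorAlgebra K V) V).symm.toLinearMap ∘ₗ
      ((TensorAlgebra.ι K).rTensor V ∘ₗ c).lTensor (TensorAlgebra K V) ∘ₗ
      (TensorProduct.assoc K (TensorAlgebra K V) V V).toLinearMap)).flip

/-- The braiding `c_{V,T} : V ⊗ T → T ⊗ V`: one strand `v` is moved across `w₁ ⋯ wₘ` from left to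
right, crossing `w₁` first and `wₘ` last, each crossing being a copy of `c`. The anti-homomorphism
`T → End(T ⊗ V)` extending `crossRight` is evaluated at `1 ⊗ v`. -/
def braidVT (c : V ⊗[K] V →ₗ[K] V ⊗[K] V) :
    V ⊗[K] TensorAlgebra K V →ₗ[K] TensorAlgebra K V ⊗[K] V :=
  TensorProduct.lift
    (LinearMap.lcomp K (TensorAlgebra K V ⊗[K] V) (TensorProduct.mk K (TensorAlgebra K V) V 1) ∘ₗ
      (MulOpposite.opLinearEquiv K).symm.toLinearMap ∘ₗ
      (TensorAlgebra.lift K ((MulOpposite.opLinearEquiv K).toLinearMap ∘ₗ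
        crossRight c)).toLinearMap).flip

/-- The linear map `V → End(T ⊗ T)` sending `v` to `t ⊗ x ↦ c_{V,T}(v ⊗ t) · x`. -/
def crossLeft (c : V ⊗[K] V →ₗ[K] V ⊗[K] V) :
    V →ₗ[K] Module.End K (TensorAlgebra K V ⊗[K] TensorAlgebra K V) :=
  TensorProduct.curry
    ((LinearMap.mul' K (TensorAlgebra K V) ∘ₗ
        (TensorAlgebra.ι K).rTensor (TensorAlgebra K V)).lTensor (TensorAlgebra K V) ∘ₗ
      (TensorProduct.assoc K (TensorAlgebra K V) V (TensorAlgebra K V)).toLinearMap ∘ₗ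
      (braidVT c).rTensor (TensorAlgebra K V) ∘ₗ
      (TensorProduct.assoc K V (TensorAlgebra K V) (TensorAlgebra K V)).symm.toLinearMap)

/-- The braiding `c_T : T ⊗ T → T ⊗ T` of the tensor algebra: in `v₁ ⋯ vₙ ⊗ w₁ ⋯ wₘ` the strands
`vₙ, …, v₁` are moved, in this order, across `w₁ ⋯ wₘ`. The algebra homomorphism
`T → End(T ⊗ T)` extending `crossLeft` is evaluated at `t ⊗ 1`. -/
def braidTT (c : V ⊗[K] V →ₗ[K] V ⊗[K] V) :
    TensorAlgebra K V ⊗[K] TensorAlgebra K V →ₗ[K]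
      TensorAlgebra K V ⊗[K] TensorAlgebra K V :=
  TensorProduct.lift
    (LinearMap.lcomp K (TensorAlgebra K V ⊗[K] TensorAlgebra K V)
        ((TensorProduct.mk K (TensorAlgebra K V) (TensorAlgebra K V)).flip 1) ∘ₗ
      (TensorAlgebra.lift K (crossLeft c)).toLinearMap)

/-- The map `V → T ⊗ T`, `v ↦ v ⊗ 1 + 1 ⊗ v`. -/
def primitiveMap (K : Type u) [Field K] (V : Type v) [AddCommGroup V] [Module K V] :
    V →ₗ[K] TensorAlgebra K V ⊗[K] TensorAlgebra K V :=
  ((TensorProduct.mk K (TensorAlgebra K V) (TensorAlgebra K V)).flip 1 +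
    TensorProduct.mk K (TensorAlgebra K V) (TensorAlgebra K V) 1) ∘ₗ TensorAlgebra.ι K

/-- The comultiplication of `T(V,c)`: the algebra homomorphism `T → T ⊗_c T` with
`v ↦ v ⊗ 1 + 1 ⊗ v`. It is obtained as follows: `v` acts on `T ⊗_c T` by left multiplication with
`v ⊗ 1 + 1 ⊗ v`; this extends to an action of `T`, and `Δ t` is the image of `1 ⊗ 1` under `t`. -/
def comulT (c : V ⊗[K] V →ₗ[K] V ⊗[K] V) :
    TensorAlgebra K V →ₗ[K] TensorAlgebra K V ⊗[K] TensorAlgebra K V :=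
  LinearMap.applyₗ (1 ⊗ₜ 1) ∘ₗ
    (TensorAlgebra.lift K
      (TensorProduct.curry
        (TensorProduct.map (LinearMap.mul' K (TensorAlgebra K V))
          (LinearMap.mul' K (TensorAlgebra K V)) ∘ₗ midBraid (braidTT c)) ∘ₗ
        primitiveMap K V)).toLinearMap

/-- The braided tensor algebra `T(V,c)`. -/
def tensorData (c : V ⊗[K] V →ₗ[K] V ⊗[K] V) : BraidedBialgebraData K (TensorAlgebra K V) where
  mul := LinearMap.mul' K (TensorAlgebra K V)
  unit := Algebra.linearMap K (TensorAlgebra K V)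
  comul := comulT c
  counit := TensorAlgebra.algebraMapInv.toLinearMap
  braid := braidTT c

end TensorAlgebra

/-! ## Quotients of `T(V,c)` -/

section Quotients

variable {K : Type u} [Field K] {V : Type v} [AddCommGroup V] [Module K V]

/-- The subspace `I ⊗ A + A ⊗ I` of `A ⊗ A`. -/
def tensorIdeal (K : Type u) [Field K] {A : Type v} [Ring A] [Algebra K A] (I : Ideal A) :
    Submodule K (A ⊗[K] A) :=
  LinearMap.range (TensorProduct.mapIncl (I.restrictScalars K) ⊤) ⊔
    LinearMap.range (TensorProduct.mapIncl ⊤ (I.restrictScalars K))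

/-- A two-sided ideal `I` of `T(V,c)` such that `Δ`, `ε` and `c_T` induce maps on `T/I`, i.e. such
that `T/I` is a quotient braided bialgebra of `T(V,c)`. -/
structure BraidedBiideal (c : V ⊗[K] V →ₗ[K] V ⊗[K] V) where
  ideal : Ideal (TensorAlgebra K V)
  isTwoSided : ideal.IsTwoSided
  comul_mem : ∀ x ∈ ideal, comulT c x ∈ tensorIdeal K ideal
  counit_mem : ∀ x ∈ ideal, TensorAlgebra.algebraMapInv x = 0
  braid_mem : ∀ z ∈ tensorIdeal K ideal, braidTT c z ∈ tensorIdeal K ideal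

attribute [instance] BraidedBiideal.isTwoSided

namespace BraidedBiideal

variable {c : V ⊗[K] V →ₗ[K] V ⊗[K] V}

/-- The quotient algebra `T/I`. -/
def Quo (I : BraidedBiideal c) : Type (max u v) := TensorAlgebra K V ⧸ I.ideal

instance (I : BraidedBiideal c) : Ring I.Quo :=
  inferInstanceAs (Ring (TensorAlgebra K V ⧸ I.ideal))

instance (I : BraidedBiideal c) : Algebra K I.Quo :=
  inferInstanceAs (Algebra K (TensorAlgebra K V ⧸ I.ideal))

/-- The projection `T → T/I`. -/
def proj (I : BraidedBiideal c) : TensorAlgebra K V →ₐ[K] I.Quo := Ideal.Quotient.mkₐ K I.ideal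

theorem proj_surjective (I : BraidedBiideal c) : Function.Surjective I.proj :=
  Ideal.Quotient.mkₐ_surjective K I.ideal

theorem proj_eq_zero_iff (I : BraidedBiideal c) (x : TensorAlgebra K V) :
    I.proj x = 0 ↔ x ∈ I.ideal :=
  Ideal.Quotient.eq_zero_iff_mem

/-- The projection `T ⊗ T → T/I ⊗ T/I`. -/
def proj₂ (I : BraidedBiideal c) :
    TensorAlgebra K V ⊗[K] TensorAlgebra K V →ₗ[K] I.Quo ⊗[K] I.Quo :=
  TensorProduct.map I.proj.toLinearMap I.proj.toLinearMap

theorem proj₂_eq_zero (I : BraidedBiideal c) {z : TensorAlgebra K V ⊗[K] TensorAlgebra K V}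
    (hz : z ∈ tensorIdeal K I.ideal) : I.proj₂ z = 0 := by
  have h : tensorIdeal K I.ideal ≤ LinearMap.ker I.proj₂ := by
    refine sup_le ?_ ?_
    · rw [LinearMap.range_le_ker_iff]
      refine TensorProduct.ext' fun x y => ?_
      have hx : I.proj (x : TensorAlgebra K V) = 0 := (I.proj_eq_zero_iff _).2 x.2
      simp [proj₂, TensorProduct.mapIncl, hx]
    · rw [LinearMap.range_le_ker_iff]
      refine TensorProduct.ext' fun x y => ?_
      have hy : I.proj (y : TensorAlgebra K V) = 0 := (I.proj_eq_zero_iff _).2 y.2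
      simp [proj₂, TensorProduct.mapIncl, hy]
  exact h hz

/-- Factor a linear map vanishing on `I` through `T/I`. -/
def lift (I : BraidedBiideal c) {M : Type w} [AddCommGroup M] [Module K M]
    (f : TensorAlgebra K V →ₗ[K] M) (hf : ∀ x ∈ I.ideal, f x = 0) : I.Quo →ₗ[K] M :=
  (I.ideal.restrictScalars K).liftQ f (fun x hx => hf x hx) ∘ₗ
    (Submodule.Quotient.restrictScalarsEquiv K I.ideal).symm.toLinearMap

theorem lift_proj (I : BraidedBiideal c) {M : Type w} [AddCommGroup M] [Module K M]
    (f : TensorAlgebra K V →ₗ[K] M) (hf : ∀ x ∈ I.ideal, f x = 0) (x : TensorAlgebra K V) :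
    I.lift f hf (I.proj x) = f x := rfl

theorem tmul_mem_left (I : BraidedBiideal c) {x : TensorAlgebra K V} (hx : x ∈ I.ideal)
    (y : TensorAlgebra K V) : x ⊗ₜ y ∈ tensorIdeal K I.ideal :=
  Submodule.mem_sup_left ⟨⟨x, hx⟩ ⊗ₜ ⟨y, trivial⟩, rfl⟩

theorem tmul_mem_right (I : BraidedBiideal c) (x : TensorAlgebra K V) {y : TensorAlgebra K V}
    (hy : y ∈ I.ideal) : x ⊗ₜ y ∈ tensorIdeal K I.ideal :=
  Submodule.mem_sup_right ⟨⟨x, trivial⟩ ⊗ₜ ⟨y, hy⟩, rfl⟩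

/-- The map `T ⊗ T/I → T/I ⊗ T/I` induced by `c_T`, in curried form. -/
def quoBraidAux (I : BraidedBiideal c) :
    TensorAlgebra K V →ₗ[K] I.Quo →ₗ[K] I.Quo ⊗[K] I.Quo :=
  (I.lift (M := TensorAlgebra K V →ₗ[K] I.Quo ⊗[K] I.Quo)
    (TensorProduct.curry (I.proj₂ ∘ₗ braidTT c)).flip
    (fun _ hy => LinearMap.ext fun x =>
      I.proj₂_eq_zero (I.braid_mem _ (I.tmul_mem_right x hy)))).flip

/-- The braiding of `T/I` induced by `c_T`. -/
def quoBraid (I : BraidedBiideal c) : I.Quo ⊗[K] I.Quo →ₗ[K] I.Quo ⊗[K] I.Quo :=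
  TensorProduct.lift
    (I.lift (M := I.Quo →ₗ[K] I.Quo ⊗[K] I.Quo) I.quoBraidAux
      (fun x hx => LinearMap.ext fun y => by
        obtain ⟨y, rfl⟩ := I.proj_surjective y
        exact I.proj₂_eq_zero (I.braid_mem _ (I.tmul_mem_left hx y))))

/-- The braided bialgebra structure on `T/I` induced by that of `T(V,c)`. -/
def data (I : BraidedBiideal c) : BraidedBialgebraData K I.Quo where
  mul := LinearMap.mul' K I.Quo
  unit := Algebra.linearMap K I.Quo
  comul := I.lift (I.proj₂ ∘ₗ comulT c) (fun x hx => I.proj₂_eq_zero (I.comul_mem x hx))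
  counit := I.lift TensorAlgebra.algebraMapInv.toLinearMap I.counit_mem
  braid := I.quoBraid

/-- The projection `T(V,c) → T/I` is a morphism of braided bialgebras. -/
theorem isHom_proj (I : BraidedBiideal c) : (tensorData c).IsHom I.data I.proj.toLinearMap where
  map_mul := TensorProduct.ext' fun x y => map_mul I.proj x y
  map_unit := LinearMap.ext fun x => I.proj.commutes x
  map_comul := LinearMap.ext fun _ => rfl
  map_counit := LinearMap.ext fun _ => rfl
  map_braid := TensorProduct.ext' fun _ _ => rfl

/-- The space of primitive elements of `T/I`. -/
abbrev prim (I : BraidedBiideal c) : Submodule K I.Quo := I.data.primitives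

/-- The canonical map `V → T/I`. -/
def incl (I : BraidedBiideal c) : V →ₗ[K] I.Quo := I.proj.toLinearMap ∘ₗ TensorAlgebra.ι K

/-- The image of `V` in `T/I`. -/
abbrev imageV (I : BraidedBiideal c) : Submodule K I.Quo := LinearMap.range I.incl

/-- For a linear map `b : P(T/I) → V`, the map `i b : P(T/I) → i(V)`. -/
def inclBracket (I : BraidedBiideal c) (b : I.prim →ₗ[K] V) : I.prim →ₗ[K] I.imageV :=
  I.incl.rangeRestrict ∘ₗ b

end BraidedBiideal

/-! ## Brackets and universal enveloping algebras -/

/-- `f : X ⊗ Y → Y ⊗ X` is the restriction of `c : B ⊗ B → B ⊗ B`. -/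
def IsRestriction {B : Type v} [AddCommGroup B] [Module K B] (c : B ⊗[K] B →ₗ[K] B ⊗[K] B)
    (X Y : Submodule K B) (f : X ⊗[K] Y →ₗ[K] Y ⊗[K] X) : Prop :=
  TensorProduct.mapIncl Y X ∘ₗ f = c ∘ₗ TensorProduct.mapIncl X Y

/-- A bracket on `(V,c)`. The braided bialgebras `U^[n]` of the definition are the quotients
`T(V,c)/I_n` with their induced structure; the maps `b^[n] : P(U^[n]) → V` are `map n`, and
`i^[n] : V → P(U^[n])` is the canonical map. -/
structure Bracket (c : V ⊗[K] V →ₗ[K] V ⊗[K] V) where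
  /-- The kernel `I_n` of `T(V,c) → U^[n]`. -/
  biideal : ℕ → BraidedBiideal c
  /-- The map `b^[n] : P^[n] → V`. -/
  map : ∀ n, (biideal n).prim →ₗ[K] V
  /-- `U^[0] = T(V,c)`. -/
  biideal_zero : (biideal 0).ideal = ⊥
  /-- `U^[n+1]` is the quotient of `U^[n]` by the two-sided ideal generated by the image of
  `Id - i^[n] b^[n]` on `P^[n]`. -/
  biideal_succ : ∀ n, (biideal (n + 1)).ideal =
    (TwoSidedIdeal.asIdeal (TwoSidedIdeal.span
      {x : (biideal n).Quo | ∃ p : (biideal n).prim,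
        x = (p : (biideal n).Quo) - (biideal n).incl (map n p)})).comap
      (biideal n).proj
  /-- `c_{V^[n]} (i b ⊗ V^[n]) = (V^[n] ⊗ i b) c_{P^[n],V^[n]}` -/
  braid_left : ∀ n, ∃ (cVV : (biideal n).imageV ⊗[K] (biideal n).imageV →ₗ[K]
        (biideal n).imageV ⊗[K] (biideal n).imageV)
      (cPV : (biideal n).prim ⊗[K] (biideal n).imageV →ₗ[K]
        (biideal n).imageV ⊗[K] (biideal n).prim),
    IsRestriction (biideal n).data.braid (biideal n).imageV (biideal n).imageV cVV ∧
    IsRestriction (biideal n).data.braid (biideal n).prim (biideal n).imageV cPV ∧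
    cVV ∘ₗ ((biideal n).inclBracket (map n)).rTensor (biideal n).imageV =
      ((biideal n).inclBracket (map n)).lTensor (biideal n).imageV ∘ₗ cPV
  /-- `c_{V^[n]} (V^[n] ⊗ i b) = (i b ⊗ V^[n]) c_{V^[n],P^[n]}` -/
  braid_right : ∀ n, ∃ (cVV : (biideal n).imageV ⊗[K] (biideal n).imageV →ₗ[K]
        (biideal n).imageV ⊗[K] (biideal n).imageV)
      (cVP : (biideal n).imageV ⊗[K] (biideal n).prim →ₗ[K]
        (biideal n).prim ⊗[K] (biideal n).imageV),
    IsRestriction (biideal n).data.braid (biideal n).imageV (biideal n).imageV cVV ∧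
    IsRestriction (biideal n).data.braid (biideal n).imageV (biideal n).prim cVP ∧
    cVV ∘ₗ ((biideal n).inclBracket (map n)).lTensor (biideal n).imageV =
      ((biideal n).inclBracket (map n)).rTensor (biideal n).imageV ∘ₗ cVP

namespace BraidedBiideal

variable {c : V ⊗[K] V →ₗ[K] V ⊗[K] V}

theorem tensorIdeal_mono {I J : Ideal (TensorAlgebra K V)} (h : I ≤ J) :
    tensorIdeal K I ≤ tensorIdeal K J := by
  have h' : I.restrictScalars K ≤ J.restrictScalars K := h
  exact sup_le_sup (TensorProduct.range_mapIncl_mono h' le_rfl)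
    (TensorProduct.range_mapIncl_mono le_rfl h')

theorem isTwoSided_iSup (I : ℕ → BraidedBiideal c) : (⨆ n, (I n).ideal).IsTwoSided := by
  refine ⟨fun {a} b ha => ?_⟩
  refine Submodule.iSup_induction (fun n => (I n).ideal)
    (motive := fun a => a * b ∈ ⨆ n, (I n).ideal) ha ?_ ?_ ?_
  · intro n x hx
    exact Submodule.mem_iSup_of_mem n ((I n).ideal.mul_mem_right b hx)
  · simp
  · intro x y hx hy
    rw [add_mul]
    exact add_mem hx hy

/-- The sum of a sequence of biideals. -/
def iSup (I : ℕ → BraidedBiideal c) : BraidedBiideal c where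
  ideal := ⨆ n, (I n).ideal
  isTwoSided := isTwoSided_iSup I
  comul_mem := fun x hx => by
    refine Submodule.iSup_induction (fun n => (I n).ideal)
      (motive := fun x => comulT c x ∈ tensorIdeal K (⨆ n, (I n).ideal)) hx ?_ ?_ ?_
    · exact fun n x hx => tensorIdeal_mono (le_iSup (fun n => (I n).ideal) n)
        ((I n).comul_mem x hx)
    · simp
    · intro x y hx hy
      rw [map_add]
      exact add_mem hx hy
  counit_mem := fun x hx => by
    refine Submodule.iSup_induction (fun n => (I n).ideal)
      (motive := fun x => TensorAlgebra.algebraMapInv x = 0) hx ?_ ?_ ?_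
    · exact fun n x hx => (I n).counit_mem x hx
    · simp
    · intro x y hx hy
      rw [map_add, hx, hy, add_zero]
  braid_mem := fun z hz => by
    have key : ∀ x ∈ (⨆ n, (I n).ideal), ∀ y : TensorAlgebra K V,
        braidTT c (x ⊗ₜ y) ∈ tensorIdeal K (⨆ n, (I n).ideal) ∧
        braidTT c (y ⊗ₜ x) ∈ tensorIdeal K (⨆ n, (I n).ideal) := by
      intro x hx y
      refine Submodule.iSup_induction (fun n => (I n).ideal)
        (motive := fun x => braidTT c (x ⊗ₜ y) ∈ tensorIdeal K (⨆ n, (I n).ideal) ∧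
          braidTT c (y ⊗ₜ x) ∈ tensorIdeal K (⨆ n, (I n).ideal)) hx ?_ ?_ ?_
      · exact fun n x hx =>
          ⟨tensorIdeal_mono (le_iSup (fun n => (I n).ideal) n)
            ((I n).braid_mem _ ((I n).tmul_mem_left hx y)),
          tensorIdeal_mono (le_iSup (fun n => (I n).ideal) n)
            ((I n).braid_mem _ ((I n).tmul_mem_right y hx))⟩
      · simp
      · intro x x' hx hx'
        rw [TensorProduct.add_tmul, TensorProduct.tmul_add, map_add, map_add]
        exact ⟨add_mem hx.1 hx'.1, add_mem hx.2 hx'.2⟩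
    have h : tensorIdeal K (⨆ n, (I n).ideal) ≤
        (tensorIdeal K (⨆ n, (I n).ideal)).comap (braidTT c) := by
      refine sup_le ?_ ?_
      · rintro _ ⟨w, rfl⟩
        induction w with
        | zero => simp
        | tmul x y => exact (key x x.2 y).1
        | add a b ha hb => rw [map_add]; exact add_mem ha hb
      · rintro _ ⟨w, rfl⟩
        induction w with
        | zero => simp
        | tmul x y => exact (key y y.2 x).2
        | add a b ha hb => rw [map_add]; exact add_mem ha hb
    exact h hz

end BraidedBiideal

namespace Bracket

variable {c : V ⊗[K] V →ₗ[K] V ⊗[K] V}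

/-- The kernel of `π_U : T(V,c) → U(V,c,b)`, the union of the increasing sequence `I_n`. -/
def limit (b : Bracket c) : BraidedBiideal c := BraidedBiideal.iSup b.biideal

/-- The universal enveloping algebra `U(V,c,b)`: the direct limit of the surjections
`T(V,c)/I_0 → T(V,c)/I_1 → ⋯`, that is, the quotient of `T(V,c)` by the union of the `I_n`. -/
abbrev U (b : Bracket c) : Type (max u v) := b.limit.Quo

/-- The braided bialgebra structure of `U(V,c,b)`, induced by that of `T(V,c)`. -/
def data (b : Bracket c) : BraidedBialgebraData K b.U := b.limit.data

/-- The projection `π_U : T(V,c) → U(V,c,b)`. -/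
def piU (b : Bracket c) : TensorAlgebra K V →ₐ[K] b.U := b.limit.proj

/-- The canonical map `i_U : V → U(V,c,b)`. -/
def iU (b : Bracket c) : V →ₗ[K] b.U := b.limit.incl

end Bracket

/-- `(V,c,b)` is a braided Lie algebra: `c` is a braiding, `b` is a bracket on `(V,c)`, and
`i_U : V → U(V,c,b)` is injective. -/
structure IsBraidedLieAlgebra (c : V ⊗[K] V →ₗ[K] V ⊗[K] V) (b : Bracket c) : Prop where
  isBraiding : IsBraiding c
  injective_iU : Function.Injective b.iU

end Quotients

/-! ## Filtrations and their graded objects -/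

section Filtrations

variable {K : Type u} [Field K] {M : Type v} [AddCommGroup M] [Module K M]

/-- The term of index `n - 1` of a filtration, with the convention `M_{-1} = 0`. -/
def pred (F : ℕ → Submodule K M) : ℕ → Submodule K M
  | 0 => ⊥
  | n + 1 => F n

/-- The component `F_n / F_{n-1}`. -/
def GrPiece (F : ℕ → Submodule K M) (n : ℕ) : Type v :=
  F n ⧸ (pred F n).submoduleOf (F n)

instance (F : ℕ → Submodule K M) (n : ℕ) : AddCommGroup (GrPiece F n) :=
  inferInstanceAs (AddCommGroup (F n ⧸ (pred F n).submoduleOf (F n)))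

instance (F : ℕ → Submodule K M) (n : ℕ) : Module K (GrPiece F n) :=
  inferInstanceAs (Module K (F n ⧸ (pred F n).submoduleOf (F n)))

/-- The projection `F_n → F_n / F_{n-1}`. -/
def GrPiece.mk (F : ℕ → Submodule K M) (n : ℕ) : F n →ₗ[K] GrPiece F n :=
  ((pred F n).submoduleOf (F n)).mkQ

/-- The graded vector space `⨁ n, F_n / F_{n-1}`. -/
abbrev Gr (F : ℕ → Submodule K M) : Type v := ⨁ n, GrPiece F n

/-- The projection `F_n → F_n / F_{n-1}`, with values in the graded object. -/
def cls (F : ℕ → Submodule K M) (n : ℕ) : F n →ₗ[K] Gr F :=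
  DirectSum.lof K ℕ (GrPiece F) n ∘ₗ GrPiece.mk F n

/-- The homogeneous part `F_n / F_{n-1}` as a subspace of the graded object. -/
def grPart (F : ℕ → Submodule K M) (n : ℕ) : Submodule K (Gr F) :=
  LinearMap.range (DirectSum.lof K ℕ (GrPiece F) n)

theorem pred_mono {F F' : ℕ → Submodule K M} (h : ∀ n, F n ≤ F' n) (n : ℕ) :
    pred F n ≤ pred F' n := by
  cases n with
  | zero => exact le_rfl
  | succ n => exact h n

/-- The map `F_n / F_{n-1} → F'_n / F'_{n-1}` induced by the identity of `M` when `F_n ⊆ F'_n` for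
all `n`. -/
def GrPiece.map {F F' : ℕ → Submodule K M} (h : ∀ n, F n ≤ F' n) (n : ℕ) :
    GrPiece F n →ₗ[K] GrPiece F' n :=
  Submodule.mapQ ((pred F n).submoduleOf (F n)) ((pred F' n).submoduleOf (F' n))
    (Submodule.inclusion (h n)) (fun _ hx => pred_mono h n hx)

/-- The graded map induced by the identity of `M` when `F_n ⊆ F'_n` for all `n`. -/
def grId {F F' : ℕ → Submodule K M} (h : ∀ n, F n ≤ F' n) : Gr F →ₗ[K] Gr F' :=
  DirectSum.lmap (GrPiece.map h)

/-- `E` is the structure on the graded object of the filtration `F` induced by the structure `D` of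
`M`; in particular `D` respects the filtration. -/
structure IsInduced (D : BraidedBialgebraData K M) (F : ℕ → Submodule K M)
    (E : BraidedBialgebraData K (Gr F)) : Prop where
  monotone : Monotone F
  exhaustive : ⨆ n, F n = ⊤
  mul_mem : ∀ i j (x : F i) (y : F j), D.mul ((x : M) ⊗ₜ (y : M)) ∈ F (i + j)
  mul_eq : ∀ i j (x : F i) (y : F j),
    E.mul (cls F i x ⊗ₜ cls F j y) = cls F (i + j) ⟨_, mul_mem i j x y⟩
  one_mem : D.one ∈ F 0
  one_eq : E.one = cls F 0 ⟨_, one_mem⟩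
  comul_mem : ∀ n (x : F n), D.comul x ∈
    ⨆ p ∈ Finset.HasAntidiagonal.antidiagonal n, LinearMap.range (TensorProduct.mapIncl (F p.1) (F p.2))
  comul_eq : ∀ n (x : F n) (z : ∀ p : ℕ × ℕ, F p.1 ⊗[K] F p.2),
    D.comul x = ∑ p ∈ Finset.HasAntidiagonal.antidiagonal n,
        TensorProduct.mapIncl (F p.1) (F p.2) (z p) →
    E.comul (cls F n x) =
      ∑ p ∈ Finset.HasAntidiagonal.antidiagonal n, TensorProduct.map (cls F p.1) (cls F p.2) (z p)
  counit_eq : ∀ n (x : F n), E.counit (cls F n x) = if n = 0 then D.counit x else 0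
  braid_mem : ∀ i j (x : F i) (y : F j), D.braid ((x : M) ⊗ₜ (y : M)) ∈
    LinearMap.range (TensorProduct.mapIncl (F j) (F i))
  braid_eq : ∀ i j (x : F i) (y : F j) (z : F j ⊗[K] F i),
    D.braid ((x : M) ⊗ₜ (y : M)) = TensorProduct.mapIncl (F j) (F i) z →
    E.braid (cls F i x ⊗ₜ cls F j y) = TensorProduct.map (cls F j) (cls F i) z

/-- `D` is a subcoalgebra for the comultiplication `Δ`: `Δ(D) ⊆ D ⊗ D`. -/
def IsSubcoalgebra (Δ : M →ₗ[K] M ⊗[K] M) (D : Submodule K M) : Prop :=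
  ∀ x ∈ D, Δ x ∈ LinearMap.range (TensorProduct.mapIncl D D)

/-- `D` is a simple subcoalgebra. -/
def IsSimpleSubcoalgebra (Δ : M →ₗ[K] M ⊗[K] M) (D : Submodule K M) : Prop :=
  IsSubcoalgebra Δ D ∧ D ≠ ⊥ ∧ ∀ E ≤ D, IsSubcoalgebra Δ E → E = ⊥ ∨ E = D

/-- The coradical: the sum of all simple subcoalgebras. -/
def coradical (Δ : M →ₗ[K] M ⊗[K] M) : Submodule K M :=
  sSup {D | IsSimpleSubcoalgebra Δ D}

/-- The coradical filtration: `C_0` is the coradical and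
`C_{n+1} = Δ⁻¹(C ⊗ C_n + C_0 ⊗ C)`. -/
def coradicalFiltration (Δ : M →ₗ[K] M ⊗[K] M) : ℕ → Submodule K M
  | 0 => coradical Δ
  | n + 1 => (LinearMap.range (TensorProduct.mapIncl ⊤ (coradicalFiltration Δ n)) ⊔
      LinearMap.range (TensorProduct.mapIncl (coradical Δ) ⊤)).comap Δ

end Filtrations

namespace Bracket

variable {K : Type u} [Field K] {V : Type v} [AddCommGroup V] [Module K V]
  {c : V ⊗[K] V →ₗ[K] V ⊗[K] V}

/-- The image `π_U(V)` of `V` in `U`. -/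
def imV (b : Bracket c) : Submodule K b.U := LinearMap.range b.iU

/-- The standard filtration `U_(n) = π_U(T_(n))`, where `T_(n)` is the sum of the subspaces
`V^{⊗ i}` of the tensor algebra for `i ≤ n`. -/
def stdFiltration (b : Bracket c) (n : ℕ) : Submodule K b.U :=
  (⨆ i ∈ Finset.range (n + 1), LinearMap.range (TensorAlgebra.ι K (M := V)) ^ i).map
    b.piU.toLinearMap

/-- The coradical filtration `U_n` of `U`. -/
def corFiltration (b : Bracket c) : ℕ → Submodule K b.U := coradicalFiltration b.data.comul

/-- `U` is strictly generated by `V`: the standard and the coradical filtration coincide. -/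
def IsStrictlyGenerated (b : Bracket c) : Prop := ∀ n, b.corFiltration n = b.stdFiltration n

end Bracket

end BraidedLie

end

/-!
The bracket plays no role in the argument beyond the definition of `U`: everything holds for a
quotient `U = T(V,c)/I` of the braided tensor algebra by an ideal compatible with the structure.

*The tensor algebra is a braided bialgebra* (`isBraidedBialgebra_tensorData`). The law for a
structure map of `T = T(V,c)` and a strand running past it from the left to the right says that the
map commutes with the strand (`CommutesWithStrand`). Such maps are closed under composition and
tensor products, strands in `T` are reduced to strands in `V` (`CommutesWithStrand.extend`), and for
these the proof is an induction on the length of words in which the Yang-Baxter equation of `c` is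
the only input. With the recursion `Δ(v t) = (v ⊗ 1 + 1 ⊗ v) Δ(t)`, the remaining laws, among them
coassociativity and the multiplicativity of `Δ`, follow by induction on the length of words from the
fact that the structure maps commute with strands in `V`.

*Quotients and graded objects are braided bialgebras.* Both `T → T/I` and the passage from a
filtered space to its graded space relate elements to symbols (`SymbolRel`). A map has at most one
leading part on symbols, leading parts compose and tensor, and so every law of a braided bialgebra
passes from the elements to the symbols (`IsSymbolStructure.isBraidedBialgebra`). For a filtration
respected by the structure maps the leading parts exist (`IsCompatible.exists_isSymbolStructure`).

*The two filtrations.* The standard filtration is respected by the structure because `V` generates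
`U`, consists of primitive elements, and `V ⊗ V` is stable under the braiding
(`Bracket.isCompatible_stdFiltration`). As a coalgebra filtration starting with the scalars it is
contained in the coradical filtration and forces the coradical to be `K`
(`IsCompatible.le_coradicalFiltration`, `coradical_eq_span_one`). The coradical filtration of a
connected braided bialgebra is then respected by the structure as well
(`isCompatible_coradicalFiltration`). For the comultiplication this is the associativity of wedges.
For the braiding one inducts on the step of the filtration, pulling a strand across `Δ`, which shows
`c(U_i ⊗ U) ⊆ U ⊗ U_i` and `c(U ⊗ U_j) ⊆ U_j ⊗ U`. For the multiplication one applies `Δ` to a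
product.

*The equivalences* (`tfae_eq_coradicalFiltration`). Injectivity and surjectivity of the comparison
map are the two degreewise conditions on the filtrations, and either of them gives equality of the
filtrations by induction on the degree, the former since the standard filtration is exhaustive. If
the primitive elements of the graded bialgebra have degree one, then an element of `U_(n) ∩ U_{n-1}`
has, by induction, a primitive class of degree `n`, which must vanish when `n ≥ 2`
(`inf_pred_le_of_primitives_le`). Conversely, a homogeneous primitive class of degree `n ≥ 2` has a
representative in `K ∧ U_(n-2)`, which is `U_(n-1)` if the filtrations agree
(`primitives_le_grPart_one`).
-/

namespace BraidedLie

noncomputable section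

/-! ### Crossing a strand -/

section Strand

variable {K S N P Q N' P' : Type*} [Field K] [AddCommGroup S] [Module K S]
  [AddCommGroup N] [Module K N] [AddCommGroup P] [Module K P] [AddCommGroup Q] [Module K Q]
  [AddCommGroup N'] [Module K N'] [AddCommGroup P'] [Module K P']

/-- The second half of the crossing of a strand with `N ⊗ P`, when the strand stands between `N`
and `P`. -/
def crossSecond (κP : S ⊗[K] P →ₗ[K] P ⊗[K] S) :
    (N ⊗[K] S) ⊗[K] P →ₗ[K] (N ⊗[K] P) ⊗[K] S :=
  (TensorProduct.assoc K N P S).symm.toLinearMap ∘ₗ κP.lTensor N ∘ₗ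
    (TensorProduct.assoc K N S P).toLinearMap

/-- The crossing of a strand `S` with `N ⊗ P`, for given crossings with `N` and with `P`. -/
def crossTensor (κN : S ⊗[K] N →ₗ[K] N ⊗[K] S) (κP : S ⊗[K] P →ₗ[K] P ⊗[K] S) :
    S ⊗[K] (N ⊗[K] P) →ₗ[K] (N ⊗[K] P) ⊗[K] S :=
  crossSecond κP ∘ₗ κN.rTensor P ∘ₗ (TensorProduct.assoc K S N P).symm.toLinearMap

@[simp]
theorem crossSecond_tmul (κP : S ⊗[K] P →ₗ[K] P ⊗[K] S) (n : N) (s : S) (p : P) :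
    crossSecond κP ((n ⊗ₜ s) ⊗ₜ p) =
      (TensorProduct.assoc K N P S).symm (n ⊗ₜ κP (s ⊗ₜ p)) := rfl

@[simp]
theorem crossTensor_tmul (κN : S ⊗[K] N →ₗ[K] N ⊗[K] S) (κP : S ⊗[K] P →ₗ[K] P ⊗[K] S)
    (s : S) (n : N) (p : P) :
    crossTensor κN κP (s ⊗ₜ (n ⊗ₜ p)) = crossSecond κP (κN (s ⊗ₜ n) ⊗ₜ p) := rfl

/-- The linear map `f : N → P` commutes with crossing the strand `S`, at the element `n`. -/
def CommutesWithStrandAt (κN : S ⊗[K] N →ₗ[K] N ⊗[K] S) (κP : S ⊗[K] P →ₗ[K] P ⊗[K] S)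
    (f : N →ₗ[K] P) (n : N) : Prop :=
  ∀ s, κP (s ⊗ₜ f n) = f.rTensor S (κN (s ⊗ₜ n))

/-- The linear map `f : N → P` commutes with crossing the strand `S`. -/
def CommutesWithStrand (κN : S ⊗[K] N →ₗ[K] N ⊗[K] S) (κP : S ⊗[K] P →ₗ[K] P ⊗[K] S)
    (f : N →ₗ[K] P) : Prop :=
  ∀ n, CommutesWithStrandAt κN κP f n

section At

variable {κN : S ⊗[K] N →ₗ[K] N ⊗[K] S} {κP : S ⊗[K] P →ₗ[K] P ⊗[K] S}
  {κQ : S ⊗[K] Q →ₗ[K] Q ⊗[K] S} {κN' : S ⊗[K] N' →ₗ[K] N' ⊗[K] S}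
  {κP' : S ⊗[K] P' →ₗ[K] P' ⊗[K] S}

namespace CommutesWithStrandAt

theorem zero (f : N →ₗ[K] P) : CommutesWithStrandAt κN κP f 0 := fun s => by simp

theorem add {f : N →ₗ[K] P} {n n' : N} (h : CommutesWithStrandAt κN κP f n)
    (h' : CommutesWithStrandAt κN κP f n') : CommutesWithStrandAt κN κP f (n + n') := fun s => by
  simp only [map_add, TensorProduct.tmul_add, h s, h' s]

theorem smul {f : N →ₗ[K] P} {n : N} (k : K) (h : CommutesWithStrandAt κN κP f n) :
    CommutesWithStrandAt κN κP f (k • n) := fun s => by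
  simp only [map_smul, TensorProduct.tmul_smul, h s]

theorem comp {g : P →ₗ[K] Q} {f : N →ₗ[K] P} {n : N} (hg : CommutesWithStrandAt κP κQ g (f n))
    (hf : CommutesWithStrandAt κN κP f n) : CommutesWithStrandAt κN κQ (g ∘ₗ f) n := fun s => by
  rw [LinearMap.comp_apply, hg, hf, LinearMap.rTensor_comp_apply]

/-- If `f` and `g ∘ f` commute with the strand, so does `g` on the image of `f`. -/
theorem of_comp {g : P →ₗ[K] Q} {f : N →ₗ[K] P} {n : N} (hf : CommutesWithStrandAt κN κP f n)
    (hgf : CommutesWithStrandAt κN κQ (g ∘ₗ f) n) : CommutesWithStrandAt κP κQ g (f n) :=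
  fun s => by
    rw [hf, ← LinearMap.rTensor_comp_apply, ← hgf, LinearMap.comp_apply]

theorem map {f : N →ₗ[K] P} {g : N' →ₗ[K] P'} {n : N} {n' : N'}
    (hf : CommutesWithStrandAt κN κP f n) (hg : CommutesWithStrandAt κN' κP' g n') :
    CommutesWithStrandAt (crossTensor κN κN') (crossTensor κP κP') (TensorProduct.map f g)
      (n ⊗ₜ n') := by
  intro s
  rw [TensorProduct.map_tmul, crossTensor_tmul, crossTensor_tmul, hf]
  generalize κN (s ⊗ₜ n) = q
  induction q with
  | zero => simp
  | add a b ha hb => simp only [map_add, TensorProduct.add_tmul, ha, hb]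
  | tmul n s =>
    rw [LinearMap.rTensor_tmul, crossSecond_tmul, crossSecond_tmul, hg]
    generalize κN' (s ⊗ₜ n') = q
    induction q with
    | zero => simp
    | add a b ha hb => simp only [map_add, TensorProduct.tmul_add, ha, hb]
    | tmul n' s => simp

end CommutesWithStrandAt

namespace CommutesWithStrand

theorem id (κN : S ⊗[K] N →ₗ[K] N ⊗[K] S) : CommutesWithStrand κN κN LinearMap.id :=
  fun n s => by simp

theorem comp {g : P →ₗ[K] Q} {f : N →ₗ[K] P} (hg : CommutesWithStrand κP κQ g)
    (hf : CommutesWithStrand κN κP f) : CommutesWithStrand κN κQ (g ∘ₗ f) :=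
  fun n => (hg (f n)).comp (hf n)

theorem add {f g : N →ₗ[K] P} (hf : CommutesWithStrand κN κP f)
    (hg : CommutesWithStrand κN κP g) : CommutesWithStrand κN κP (f + g) := fun n s => by
  rw [LinearMap.add_apply, TensorProduct.tmul_add, map_add κP, hf n s, hg n s,
    LinearMap.rTensor_add, LinearMap.add_apply]

theorem map {f : N →ₗ[K] P} {g : N' →ₗ[K] P'} (hf : CommutesWithStrand κN κP f)
    (hg : CommutesWithStrand κN' κP' g) :
    CommutesWithStrand (crossTensor κN κN') (crossTensor κP κP') (TensorProduct.map f g) := by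
  intro z
  induction z with
  | zero => exact CommutesWithStrandAt.zero _
  | add a b ha hb => exact ha.add hb
  | tmul n n' => exact (hf n).map (hg n')

theorem lTensor {g : N' →ₗ[K] P'} (hg : CommutesWithStrand κN' κP' g) :
    CommutesWithStrand (crossTensor κN κN') (crossTensor κN κP') (g.lTensor N) :=
  (CommutesWithStrand.id κN).map hg

theorem rTensor {f : N →ₗ[K] P} (hf : CommutesWithStrand κN κP f) :
    CommutesWithStrand (crossTensor κN κN') (crossTensor κP κN') (f.rTensor N') :=
  hf.map (CommutesWithStrand.id κN')

theorem assoc (κN : S ⊗[K] N →ₗ[K] N ⊗[K] S) (κP : S ⊗[K] P →ₗ[K] P ⊗[K] S)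
    (κQ : S ⊗[K] Q →ₗ[K] Q ⊗[K] S) :
    CommutesWithStrand (crossTensor (crossTensor κN κP) κQ) (crossTensor κN (crossTensor κP κQ))
      (TensorProduct.assoc K N P Q).toLinearMap := by
  intro z s
  induction z with
  | zero => simp
  | add a b ha hb => simp only [map_add, TensorProduct.tmul_add, ha, hb]
  | tmul z q =>
  induction z with
  | zero => simp
  | add a b ha hb => simp only [map_add, TensorProduct.tmul_add, TensorProduct.add_tmul, ha, hb]
  | tmul n p =>
    simp only [LinearEquiv.coe_coe, TensorProduct.assoc_tmul, crossTensor_tmul]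
    generalize κN (s ⊗ₜ n) = r
    induction r with
    | zero => simp
    | add a b ha hb => simp only [map_add, TensorProduct.add_tmul, ha, hb]
    | tmul n s =>
      simp only [crossSecond_tmul, crossTensor_tmul]
      generalize κP (s ⊗ₜ p) = r
      induction r with
      | zero => simp
      | add a b ha hb =>
        simp only [map_add, TensorProduct.add_tmul, TensorProduct.tmul_add, ha, hb]
      | tmul p s =>
        simp only [crossSecond_tmul, TensorProduct.assoc_symm_tmul]
        generalize κQ (s ⊗ₜ q) = r
        induction r with
        | zero => simp
        | add a b ha hb =>
          simp only [map_add, TensorProduct.tmul_add, ha, hb]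
        | tmul q s => simp

theorem assoc_symm (κN : S ⊗[K] N →ₗ[K] N ⊗[K] S) (κP : S ⊗[K] P →ₗ[K] P ⊗[K] S)
    (κQ : S ⊗[K] Q →ₗ[K] Q ⊗[K] S) :
    CommutesWithStrand (crossTensor κN (crossTensor κP κQ)) (crossTensor (crossTensor κN κP) κQ)
      (TensorProduct.assoc K N P Q).symm.toLinearMap := by
  intro z s
  obtain ⟨w, rfl⟩ := (TensorProduct.assoc K N P Q).surjective z
  have h := assoc κN κP κQ w s
  simp only [LinearEquiv.coe_coe] at h ⊢
  rw [h, LinearEquiv.symm_apply_apply, ← LinearMap.comp_apply, ← LinearMap.rTensor_comp]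
  simp

end CommutesWithStrand

end At

end Strand

/-! ### The braiding of the tensor algebra -/

section TensorBraid

variable {K V : Type*} [Field K] [AddCommGroup V] [Module K V]
  (c : V ⊗[K] V →ₗ[K] V ⊗[K] V)

/-- Every element of the tensor algebra is a combination of products `v₁ (v₂ (⋯ 1))`. -/
theorem tensorAlgebra_induction_left {motive : TensorAlgebra K V → Prop} (one : motive 1)
    (ι_mul : ∀ v t, motive t → motive (TensorAlgebra.ι K v * t))
    (add : ∀ s t, motive s → motive t → motive (s + t))
    (smul : ∀ (k : K) t, motive t → motive (k • t)) (t : TensorAlgebra K V) : motive t := by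
  have key : ∀ a : TensorAlgebra K V, ∀ t, motive t → motive (a * t) := by
    intro a
    induction a using TensorAlgebra.induction with
    | algebraMap k => intro t ht; rw [← Algebra.smul_def]; exact smul k t ht
    | ι v => exact ι_mul v
    | mul a b ha hb => intro t ht; rw [mul_assoc]; exact ha _ (hb _ ht)
    | add a b ha hb => intro t ht; rw [add_mul]; exact add _ _ (ha _ ht) (hb _ ht)
  simpa using key t 1 one

/-- The anti-homomorphism `T → End(T ⊗ V)` describing how a strand crosses elements of `T`. -/
def strandEnd : TensorAlgebra K V →ₐ[K] (Module.End K (TensorAlgebra K V ⊗[K] V))ᵐᵒᵖ :=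
  TensorAlgebra.lift K ((MulOpposite.opLinearEquiv K).toLinearMap ∘ₗ crossRight c)

theorem braidVT_tmul (v : V) (t : TensorAlgebra K V) :
    braidVT c (v ⊗ₜ t) = (strandEnd c t).unop (1 ⊗ₜ v) := rfl

theorem crossRight_apply (w : V) (t : TensorAlgebra K V) (v : V) :
    crossRight c w (t ⊗ₜ v) =
      (LinearMap.mulLeft K t).rTensor V ((TensorAlgebra.ι K).rTensor V (c (v ⊗ₜ w))) := by
  simp only [crossRight, LinearMap.flip_apply, TensorProduct.curry_apply, LinearMap.comp_apply,
    LinearEquiv.coe_coe, TensorProduct.assoc_tmul, LinearMap.lTensor_tmul]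
  generalize c (v ⊗ₜ w) = q
  induction q with
  | zero => simp
  | add a b ha hb => simp only [map_add, TensorProduct.tmul_add, ha, hb]
  | tmul x y => simp

theorem strandEnd_ι (w : V) : (strandEnd c (TensorAlgebra.ι K w)).unop = crossRight c w := by
  simp [strandEnd]

/-- A strand crossing `y` does not see the elements of `T` to its left. -/
theorem strandEnd_mulLeft (y a : TensorAlgebra K V) (z : TensorAlgebra K V ⊗[K] V) :
    (strandEnd c y).unop ((LinearMap.mulLeft K a).rTensor V z) =
      (LinearMap.mulLeft K a).rTensor V ((strandEnd c y).unop z) := by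
  induction y using TensorAlgebra.induction generalizing z with
  | algebraMap k =>
    simp [AlgHom.commutes, MulOpposite.algebraMap_apply, Module.algebraMap_end_apply]
  | ι w =>
    rw [strandEnd_ι]
    induction z with
    | zero => simp
    | add z z' hz hz' => simp only [map_add, hz, hz']
    | tmul t v =>
      rw [LinearMap.rTensor_tmul, crossRight_apply, crossRight_apply, LinearMap.mulLeft_apply,
        LinearMap.mulLeft_mul, LinearMap.rTensor_comp_apply]
  | mul x y hx hy => simp [hx, hy]
  | add x y hx hy => simp [hx, hy]

theorem strandEnd_tmul (y a : TensorAlgebra K V) (v : V) :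
    (strandEnd c y).unop (a ⊗ₜ v) = (LinearMap.mulLeft K a).rTensor V (braidVT c (v ⊗ₜ y)) := by
  rw [braidVT_tmul, ← strandEnd_mulLeft]
  simp

theorem braidVT_one (v : V) : braidVT c (v ⊗ₜ 1) = 1 ⊗ₜ v := by
  simp [braidVT_tmul]

theorem braidVT_ι (v w : V) :
    braidVT c (v ⊗ₜ TensorAlgebra.ι K w) = (TensorAlgebra.ι K).rTensor V (c (v ⊗ₜ w)) := by
  rw [braidVT_tmul, strandEnd_ι, crossRight_apply]
  simp [LinearMap.mulLeft_one]

/-- Multiplication of `T` commutes with the strand `V`. -/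
theorem mul_commutesWithStrand_V :
    CommutesWithStrand (crossTensor (braidVT c) (braidVT c)) (braidVT c)
      (LinearMap.mul' K (TensorAlgebra K V)) := by
  intro z v
  induction z with
  | zero => simp
  | add a b ha hb => simp only [map_add, TensorProduct.tmul_add, ha, hb]
  | tmul x y =>
    rw [LinearMap.mul'_apply, crossTensor_tmul, braidVT_tmul, map_mul, MulOpposite.unop_mul,
      Module.End.mul_apply, ← braidVT_tmul]
    generalize braidVT c (v ⊗ₜ x) = q
    induction q with
    | zero => simp
    | add a b ha hb => simp only [map_add, TensorProduct.add_tmul, ha, hb]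
    | tmul t v =>
      rw [crossSecond_tmul, strandEnd_tmul]
      generalize braidVT c (v ⊗ₜ y) = q
      induction q with
      | zero => simp
      | add a b ha hb => simp only [map_add, TensorProduct.tmul_add, ha, hb]
      | tmul t v => simp

theorem ι_commutesWithStrand_V :
    CommutesWithStrand c (braidVT c) (TensorAlgebra.ι K (M := V)) :=
  fun w v => braidVT_ι c v w

/-- The homomorphism `T → End(T ⊗ T)` describing how elements of `T` move across elements of
`T`. -/
def crossEnd : TensorAlgebra K V →ₐ[K]
    Module.End K (TensorAlgebra K V ⊗[K] TensorAlgebra K V) :=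
  TensorAlgebra.lift K (crossLeft c)

theorem braidTT_tmul (t y : TensorAlgebra K V) : braidTT c (t ⊗ₜ y) = crossEnd c t (y ⊗ₜ 1) := rfl

theorem crossLeft_apply (v : V) (t x : TensorAlgebra K V) :
    crossLeft c v (t ⊗ₜ x) =
      (LinearMap.mulRight K x).lTensor _ ((TensorAlgebra.ι K).lTensor _ (braidVT c (v ⊗ₜ t))) := by
  simp only [crossLeft, TensorProduct.curry_apply, LinearMap.comp_apply,
    LinearEquiv.coe_coe, TensorProduct.assoc_symm_tmul, LinearMap.rTensor_tmul]
  generalize braidVT c (v ⊗ₜ t) = q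
  induction q with
  | zero => simp
  | add a b ha hb => simp only [map_add, TensorProduct.add_tmul, ha, hb]
  | tmul x y => simp

/-- An element moving to the right across elements of `T` does not see what stands on its right. -/
theorem crossEnd_mulRight (a x : TensorAlgebra K V) (z : TensorAlgebra K V ⊗[K] TensorAlgebra K V) :
    crossEnd c a ((LinearMap.mulRight K x).lTensor _ z) =
      (LinearMap.mulRight K x).lTensor _ (crossEnd c a z) := by
  induction a using TensorAlgebra.induction generalizing z with
  | algebraMap k => simp [AlgHom.commutes, Module.algebraMap_end_apply]
  | ι w =>
    simp only [crossEnd, TensorAlgebra.lift_ι_apply]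
    induction z with
    | zero => simp
    | add z z' hz hz' => simp only [map_add, hz, hz']
    | tmul t y =>
      rw [LinearMap.lTensor_tmul, crossLeft_apply, crossLeft_apply, LinearMap.mulRight_apply,
        LinearMap.mulRight_mul, LinearMap.lTensor_comp_apply]
  | mul x y hx hy => simp [hx, hy]
  | add x y hx hy => simp [hx, hy]

theorem crossEnd_tmul (a y x : TensorAlgebra K V) :
    crossEnd c a (y ⊗ₜ x) = (LinearMap.mulRight K x).lTensor _ (braidTT c (a ⊗ₜ y)) := by
  rw [braidTT_tmul, ← crossEnd_mulRight]
  simp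

theorem braidTT_one_left (y : TensorAlgebra K V) : braidTT c (1 ⊗ₜ y) = y ⊗ₜ 1 := by
  simp [braidTT_tmul]

theorem braidTT_ι_left (v : V) (y : TensorAlgebra K V) :
    braidTT c (TensorAlgebra.ι K v ⊗ₜ y) = (TensorAlgebra.ι K).lTensor _ (braidVT c (v ⊗ₜ y)) := by
  simp only [braidTT_tmul, crossEnd, TensorAlgebra.lift_ι_apply, crossLeft_apply,
    LinearMap.mulRight_one]
  simp

theorem braidTT_mul_left (a b y : TensorAlgebra K V) :
    braidTT c ((a * b) ⊗ₜ y) = (LinearMap.mul' K _).lTensor _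
      (braidFst (braidTT c) (a ⊗ₜ braidTT c (b ⊗ₜ y))) := by
  rw [braidTT_tmul, map_mul, Module.End.mul_apply, ← braidTT_tmul]
  generalize braidTT c (b ⊗ₜ y) = q
  induction q with
  | zero => simp
  | add a b ha hb => simp only [map_add, TensorProduct.tmul_add, ha, hb]
  | tmul t v =>
    rw [crossEnd_tmul]
    simp only [braidFst, LinearMap.comp_apply, LinearEquiv.coe_coe, TensorProduct.assoc_symm_tmul,
      LinearMap.rTensor_tmul]
    generalize braidTT c (a ⊗ₜ t) = q
    induction q with
    | zero => simp
    | add a b ha hb => simp only [map_add, TensorProduct.add_tmul, ha, hb]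
    | tmul x y => simp

end TensorBraid

section Strand

variable {K S N : Type*} [Field K] [AddCommGroup S] [Module K S] [AddCommGroup N] [Module K N]

theorem crossTensor_self_eq (c : N ⊗[K] N →ₗ[K] N ⊗[K] N) :
    crossTensor c c =
      (TensorProduct.assoc K N N N).symm.toLinearMap ∘ₗ braidSnd c ∘ₗ braidFst c := by
  refine TensorProduct.ext' fun s z => ?_
  simp [crossTensor, crossSecond, braidFst, braidSnd]

/-- The Yang-Baxter equation says that a crossing commutes with a third strand running past it. -/
theorem isBraiding_iff_commutesWithStrand (c : N ⊗[K] N →ₗ[K] N ⊗[K] N) :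
    IsBraiding c ↔ CommutesWithStrand (crossTensor c c) (crossTensor c c) c := by
  rw [crossTensor_self_eq, IsBraiding]
  constructor
  · intro h n s
    have := congrArg (TensorProduct.assoc K N N N).symm (LinearMap.congr_fun h (s ⊗ₜ n))
    simpa [braidFst, braidSnd] using this.symm
  · intro h
    refine TensorProduct.ext' fun s n => ?_
    have := congrArg (TensorProduct.assoc K N N N) (h n s)
    simpa [braidFst, braidSnd] using this.symm

end Strand

section TensorNat

variable {K V : Type*} [Field K] [AddCommGroup V] [Module K V]
  {c : V ⊗[K] V →ₗ[K] V ⊗[K] V}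

/-- The multiplication `V ⊗ T → T`. -/
def ιMul (K V : Type*) [Field K] [AddCommGroup V] [Module K V] :
    V ⊗[K] TensorAlgebra K V →ₗ[K] TensorAlgebra K V :=
  LinearMap.mul' K _ ∘ₗ (TensorAlgebra.ι K).rTensor _

@[simp]
theorem ιMul_tmul (v : V) (t : TensorAlgebra K V) :
    ιMul K V (v ⊗ₜ t) = TensorAlgebra.ι K v * t := rfl

theorem ιMul_commutesWithStrand :
    CommutesWithStrand (crossTensor c (braidVT c)) (braidVT c) (ιMul K V) :=
  (mul_commutesWithStrand_V c).comp (ι_commutesWithStrand_V c).rTensor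

theorem braidVT_comp_ιMul :
    braidVT c ∘ₗ (ιMul K V).lTensor V =
      (ιMul K V).rTensor V ∘ₗ crossTensor c (braidVT c) := by
  refine TensorProduct.ext' fun v z => ?_
  exact ιMul_commutesWithStrand z v

/-- The Yang-Baxter equation for two strands in `V` and one in `T`, by induction on the word in `T`:
its first letter is split off and treated by the Yang-Baxter equation of `c`. -/
theorem braidVT_commutesWithStrand (hc : IsBraiding c) :
    CommutesWithStrand (crossTensor c (braidVT c)) (crossTensor (braidVT c) c) (braidVT c) := by
  have key : ∀ (t : TensorAlgebra K V) (u : V),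
      CommutesWithStrandAt (crossTensor c (braidVT c)) (crossTensor (braidVT c) c) (braidVT c)
        (u ⊗ₜ t) := by
    intro t
    induction t using tensorAlgebra_induction_left with
    | one =>
      intro u s
      rw [braidVT_one, crossTensor_tmul, crossTensor_tmul, braidVT_one, crossSecond_tmul]
      generalize c (s ⊗ₜ u) = q
      induction q with
      | zero => simp
      | add a b ha hb => simp only [map_add, TensorProduct.add_tmul, TensorProduct.tmul_add, ha, hb]
      | tmul n s => simp [braidVT_one]
    | ι_mul w t ih =>
      intro u
      refine CommutesWithStrandAt.of_comp (f := (ιMul K V).lTensor V) (n := u ⊗ₜ (w ⊗ₜ t))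
        (ιMul_commutesWithStrand.lTensor _) ?_
      rw [braidVT_comp_ιMul]
      refine CommutesWithStrandAt.comp (ιMul_commutesWithStrand.rTensor _) ?_
      change CommutesWithStrandAt _ _ ((TensorProduct.assoc K _ _ _).symm.toLinearMap ∘ₗ
        (braidVT c).lTensor V ∘ₗ (TensorProduct.assoc K _ _ _).toLinearMap ∘ₗ
        c.rTensor _ ∘ₗ (TensorProduct.assoc K _ _ _).symm.toLinearMap) _
      refine CommutesWithStrandAt.comp (CommutesWithStrand.assoc_symm _ _ _ _) ?_
      refine CommutesWithStrandAt.comp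
        (κP := crossTensor c (crossTensor c (braidVT c))) ?_ ?_
      · change CommutesWithStrandAt _ _ _ ((TensorProduct.assoc K V V (TensorAlgebra K V))
          (c (u ⊗ₜ w) ⊗ₜ t))
        generalize c (u ⊗ₜ w) = q
        induction q with
        | zero => simpa using CommutesWithStrandAt.zero _
        | add a b ha hb =>
          simp only [map_add, TensorProduct.add_tmul]
          exact ha.add hb
        | tmul w u => exact (CommutesWithStrand.id _ _).map (ih u)
      · refine CommutesWithStrandAt.comp (CommutesWithStrand.assoc _ _ _ _) ?_
        refine CommutesWithStrandAt.comp
          (((isBraiding_iff_commutesWithStrand c).1 hc).rTensor _) ?_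
        exact CommutesWithStrand.assoc_symm _ _ _ _
    | add s t hs ht => intro u; rw [TensorProduct.tmul_add]; exact (hs u).add (ht u)
    | smul k t ht => intro u; rw [TensorProduct.tmul_smul]; exact (ht u).smul k
  intro z
  induction z with
  | zero => exact CommutesWithStrandAt.zero _
  | add a b ha hb => exact ha.add hb
  | tmul u t => exact key t u

/-- The recursion for the braiding of `T` in its left factor. -/
theorem braidTT_ι_mul (v : V) (t z : TensorAlgebra K V) :
    braidTT c ((TensorAlgebra.ι K v * t) ⊗ₜ z) =
      ((ιMul K V).lTensor _ ∘ₗ (TensorProduct.assoc K _ _ _).toLinearMap ∘ₗ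
        (braidVT c).rTensor _ ∘ₗ (TensorProduct.assoc K _ _ _).symm.toLinearMap)
        (v ⊗ₜ braidTT c (t ⊗ₜ z)) := by
  rw [braidTT_mul_left]
  generalize braidTT c (t ⊗ₜ z) = q
  induction q with
  | zero => simp
  | add a b ha hb => simp only [map_add, TensorProduct.tmul_add, ha, hb]
  | tmul x y =>
    simp only [braidFst, LinearMap.comp_apply, LinearEquiv.coe_coe, TensorProduct.assoc_symm_tmul,
      LinearMap.rTensor_tmul, braidTT_ι_left]
    generalize braidVT c (v ⊗ₜ x) = q
    induction q with
    | zero => simp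
    | add a b ha hb => simp only [map_add, TensorProduct.add_tmul, ha, hb]
    | tmul x y => simp

/-- The Yang-Baxter equation for one strand in `V` and two in `T`, by induction on the first word in
`T`. -/
theorem braidTT_commutesWithStrand_V (hc : IsBraiding c) :
    CommutesWithStrand (crossTensor (braidVT c) (braidVT c)) (crossTensor (braidVT c) (braidVT c))
      (braidTT c) := by
  have key : ∀ (t z : TensorAlgebra K V),
      CommutesWithStrandAt (crossTensor (braidVT c) (braidVT c))
        (crossTensor (braidVT c) (braidVT c)) (braidTT c) (t ⊗ₜ z) := by
    intro t
    induction t using tensorAlgebra_induction_left with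
    | one =>
      intro z s
      rw [braidTT_one_left, crossTensor_tmul, crossTensor_tmul, braidVT_one, crossSecond_tmul]
      generalize braidVT c (s ⊗ₜ z) = q
      induction q with
      | zero => simp
      | add a b ha hb => simp only [map_add, TensorProduct.add_tmul, TensorProduct.tmul_add, ha, hb]
      | tmul n s => simp [braidVT_one, braidTT_one_left]
    | ι_mul w t ih =>
      intro z
      refine CommutesWithStrandAt.of_comp
        (f := (ιMul K V).rTensor _ ∘ₗ (TensorProduct.assoc K _ _ _).symm.toLinearMap)
        (n := w ⊗ₜ (t ⊗ₜ z)) (κN := crossTensor c (crossTensor (braidVT c) (braidVT c)))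
        ((ιMul_commutesWithStrand.rTensor.comp (CommutesWithStrand.assoc_symm _ _ _)) _) ?_
      have h : braidTT c ∘ₗ (ιMul K V).rTensor _ ∘ₗ
          (TensorProduct.assoc K _ _ _).symm.toLinearMap =
          ((ιMul K V).lTensor _ ∘ₗ (TensorProduct.assoc K _ _ _).toLinearMap ∘ₗ
        (braidVT c).rTensor _ ∘ₗ (TensorProduct.assoc K _ _ _).symm.toLinearMap) ∘ₗ
          (braidTT c).lTensor V := by
        refine TensorProduct.ext' fun v z => ?_
        induction z with
        | zero => simp
        | add a b ha hb => simp only [map_add, TensorProduct.tmul_add, ha, hb]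
        | tmul x y => exact braidTT_ι_mul v x y
      rw [h]
      refine CommutesWithStrandAt.comp ?_ ((CommutesWithStrand.id _ _).map (ih z))
      exact (ιMul_commutesWithStrand.lTensor.comp ((CommutesWithStrand.assoc _ _ _).comp
        ((braidVT_commutesWithStrand hc).rTensor.comp (CommutesWithStrand.assoc_symm _ _ _)))) _
    | add s t hs ht => intro u; rw [TensorProduct.add_tmul]; exact (hs u).add (ht u)
    | smul k t ht => intro u; rw [← TensorProduct.smul_tmul']; exact (ht u).smul k
  intro z
  induction z with
  | zero => exact CommutesWithStrandAt.zero _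
  | add a b ha hb => exact ha.add hb
  | tmul u t => exact key u t

end TensorNat

/-! ### The comultiplication of the tensor algebra -/

section TensorComul

variable {K V : Type*} [Field K] [AddCommGroup V] [Module K V]
  {c : V ⊗[K] V →ₗ[K] V ⊗[K] V}

theorem midBraid_tmul {B : Type*} [AddCommGroup B] [Module K B] (c : B ⊗[K] B →ₗ[K] B ⊗[K] B)
    (a b x y : B) :
    midBraid c ((a ⊗ₜ b) ⊗ₜ (x ⊗ₜ y)) = (TensorProduct.assoc K B B (B ⊗[K] B)).symm
      (a ⊗ₜ TensorProduct.assoc K B B B (c (b ⊗ₜ x) ⊗ₜ y)) := rfl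

/-- Left multiplication by `v ⊗ 1 + 1 ⊗ v` in the braided tensor square of `T`. -/
def primMul (c : V ⊗[K] V →ₗ[K] V ⊗[K] V) :
    V ⊗[K] (TensorAlgebra K V ⊗[K] TensorAlgebra K V) →ₗ[K]
      TensorAlgebra K V ⊗[K] TensorAlgebra K V :=
  (ιMul K V).rTensor _ ∘ₗ (TensorProduct.assoc K _ _ _).symm.toLinearMap +
    (ιMul K V).lTensor _ ∘ₗ (TensorProduct.assoc K _ _ _).toLinearMap ∘ₗ
        (braidVT c).rTensor _ ∘ₗ (TensorProduct.assoc K _ _ _).symm.toLinearMap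

theorem primMul_tmul (v : V) (x y : TensorAlgebra K V) :
    primMul c (v ⊗ₜ (x ⊗ₜ y)) = (TensorAlgebra.ι K v * x) ⊗ₜ y +
      (ιMul K V).lTensor _ (TensorProduct.assoc K _ _ _ (braidVT c (v ⊗ₜ x) ⊗ₜ y)) := rfl

theorem primMul_eq_braidedMul (v : V) (z : TensorAlgebra K V ⊗[K] TensorAlgebra K V) :
    primMul c (v ⊗ₜ z) = (tensorData c).braidedMul (primitiveMap K V v ⊗ₜ z) := by
  induction z with
  | zero => simp
  | add a b ha hb => simp only [map_add, TensorProduct.tmul_add, ha, hb]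
  | tmul x y =>
    simp only [primMul_tmul, primitiveMap, LinearMap.comp_apply, LinearMap.add_apply,
      TensorProduct.add_tmul, map_add, LinearMap.flip_apply, TensorProduct.mk_apply,
      BraidedBialgebraData.braidedMul, midBraid_tmul, tensorData, braidTT_one_left,
      braidTT_ι_left]
    congr 1
    · simp
    · generalize braidVT c (v ⊗ₜ x) = q
      induction q with
      | zero => simp
      | add a b ha hb =>
        simp only [map_add, TensorProduct.add_tmul, TensorProduct.tmul_add, ha, hb]
      | tmul x y => simp

theorem comulT_one : comulT c 1 = 1 ⊗ₜ 1 := by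
  simp [comulT]

/-- The recursion `Δ(v t) = (v ⊗ 1 + 1 ⊗ v) Δ(t)`. -/
theorem comulT_ι_mul (v : V) (t : TensorAlgebra K V) :
    comulT c (TensorAlgebra.ι K v * t) = primMul c (v ⊗ₜ comulT c t) := by
  rw [primMul_eq_braidedMul]
  simp only [comulT, LinearMap.comp_apply, AlgHom.toLinearMap_apply, map_mul,
    TensorAlgebra.lift_ι_apply, Module.End.mul_apply, LinearMap.applyₗ_apply_apply]
  rfl

theorem primMul_commutesWithStrand (hc : IsBraiding c) :
    CommutesWithStrand (crossTensor c (crossTensor (braidVT c) (braidVT c)))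
      (crossTensor (braidVT c) (braidVT c)) (primMul c) :=
  CommutesWithStrand.add
    (ιMul_commutesWithStrand.rTensor.comp (CommutesWithStrand.assoc_symm _ _ _))
    (ιMul_commutesWithStrand.lTensor.comp ((CommutesWithStrand.assoc _ _ _).comp
        ((braidVT_commutesWithStrand hc).rTensor.comp (CommutesWithStrand.assoc_symm _ _ _))))

/-- `Δ` commutes with a strand in `V`: by the recursion for `Δ` this follows from the same property
of the multiplication by `v ⊗ 1 + 1 ⊗ v`. -/
theorem comulT_commutesWithStrand_V (hc : IsBraiding c) :
    CommutesWithStrand (braidVT c) (crossTensor (braidVT c) (braidVT c)) (comulT c) := by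
  intro t
  induction t using tensorAlgebra_induction_left with
  | one => intro s; simp [comulT_one, braidVT_one]
  | ι_mul w t ih =>
    refine CommutesWithStrandAt.of_comp (f := ιMul K V) (n := w ⊗ₜ t)
      (ιMul_commutesWithStrand _) ?_
    have h : comulT c ∘ₗ ιMul K V = primMul c ∘ₗ (comulT c).lTensor V :=
      TensorProduct.ext' fun v t => comulT_ι_mul v t
    rw [h]
    exact CommutesWithStrandAt.comp (primMul_commutesWithStrand hc _)
      ((CommutesWithStrand.id _ _).map ih)
  | add s t hs ht => exact hs.add ht
  | smul k t ht => exact ht.smul k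

theorem algebraMapInv_comp_ιMul :
    (TensorAlgebra.algebraMapInv (R := K) (M := V)).toLinearMap ∘ₗ ιMul K V = 0 :=
  TensorProduct.ext' fun v t => by simp [TensorAlgebra.algebraMapInv]

theorem algebraMapInv_commutesWithStrand_V :
    CommutesWithStrand (braidVT c) (TensorProduct.comm K V K).toLinearMap
      (TensorAlgebra.algebraMapInv (R := K) (M := V)).toLinearMap := by
  intro t
  induction t using tensorAlgebra_induction_left with
  | one => intro s; simp [braidVT_one]
  | ι_mul w t ih =>
    intro s
    have h' := ιMul_commutesWithStrand (c := c) (w ⊗ₜ t) s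
    rw [ιMul_tmul] at h'
    rw [h', ← LinearMap.rTensor_comp_apply, algebraMapInv_comp_ιMul]
    simp [TensorAlgebra.algebraMapInv]
  | add s t hs ht => exact hs.add ht
  | smul k t ht => exact ht.smul k

end TensorComul

/-! ### Strands labelled by the tensor algebra -/

section Extends

variable {K V N P : Type*} [Field K] [AddCommGroup V] [Module K V]
  [AddCommGroup N] [Module K N] [AddCommGroup P] [Module K P]
  {c : V ⊗[K] V →ₗ[K] V ⊗[K] V}

/-- Moving `v ∈ V` across `n` and multiplying it to an element of `T` on the other side. -/
def strandStep (κ : V ⊗[K] N →ₗ[K] N ⊗[K] V) :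
    V ⊗[K] (N ⊗[K] TensorAlgebra K V) →ₗ[K] N ⊗[K] TensorAlgebra K V :=
  (ιMul K V).lTensor _ ∘ₗ (TensorProduct.assoc K _ _ _).toLinearMap ∘ₗ
        κ.rTensor _ ∘ₗ (TensorProduct.assoc K _ _ _).symm.toLinearMap

theorem strandStep_tmul (κ : V ⊗[K] N →ₗ[K] N ⊗[K] V) (v : V) (n : N) (t : TensorAlgebra K V) :
    strandStep κ (v ⊗ₜ (n ⊗ₜ t)) =
      (ιMul K V).lTensor _ (TensorProduct.assoc K _ _ _ (κ (v ⊗ₜ n) ⊗ₜ t)) := rfl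

/-- The crossing `κ'` of `N` with strands in `T` is the multiplicative extension of the crossing
`κ` with strands in `V`. -/
structure ExtendsStrand (κ : V ⊗[K] N →ₗ[K] N ⊗[K] V)
    (κ' : TensorAlgebra K V ⊗[K] N →ₗ[K] N ⊗[K] TensorAlgebra K V) : Prop where
  one : ∀ n, κ' (1 ⊗ₜ n) = n ⊗ₜ 1
  ι_mul : ∀ v t n, κ' ((TensorAlgebra.ι K v * t) ⊗ₜ n) = strandStep κ (v ⊗ₜ κ' (t ⊗ₜ n))

theorem extendsStrand_braidTT : ExtendsStrand (braidVT c) (braidTT c) where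
  one := braidTT_one_left c
  ι_mul := braidTT_ι_mul

theorem extendsStrand_comm : ExtendsStrand (TensorProduct.comm K V K).toLinearMap
    (TensorProduct.comm K (TensorAlgebra K V) K).toLinearMap where
  one := by simp
  ι_mul v t n := by simp [strandStep_tmul]

theorem ExtendsStrand.crossTensor {κN : V ⊗[K] N →ₗ[K] N ⊗[K] V}
    {κN' : TensorAlgebra K V ⊗[K] N →ₗ[K] N ⊗[K] TensorAlgebra K V}
    {κP : V ⊗[K] P →ₗ[K] P ⊗[K] V}
    {κP' : TensorAlgebra K V ⊗[K] P →ₗ[K] P ⊗[K] TensorAlgebra K V}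
    (hN : ExtendsStrand κN κN') (hP : ExtendsStrand κP κP') :
    ExtendsStrand (crossTensor κN κP) (crossTensor κN' κP') where
  one z := by
    induction z with
    | zero => simp
    | add a b ha hb => simp only [map_add, TensorProduct.add_tmul, TensorProduct.tmul_add, ha, hb]
    | tmul n p => simp [hN.one, hP.one]
  ι_mul v t z := by
    induction z with
    | zero => simp
    | add a b ha hb => simp only [map_add, TensorProduct.tmul_add, ha, hb]
    | tmul n p =>
    rw [crossTensor_tmul, crossTensor_tmul, hN.ι_mul]
    generalize κN' (t ⊗ₜ n) = q
    induction q with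
    | zero => simp
    | add a b ha hb => simp only [map_add, TensorProduct.add_tmul, TensorProduct.tmul_add, ha, hb]
    | tmul n t =>
    have step : ∀ r : P ⊗[K] TensorAlgebra K V,
        strandStep (BraidedLie.crossTensor κN κP)
          (v ⊗ₜ (TensorProduct.assoc K _ _ _).symm (n ⊗ₜ r)) =
        ((TensorProduct.assoc K _ _ _).symm.toLinearMap ∘ₗ (strandStep κP).lTensor N ∘ₗ
          (TensorProduct.assoc K _ _ _).toLinearMap) (κN (v ⊗ₜ n) ⊗ₜ r) := by
      intro r
      induction r with
      | zero => simp
      | add a b ha hb => simp only [map_add, TensorProduct.tmul_add, ha, hb]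
      | tmul p t =>
      rw [TensorProduct.assoc_symm_tmul, strandStep_tmul, crossTensor_tmul]
      generalize κN (v ⊗ₜ n) = q
      induction q with
      | zero => simp
      | add a b ha hb =>
        simp only [map_add, TensorProduct.add_tmul, ha, hb]
      | tmul n v =>
      simp only [crossSecond_tmul, LinearMap.comp_apply, LinearEquiv.coe_coe,
        TensorProduct.assoc_tmul, LinearMap.lTensor_tmul, strandStep_tmul]
      generalize κP (v ⊗ₜ p) = q
      induction q with
      | zero => simp
      | add a b ha hb =>
        simp only [map_add, TensorProduct.add_tmul, TensorProduct.tmul_add, ha, hb]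
      | tmul p v => simp
    rw [crossSecond_tmul, step, strandStep_tmul]
    generalize κN (v ⊗ₜ n) = q
    induction q with
    | zero => simp
    | add a b ha hb =>
      simp only [map_add, TensorProduct.add_tmul, ha, hb]
    | tmul n v => simp [hP.ι_mul]

/-- A map commuting with strands in `V` commutes with strands in `T`. -/
theorem CommutesWithStrand.extend {κN : V ⊗[K] N →ₗ[K] N ⊗[K] V}
    {κN' : TensorAlgebra K V ⊗[K] N →ₗ[K] N ⊗[K] TensorAlgebra K V}
    {κP : V ⊗[K] P →ₗ[K] P ⊗[K] V}
    {κP' : TensorAlgebra K V ⊗[K] P →ₗ[K] P ⊗[K] TensorAlgebra K V}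
    (hN : ExtendsStrand κN κN') (hP : ExtendsStrand κP κP') {f : N →ₗ[K] P}
    (hf : CommutesWithStrand κN κP f) : CommutesWithStrand κN' κP' f := by
  intro n t
  induction t using tensorAlgebra_induction_left with
  | one => simp [hN.one, hP.one]
  | ι_mul v t ih =>
    rw [hN.ι_mul, hP.ι_mul, ih]
    generalize κN' (t ⊗ₜ n) = q
    induction q with
    | zero => simp
    | add a b ha hb => simp only [map_add, TensorProduct.tmul_add, ha, hb]
    | tmul n t =>
      rw [LinearMap.rTensor_tmul, strandStep_tmul, strandStep_tmul, hf]
      generalize κN (v ⊗ₜ n) = q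
      induction q with
      | zero => simp
      | add a b ha hb => simp only [map_add, TensorProduct.add_tmul, ha, hb]
      | tmul n v => simp
  | add s t hs ht => simp only [map_add, TensorProduct.add_tmul, hs, ht]
  | smul k t ht => simp only [map_smul, ← TensorProduct.smul_tmul', ht]

end Extends

/-! ### The braided tensor algebra is a braided bialgebra -/

section TensorLaws

variable {K V : Type*} [Field K] [AddCommGroup V] [Module K V]
  {c : V ⊗[K] V →ₗ[K] V ⊗[K] V}

theorem mul_commutesWithStrand :
    CommutesWithStrand (crossTensor (braidTT c) (braidTT c)) (braidTT c)
      (LinearMap.mul' K (TensorAlgebra K V)) :=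
  (mul_commutesWithStrand_V c).extend (extendsStrand_braidTT.crossTensor extendsStrand_braidTT)
    extendsStrand_braidTT

theorem isBraiding_braidTT (hc : IsBraiding c) : IsBraiding (braidTT c) :=
  (isBraiding_iff_commutesWithStrand _).2 <|
    (braidTT_commutesWithStrand_V hc).extend
      (extendsStrand_braidTT.crossTensor extendsStrand_braidTT)
      (extendsStrand_braidTT.crossTensor extendsStrand_braidTT)

theorem comulT_commutesWithStrand (hc : IsBraiding c) :
    CommutesWithStrand (braidTT c) (crossTensor (braidTT c) (braidTT c)) (comulT c) :=
  (comulT_commutesWithStrand_V hc).extend extendsStrand_braidTT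
    (extendsStrand_braidTT.crossTensor extendsStrand_braidTT)

theorem algebraMapInv_commutesWithStrand :
    CommutesWithStrand (braidTT c) (TensorProduct.comm K _ K).toLinearMap
      (TensorAlgebra.algebraMapInv (R := K) (M := V)).toLinearMap :=
  algebraMapInv_commutesWithStrand_V.extend extendsStrand_braidTT extendsStrand_comm

end TensorLaws

section TensorBialgebra

variable {K V : Type*} [Field K] [AddCommGroup V] [Module K V]
  {c : V ⊗[K] V →ₗ[K] V ⊗[K] V}

theorem braidFst_tmul {B : Type*} [AddCommGroup B] [Module K B]
    (c : B ⊗[K] B →ₗ[K] B ⊗[K] B) (x y z : B) :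
    braidFst c (x ⊗ₜ (y ⊗ₜ z)) = TensorProduct.assoc K B B B (c (x ⊗ₜ y) ⊗ₜ z) := rfl

theorem braidSnd_tmul {B : Type*} [AddCommGroup B] [Module K B]
    (c : B ⊗[K] B →ₗ[K] B ⊗[K] B) (x : B) (z : B ⊗[K] B) :
    braidSnd c (x ⊗ₜ z) = x ⊗ₜ c z := rfl

theorem braidTT_one_right (x : TensorAlgebra K V) : braidTT c (x ⊗ₜ 1) = 1 ⊗ₜ x := by
  induction x using tensorAlgebra_induction_left with
  | one => exact braidTT_one_left c 1
  | ι_mul v t ih => simp [extendsStrand_braidTT.ι_mul, ih, strandStep_tmul, braidVT_one]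
  | add s t hs ht => simp only [map_add, TensorProduct.add_tmul, TensorProduct.tmul_add, hs, ht]
  | smul k t ht => simp only [map_smul, ← TensorProduct.smul_tmul', TensorProduct.tmul_smul, ht]

theorem algebraMapInv_lTensor_strandStep {N : Type*} [AddCommGroup N] [Module K N]
    (κ : V ⊗[K] N →ₗ[K] N ⊗[K] V) (z : V ⊗[K] (N ⊗[K] TensorAlgebra K V)) :
    (TensorAlgebra.algebraMapInv (R := K) (M := V)).toLinearMap.lTensor N (strandStep κ z) = 0 := by
  rw [strandStep, LinearMap.comp_apply, ← LinearMap.lTensor_comp_apply, algebraMapInv_comp_ιMul]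
  simp

theorem braidTT_counit_left (x y : TensorAlgebra K V) :
    (TensorAlgebra.algebraMapInv (R := K) (M := V)).toLinearMap.lTensor _ (braidTT c (x ⊗ₜ y)) =
      y ⊗ₜ TensorAlgebra.algebraMapInv x := by
  induction x using tensorAlgebra_induction_left with
  | one => simp [braidTT_one_left]
  | ι_mul v t ih =>
    rw [extendsStrand_braidTT.ι_mul, algebraMapInv_lTensor_strandStep]
    simp [TensorAlgebra.algebraMapInv]
  | add s t hs ht => simp only [map_add, TensorProduct.add_tmul, TensorProduct.tmul_add, hs, ht]
  | smul k t ht => simp only [map_smul, ← TensorProduct.smul_tmul', TensorProduct.tmul_smul, ht]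

/-- The map `(a ⊗ b) ⊗ v ↦ a ⊗ b ⊗ v z`. -/
def mulThird (z : TensorAlgebra K V) :
    (TensorAlgebra K V ⊗[K] TensorAlgebra K V) ⊗[K] V →ₗ[K]
      TensorAlgebra K V ⊗[K] (TensorAlgebra K V ⊗[K] TensorAlgebra K V) :=
  (TensorProduct.assoc K _ _ _).toLinearMap ∘ₗ
    (LinearMap.mulRight K z ∘ₗ TensorAlgebra.ι K).lTensor _

@[simp]
theorem mulThird_tmul (z : TensorAlgebra K V) (p : TensorAlgebra K V ⊗[K] TensorAlgebra K V)
    (v : V) : mulThird z (p ⊗ₜ v) =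
      TensorProduct.assoc K _ _ _ (p ⊗ₜ (TensorAlgebra.ι K v * z)) := rfl

/-- The two strands of `x ⊗ z` are moved across `y`. -/
def twoAcross (c : V ⊗[K] V →ₗ[K] V ⊗[K] V) :
    (TensorAlgebra K V ⊗[K] TensorAlgebra K V) ⊗[K] TensorAlgebra K V →ₗ[K]
      TensorAlgebra K V ⊗[K] (TensorAlgebra K V ⊗[K] TensorAlgebra K V) :=
  braidFst (braidTT c) ∘ₗ braidSnd (braidTT c) ∘ₗ (TensorProduct.assoc K _ _ _).toLinearMap

theorem twoAcross_tmul (x z y : TensorAlgebra K V) :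
    twoAcross c ((x ⊗ₜ z) ⊗ₜ y) = braidFst (braidTT c) (x ⊗ₜ braidTT c (z ⊗ₜ y)) := rfl

set_option maxHeartbeats 800000 in
/-- Moving `(v ⊗ 1 + 1 ⊗ v) p` across `y` amounts to moving `p` across `y`, then moving `v` across
`y` and multiplying by `v ⊗ 1 + 1 ⊗ v`. The inner crossings are rearranged by the Yang-Baxter
equation. -/
theorem twoAcross_primMul (hc : IsBraiding c) (v : V)
    (p : TensorAlgebra K V ⊗[K] TensorAlgebra K V) (y : TensorAlgebra K V) :
    twoAcross c (primMul c (v ⊗ₜ p) ⊗ₜ y) =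
      ((primMul c).lTensor _ ∘ₗ (TensorProduct.assoc K _ _ _).toLinearMap ∘ₗ
        (braidVT c).rTensor _ ∘ₗ (TensorProduct.assoc K _ _ _).symm.toLinearMap)
          (v ⊗ₜ twoAcross c (p ⊗ₜ y)) := by
  induction p with
  | zero => simp
  | add a b ha hb => simp only [map_add, TensorProduct.tmul_add, TensorProduct.add_tmul, ha, hb]
  | tmul x z =>
  have h₁ : ∀ p : TensorAlgebra K V ⊗[K] V,
      twoAcross c ((ιMul K V).lTensor _ (TensorProduct.assoc K _ _ _ (p ⊗ₜ z)) ⊗ₜ y) =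
        (braidFst (braidTT c) ∘ₗ (strandStep (braidVT c)).lTensor _ ∘ₗ
          (TensorProduct.assoc K _ _ _).toLinearMap) (p ⊗ₜ braidTT c (z ⊗ₜ y)) := by
    intro p
    induction p with
    | zero => simp
    | add a b ha hb => simp only [map_add, TensorProduct.add_tmul, ha, hb]
    | tmul x w => simp [twoAcross_tmul, extendsStrand_braidTT.ι_mul]
  rw [primMul_tmul, TensorProduct.add_tmul, map_add, h₁, twoAcross_tmul, twoAcross_tmul]
  generalize braidTT c (z ⊗ₜ y) = r
  induction r with
  | zero => simp
  | add a b ha hb =>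
    simp only [map_add, TensorProduct.tmul_add] at ha hb ⊢
    exact (add_add_add_comm _ _ _ _).trans (congrArg₂ _ ha hb)
  | tmul y z =>
  have h₂ : (braidFst (braidTT c) ∘ₗ (strandStep (braidVT c)).lTensor _ ∘ₗ
      (TensorProduct.assoc K _ _ _).toLinearMap) (braidVT c (v ⊗ₜ x) ⊗ₜ (y ⊗ₜ z)) =
      mulThird z ((braidTT c).rTensor V
        (crossTensor (braidVT c) (braidVT c) (v ⊗ₜ (x ⊗ₜ y)))) := by
    rw [crossTensor_tmul]
    generalize braidVT c (v ⊗ₜ x) = q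
    induction q with
    | zero => simp
    | add a b ha hb => simp only [map_add, TensorProduct.add_tmul, ha, hb]
    | tmul x v =>
    rw [crossSecond_tmul]
    simp only [LinearMap.comp_apply, LinearEquiv.coe_coe,
        TensorProduct.assoc_tmul, LinearMap.lTensor_tmul, strandStep_tmul]
    generalize braidVT c (v ⊗ₜ y) = q
    induction q with
    | zero => simp
    | add a b ha hb => simp only [map_add, TensorProduct.add_tmul, TensorProduct.tmul_add, ha, hb]
    | tmul y v => simp [braidFst_tmul]
  rw [h₂, ← braidTT_commutesWithStrand_V hc, braidFst_tmul, braidFst_tmul,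
    extendsStrand_braidTT.ι_mul]
  generalize braidTT c (x ⊗ₜ y) = q
  induction q with
  | zero => simp
  | add a b ha hb =>
    simp only [map_add, TensorProduct.tmul_add, TensorProduct.add_tmul] at ha hb ⊢
    exact (add_add_add_comm _ _ _ _).trans (congrArg₂ _ ha hb)
  | tmul y x =>
  simp only [TensorProduct.assoc_tmul, LinearMap.comp_apply, LinearEquiv.coe_coe,
    TensorProduct.assoc_symm_tmul, LinearMap.rTensor_tmul, crossTensor_tmul, strandStep_tmul]
  generalize braidVT c (v ⊗ₜ y) = q
  induction q with
  | zero => simp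
  | add a b ha hb =>
    simp only [map_add, TensorProduct.add_tmul] at ha hb ⊢
    exact (add_add_add_comm _ _ _ _).trans (congrArg₂ _ ha hb)
  | tmul y v =>
  simp only [TensorProduct.assoc_tmul, LinearMap.lTensor_tmul, primMul_tmul,
    TensorProduct.tmul_add, crossSecond_tmul, ιMul_tmul]
  congr 1
  generalize braidVT c (v ⊗ₜ x) = q
  induction q with
  | zero => simp
  | add a b ha hb => simp only [map_add, TensorProduct.add_tmul, TensorProduct.tmul_add, ha, hb]
  | tmul x v => simp

/-- Moving a strand across `y` and then splitting it by `Δ` is the same as splitting it first. -/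
theorem braidTT_comul_left (hc : IsBraiding c) (x y : TensorAlgebra K V) :
    (comulT c).lTensor _ (braidTT c (x ⊗ₜ y)) = twoAcross c (comulT c x ⊗ₜ y) := by
  induction x using tensorAlgebra_induction_left with
  | one =>
    simp [braidTT_one_left, comulT_one, twoAcross_tmul, braidFst_tmul]
  | ι_mul v t ih =>
    rw [extendsStrand_braidTT.ι_mul, comulT_ι_mul, twoAcross_primMul hc, ← ih]
    generalize braidTT c (t ⊗ₜ y) = q
    induction q with
    | zero => simp
    | add a b ha hb => simp only [map_add, TensorProduct.tmul_add, ha, hb]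
    | tmul y t =>
    simp only [LinearMap.comp_apply, LinearMap.lTensor_tmul, LinearEquiv.coe_coe,
      TensorProduct.assoc_symm_tmul, LinearMap.rTensor_tmul, strandStep_tmul]
    generalize braidVT c (v ⊗ₜ y) = q
    induction q with
    | zero => simp
    | add a b ha hb => simp only [map_add, TensorProduct.add_tmul, ha, hb]
    | tmul y v => simp [comulT_ι_mul]
  | add s t hs ht => simp only [map_add, TensorProduct.add_tmul, hs, ht]
  | smul k t ht => simp only [map_smul, ← TensorProduct.smul_tmul', ht]

/-- Left multiplication by `v ⊗ 1 ⊗ 1 + 1 ⊗ v ⊗ 1 + 1 ⊗ 1 ⊗ v` in the braided tensor cube. -/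
def primMul₃ (c : V ⊗[K] V →ₗ[K] V ⊗[K] V) :
    V ⊗[K] (TensorAlgebra K V ⊗[K] (TensorAlgebra K V ⊗[K] TensorAlgebra K V)) →ₗ[K]
      TensorAlgebra K V ⊗[K] (TensorAlgebra K V ⊗[K] TensorAlgebra K V) :=
  (ιMul K V).rTensor _ ∘ₗ (TensorProduct.assoc K _ _ _).symm.toLinearMap +
    (primMul c).lTensor _ ∘ₗ (TensorProduct.assoc K _ _ _).toLinearMap ∘ₗ
        (braidVT c).rTensor _ ∘ₗ (TensorProduct.assoc K _ _ _).symm.toLinearMap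

theorem primMul₃_tmul (v : V) (x : TensorAlgebra K V)
    (y : TensorAlgebra K V ⊗[K] TensorAlgebra K V) :
    primMul₃ c (v ⊗ₜ (x ⊗ₜ y)) = (TensorAlgebra.ι K v * x) ⊗ₜ y +
      (primMul c).lTensor _ (TensorProduct.assoc K _ _ _ (braidVT c (v ⊗ₜ x) ⊗ₜ y)) := rfl

/-- `T ⊗ Δ` carries the multiplication by `v ⊗ 1 + 1 ⊗ v` to that by
`v ⊗ 1 ⊗ 1 + 1 ⊗ v ⊗ 1 + 1 ⊗ 1 ⊗ v`. -/
theorem comulT_lTensor_primMul (v : V) (p : TensorAlgebra K V ⊗[K] TensorAlgebra K V) :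
    (comulT c).lTensor _ (primMul c (v ⊗ₜ p)) =
      primMul₃ c (v ⊗ₜ (comulT c).lTensor _ p) := by
  induction p with
  | zero => simp
  | add a b ha hb => simp only [map_add, TensorProduct.tmul_add, ha, hb]
  | tmul x y =>
  rw [primMul_tmul, LinearMap.lTensor_tmul, primMul₃_tmul, map_add, LinearMap.lTensor_tmul]
  congr 1
  generalize braidVT c (v ⊗ₜ x) = q
  induction q with
  | zero => simp
  | add a b ha hb => simp only [map_add, TensorProduct.add_tmul, ha, hb]
  | tmul x v => simp [comulT_ι_mul]

/-- `Δ ⊗ T` carries the multiplication by `v ⊗ 1 + 1 ⊗ v` to that by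
`v ⊗ 1 ⊗ 1 + 1 ⊗ v ⊗ 1 + 1 ⊗ 1 ⊗ v`; the strand `v` is pulled across `Δ`. -/
theorem comulT_rTensor_primMul (hc : IsBraiding c) (v : V)
    (p : TensorAlgebra K V ⊗[K] TensorAlgebra K V) :
    TensorProduct.assoc K _ _ _ ((comulT c).rTensor _ (primMul c (v ⊗ₜ p))) =
      primMul₃ c (v ⊗ₜ TensorProduct.assoc K _ _ _ ((comulT c).rTensor _ p)) := by
  induction p with
  | zero => simp
  | add a b ha hb => simp only [map_add, TensorProduct.tmul_add, ha, hb]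
  | tmul x y =>
  have h₁ : ∀ q : TensorAlgebra K V ⊗[K] V, TensorProduct.assoc K _ _ _ ((comulT c).rTensor _
      ((ιMul K V).lTensor _ (TensorProduct.assoc K _ _ _ (q ⊗ₜ y)))) =
      mulThird y ((comulT c).rTensor V q) := by
    intro q
    induction q with
    | zero => simp
    | add a b ha hb => simp only [map_add, TensorProduct.add_tmul, ha, hb]
    | tmul x v => simp
  rw [primMul_tmul, map_add, map_add, LinearMap.rTensor_tmul, LinearMap.rTensor_tmul, h₁,
    ← comulT_commutesWithStrand_V hc, comulT_ι_mul]
  generalize comulT c x = q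
  induction q with
  | zero => simp
  | add a b ha hb =>
    simp only [map_add, TensorProduct.tmul_add, TensorProduct.add_tmul] at ha hb ⊢
    exact (add_add_add_comm _ _ _ _).trans (congrArg₂ _ ha hb)
  | tmul a b =>
  rw [primMul_tmul, TensorProduct.assoc_tmul, primMul₃_tmul, crossTensor_tmul]
  generalize braidVT c (v ⊗ₜ a) = q
  rw [TensorProduct.add_tmul, map_add, TensorProduct.assoc_tmul, add_assoc]
  congr 1
  induction q with
  | zero => simp
  | add a b ha hb =>
    simp only [map_add, TensorProduct.add_tmul] at ha hb ⊢
    exact (add_add_add_comm _ _ _ _).trans (congrArg₂ _ ha hb)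
  | tmul a v =>
  simp only [TensorProduct.assoc_tmul, LinearMap.lTensor_tmul, primMul_tmul,
    TensorProduct.tmul_add, crossSecond_tmul, ιMul_tmul]
  congr 1
  generalize braidVT c (v ⊗ₜ b) = q
  induction q with
  | zero => simp
  | add a b ha hb => simp only [map_add, TensorProduct.add_tmul, TensorProduct.tmul_add, ha, hb]
  | tmul x v => simp

theorem comulT_coassoc (hc : IsBraiding c) (x : TensorAlgebra K V) :
    TensorProduct.assoc K _ _ _ ((comulT c).rTensor _ (comulT c x)) =
      (comulT c).lTensor _ (comulT c x) := by
  induction x using tensorAlgebra_induction_left with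
  | one => simp [comulT_one]
  | ι_mul v t ih => rw [comulT_ι_mul, comulT_rTensor_primMul hc, comulT_lTensor_primMul, ih]
  | add s t hs ht => simp only [map_add, hs, ht]
  | smul k t ht => simp only [map_smul, ht]

theorem comulT_counit_left (x : TensorAlgebra K V) :
    (TensorAlgebra.algebraMapInv (R := K) (M := V)).toLinearMap.rTensor _ (comulT c x) =
      1 ⊗ₜ x := by
  induction x using tensorAlgebra_induction_left with
  | one => simp [comulT_one]
  | ι_mul v t ih =>
    have key : ∀ p : TensorAlgebra K V ⊗[K] TensorAlgebra K V,
        (TensorAlgebra.algebraMapInv (R := K) (M := V)).toLinearMap.rTensor _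
          (primMul c (v ⊗ₜ p)) = (LinearMap.mulLeft K (TensorAlgebra.ι K v)).lTensor _
            ((TensorAlgebra.algebraMapInv (R := K) (M := V)).toLinearMap.rTensor _ p) := by
      intro p
      induction p with
      | zero => simp
      | add a b ha hb => simp only [map_add, TensorProduct.tmul_add, ha, hb]
      | tmul x y =>
      have h₁ : ∀ q : TensorAlgebra K V ⊗[K] V,
          (TensorAlgebra.algebraMapInv (R := K) (M := V)).toLinearMap.rTensor _
            ((ιMul K V).lTensor _ (TensorProduct.assoc K _ _ _ (q ⊗ₜ y))) =
          (LinearMap.mulRight K y ∘ₗ TensorAlgebra.ι K).lTensor _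
            ((TensorAlgebra.algebraMapInv (R := K) (M := V)).toLinearMap.rTensor _ q) := by
        intro q
        induction q with
        | zero => simp
        | add a b ha hb => simp only [map_add, TensorProduct.add_tmul, ha, hb]
        | tmul x v => simp
      rw [primMul_tmul, map_add, h₁, ← algebraMapInv_commutesWithStrand_V]
      simp [TensorAlgebra.algebraMapInv]
    rw [comulT_ι_mul, key, ih]
    simp
  | add s t hs ht => simp only [map_add, TensorProduct.tmul_add, hs, ht]
  | smul k t ht => simp only [map_smul, TensorProduct.tmul_smul, ht]

theorem comulT_counit_right (x : TensorAlgebra K V) :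
    (TensorAlgebra.algebraMapInv (R := K) (M := V)).toLinearMap.lTensor _ (comulT c x) =
      x ⊗ₜ 1 := by
  induction x using tensorAlgebra_induction_left with
  | one => simp [comulT_one]
  | ι_mul v t ih =>
    have key : ∀ p : TensorAlgebra K V ⊗[K] TensorAlgebra K V,
        (TensorAlgebra.algebraMapInv (R := K) (M := V)).toLinearMap.lTensor _
          (primMul c (v ⊗ₜ p)) = (LinearMap.mulLeft K (TensorAlgebra.ι K v)).rTensor _
            ((TensorAlgebra.algebraMapInv (R := K) (M := V)).toLinearMap.lTensor _ p) := by
      intro p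
      induction p with
      | zero => simp
      | add a b ha hb => simp only [map_add, TensorProduct.tmul_add, ha, hb]
      | tmul x y =>
      rw [primMul_tmul, map_add, ← LinearMap.lTensor_comp_apply, algebraMapInv_comp_ιMul]
      simp
    rw [comulT_ι_mul, key, ih]
    simp
  | add s t hs ht => simp only [map_add, TensorProduct.add_tmul, hs, ht]
  | smul k t ht => simp only [map_smul, ← TensorProduct.smul_tmul', ht]

theorem braidedMul_tmul (x y x' y' : TensorAlgebra K V) :
    (tensorData c).braidedMul ((x ⊗ₜ y) ⊗ₜ (x' ⊗ₜ y')) =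
      TensorProduct.map (LinearMap.mulLeft K x) (LinearMap.mulRight K y')
        (braidTT c (y ⊗ₜ x')) := by
  rw [BraidedBialgebraData.braidedMul, LinearMap.comp_apply, midBraid_tmul]
  change _ = TensorProduct.map _ _ ((tensorData c).braid (y ⊗ₜ x'))
  generalize (tensorData c).braid (y ⊗ₜ x') = q
  induction q with
  | zero => simp
  | add a b ha hb => simp only [map_add, TensorProduct.add_tmul, TensorProduct.tmul_add, ha, hb]
  | tmul a b => simp [tensorData]

set_option maxHeartbeats 800000 in
/-- The case of associativity of the braided multiplication on `T ⊗ T` in which the first factor is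
`v ⊗ 1 + 1 ⊗ v`. -/
theorem primMul_braidedMul (v : V) (p q : TensorAlgebra K V ⊗[K] TensorAlgebra K V) :
    primMul c (v ⊗ₜ (tensorData c).braidedMul (p ⊗ₜ q)) =
      (tensorData c).braidedMul (primMul c (v ⊗ₜ p) ⊗ₜ q) := by
  induction p with
  | zero => simp
  | add a b ha hb => simp only [map_add, TensorProduct.tmul_add, TensorProduct.add_tmul, ha, hb]
  | tmul x y =>
  induction q with
  | zero => simp
  | add a b ha hb => simp only [map_add, TensorProduct.tmul_add, ha, hb]
  | tmul x' y' =>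
  have h₁ : ∀ q : TensorAlgebra K V ⊗[K] V, (tensorData c).braidedMul
      ((ιMul K V).lTensor _ (TensorProduct.assoc K _ _ _ (q ⊗ₜ y)) ⊗ₜ (x' ⊗ₜ y')) =
      ((LinearMap.mulRight K y').lTensor _ ∘ₗ (LinearMap.mul' K _).rTensor _ ∘ₗ
        (TensorProduct.assoc K _ _ _).symm.toLinearMap ∘ₗ (strandStep (braidVT c)).lTensor _ ∘ₗ
        (TensorProduct.assoc K _ _ _).toLinearMap) (q ⊗ₜ braidTT c (y ⊗ₜ x')) := by
    intro q
    induction q with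
    | zero => simp
    | add a b ha hb => simp only [map_add, TensorProduct.add_tmul, ha, hb]
    | tmul x v =>
      simp only [LinearMap.comp_apply, TensorProduct.assoc_tmul, LinearEquiv.coe_coe,
        LinearMap.lTensor_tmul, ιMul_tmul, braidedMul_tmul, extendsStrand_braidTT.ι_mul]
      generalize strandStep (braidVT c) (v ⊗ₜ braidTT c (y ⊗ₜ x')) = r
      induction r with
      | zero => simp
      | add a b ha hb => simp only [map_add, TensorProduct.tmul_add, ha, hb]
      | tmul a b => simp
  rw [primMul_tmul, TensorProduct.add_tmul, map_add, h₁, braidedMul_tmul, braidedMul_tmul]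
  generalize braidTT c (y ⊗ₜ x') = r
  induction r with
  | zero => simp
  | add a b ha hb =>
    simp only [map_add, TensorProduct.tmul_add] at ha hb ⊢
    exact (congrArg₂ _ ha hb).trans (add_add_add_comm _ _ _ _)
  | tmul x'' y'' =>
  rw [TensorProduct.map_tmul, primMul_tmul, LinearMap.mulLeft_apply, TensorProduct.map_tmul,
    LinearMap.mulLeft_apply, mul_assoc]
  congr 1
  have h₂ := mul_commutesWithStrand_V c (x ⊗ₜ x'') v
  rw [LinearMap.mul'_apply, crossTensor_tmul] at h₂
  rw [h₂]
  generalize braidVT c (v ⊗ₜ x) = q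
  induction q with
  | zero => simp
  | add a b ha hb => simp only [map_add, TensorProduct.add_tmul, ha, hb]
  | tmul x v =>
  simp only [crossSecond_tmul, LinearMap.comp_apply, TensorProduct.assoc_tmul,
    LinearEquiv.coe_coe, LinearMap.lTensor_tmul, strandStep_tmul]
  generalize braidVT c (v ⊗ₜ x'') = q
  induction q with
  | zero => simp
  | add a b ha hb => simp only [map_add, TensorProduct.add_tmul, TensorProduct.tmul_add, ha, hb]
  | tmul x v => simp [mul_assoc]

theorem comulT_mul (x y : TensorAlgebra K V) :
    comulT c (x * y) = (tensorData c).braidedMul (comulT c x ⊗ₜ comulT c y) := by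
  induction x using tensorAlgebra_induction_left with
  | one =>
    rw [one_mul, comulT_one]
    generalize comulT c y = q
    induction q with
    | zero => simp
    | add a b ha hb => rw [TensorProduct.tmul_add, map_add, ← ha, ← hb]
    | tmul a b => simp [braidedMul_tmul, braidTT_one_left]
  | ι_mul v t ih => rw [mul_assoc, comulT_ι_mul, comulT_ι_mul, ih, primMul_braidedMul]
  | add s t hs ht => simp only [add_mul, map_add, TensorProduct.add_tmul, hs, ht]
  | smul k t ht => simp only [smul_mul_assoc, map_smul, ← TensorProduct.smul_tmul', ht]

/-- The braided tensor algebra is a braided bialgebra. -/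
theorem isBraidedBialgebra_tensorData (hc : IsBraiding c) :
    (tensorData c).IsBraidedBialgebra where
  mul_assoc x y z := by simp [tensorData, mul_assoc]
  one_mul x := by simp [tensorData, BraidedBialgebraData.one]
  mul_one x := by simp [tensorData, BraidedBialgebraData.one]
  coassoc := LinearMap.ext fun x => comulT_coassoc hc x
  counit_left := comulT_counit_left
  counit_right := comulT_counit_right
  braiding := isBraiding_braidTT hc
  braid_mul_left := by
    refine LinearMap.ext fun z => ?_
    obtain ⟨z, rfl⟩ := (TensorProduct.assoc K _ _ _).surjective z
    simp only [LinearMap.comp_apply, LinearEquiv.coe_coe, LinearEquiv.symm_apply_apply]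
    induction z with
    | zero => simp
    | add a b ha hb => simp only [map_add, ha, hb]
    | tmul z y =>
    induction z with
    | zero => simp
    | add a b ha hb => simp only [map_add, TensorProduct.add_tmul, ha, hb]
    | tmul a b => exact braidTT_mul_left c a b y
  braid_mul_right := by
    refine TensorProduct.ext' fun x z => ?_
    refine (mul_commutesWithStrand z x).trans ?_
    rw [crossTensor_self_eq]
    rfl
  braid_one_left x := by
    simpa [tensorData, BraidedBialgebraData.one] using braidTT_one_left c x
  braid_one_right x := by
    simpa [tensorData, BraidedBialgebraData.one] using braidTT_one_right x
  braid_comul_left := TensorProduct.ext' fun x y => braidTT_comul_left hc x y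
  braid_comul_right := by
    refine TensorProduct.ext' fun x y => ?_
    have h := congrArg (TensorProduct.assoc K _ _ _) (comulT_commutesWithStrand hc y x)
    rw [crossTensor_self_eq] at h
    simpa [tensorData] using h.symm
  braid_counit_left := braidTT_counit_left
  braid_counit_right x y := (algebraMapInv_commutesWithStrand y x).symm
  comul_mul := TensorProduct.ext' comulT_mul
  comul_one := by
    simpa [tensorData, BraidedBialgebraData.one] using comulT_one (c := c)
  counit_mul x y := by simp [tensorData]
  counit_one := by simp [tensorData, BraidedBialgebraData.one]

end TensorBialgebra

/-! ### Symbols -/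

section Symbols

/-- A relation between the elements of a vector space `M` and their symbols in a vector space `G`.
The pair `(x, g)` belongs to `rel n` when `x` lies in the `n`-th step of `M` and has the symbol `g`
of degree `n`. The maps `symb n` are linear extensions of the symbol maps to all of `M`; the
condition `symb_zero` says that the symbol of degree `a` vanishes on the steps below `a`. Both
quotient maps and the passage to the graded space of a filtration give rise to such a relation. -/
structure SymbolRel (K M G : Type*) [Field K] [AddCommGroup M] [Module K M] [AddCommGroup G]
    [Module K G] where
  rel : ℕ → Submodule K (M × G)
  symb : ℕ → M →ₗ[K] G
  symb_eq : ∀ {n x g}, (x, g) ∈ rel n → symb n x = g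
  symb_zero : ∀ {n a x g}, (x, g) ∈ rel n → n < a → symb a x = 0
  span : ⨆ n, (rel n).map (LinearMap.snd K M G) = ⊤

variable {K M G M' G' M'' G'' N H N' H' : Type*} [Field K]
  [AddCommGroup M] [Module K M] [AddCommGroup G] [Module K G]
  [AddCommGroup M'] [Module K M'] [AddCommGroup G'] [Module K G']
  [AddCommGroup M''] [Module K M''] [AddCommGroup G''] [Module K G'']
  [AddCommGroup N] [Module K N] [AddCommGroup H] [Module K H]
  [AddCommGroup N'] [Module K N'] [AddCommGroup H'] [Module K H']

namespace SymbolRel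

/-- A surjective linear map, as a symbol relation: every element has the symbol `f x` in degree `0`,
and the symbol `0` in positive degrees. -/
def ofSurjective (f : M →ₗ[K] G) (hf : Function.Surjective f) : SymbolRel K M G where
  rel
    | 0 => LinearMap.graph f
    | _ + 1 => LinearMap.graph 0
  symb
    | 0 => f
    | _ + 1 => 0
  symb_eq {n x g} h := by cases n <;> exact h.symm
  symb_zero {n a x g} _ ha := by
    cases a with
    | zero => exact absurd ha (Nat.not_lt_zero _)
    | succ a => rfl
  span := by
    refine eq_top_iff.2 fun g _ => ?_
    obtain ⟨x, rfl⟩ := hf g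
    exact Submodule.mem_iSup_of_mem 0 ⟨(x, f x), rfl, rfl⟩

/-- The scalars, concentrated in degree `0`. -/
def scalars (K : Type*) [Field K] : SymbolRel K K K :=
  ofSurjective LinearMap.id Function.surjective_id

/-- The set of pairs of pure tensors with symbols of total degree `n`. -/
def tensorSet (R : SymbolRel K M G) (R' : SymbolRel K M' G') (n : ℕ) :
    Set ((M ⊗[K] M') × (G ⊗[K] G')) :=
  {q | ∃ i j x g y h, i + j = n ∧ (x, g) ∈ R.rel i ∧ (y, h) ∈ R'.rel j ∧ q = (x ⊗ₜ y, g ⊗ₜ h)}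

/-- The tensor product of two symbol relations, graded by the total degree. -/
def tensor (R : SymbolRel K M G) (R' : SymbolRel K M' G') :
    SymbolRel K (M ⊗[K] M') (G ⊗[K] G') where
  rel n := Submodule.span K (tensorSet R R' n)
  symb n := ∑ p ∈ Finset.HasAntidiagonal.antidiagonal n,
    TensorProduct.map (R.symb p.1) (R'.symb p.2)
  symb_eq {n x g} h := by
    have h' : Submodule.span K (tensorSet R R' n) ≤
        LinearMap.graph
          (∑ p ∈ Finset.HasAntidiagonal.antidiagonal n,
            TensorProduct.map (R.symb p.1) (R'.symb p.2)) := by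
      refine Submodule.span_le.2 ?_
      rintro _ ⟨i, j, x, g, y, h, rfl, hx, hy, rfl⟩
      simp only [SetLike.mem_coe, LinearMap.mem_graph_iff, LinearMap.sum_apply,
        TensorProduct.map_tmul]
      rw [Finset.sum_eq_single (i, j), R.symb_eq hx, R'.symb_eq hy]
      · rintro ⟨a, b⟩ hab hne
        rw [Finset.HasAntidiagonal.mem_antidiagonal] at hab
        dsimp only at hab ⊢
        rcases lt_trichotomy i a with h | h | h
        · rw [R.symb_zero hx h, TensorProduct.zero_tmul]
        · exact absurd (Prod.ext h.symm (by dsimp only; omega)) hne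
        · rw [R'.symb_zero hy (show j < b by omega), TensorProduct.tmul_zero]
      · intro h
        simp at h
    exact (h' h).symm
  symb_zero {n a x g} h ha := by
    have h' : Submodule.span K (tensorSet R R' n) ≤ (LinearMap.ker
        (∑ p ∈ Finset.HasAntidiagonal.antidiagonal a,
          TensorProduct.map (R.symb p.1) (R'.symb p.2))).comap
          (LinearMap.fst K _ _) := by
      refine Submodule.span_le.2 ?_
      rintro _ ⟨i, j, x, g, y, h, rfl, hx, hy, rfl⟩
      simp only [SetLike.mem_coe, Submodule.mem_comap, LinearMap.fst_apply, LinearMap.mem_ker,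
        LinearMap.sum_apply, TensorProduct.map_tmul]
      refine Finset.sum_eq_zero ?_
      rintro ⟨p, q⟩ hpq
      rw [Finset.HasAntidiagonal.mem_antidiagonal] at hpq
      dsimp only at hpq ⊢
      rcases lt_or_ge i p with h | h
      · rw [R.symb_zero hx h, TensorProduct.zero_tmul]
      · rw [R'.symb_zero hy (show j < q by omega), TensorProduct.tmul_zero]
    exact h' h
  span := by
    set T := ⨆ n, (Submodule.span K (tensorSet R R' n)).map (LinearMap.snd K _ _) with hT
    have key : ∀ g h, g ⊗ₜ h ∈ T := by
      intro g h
      have hg : g ∈ ⨆ n, (R.rel n).map (LinearMap.snd K M G) := by rw [R.span]; trivial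
      have hh : h ∈ ⨆ n, (R'.rel n).map (LinearMap.snd K M' G') := by rw [R'.span]; trivial
      induction hg using Submodule.iSup_induction' with
      | zero => rw [TensorProduct.zero_tmul]; exact zero_mem _
      | add x y _ _ hx hy => rw [TensorProduct.add_tmul]; exact add_mem hx hy
      | mem i g hg =>
      induction hh using Submodule.iSup_induction' with
      | zero => rw [TensorProduct.tmul_zero]; exact zero_mem _
      | add x y _ _ hx hy => rw [TensorProduct.tmul_add]; exact add_mem hx hy
      | mem j h hh =>
      obtain ⟨⟨x, g⟩, hx, rfl⟩ := hg
      obtain ⟨⟨y, h⟩, hy, rfl⟩ := hh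
      exact Submodule.mem_iSup_of_mem (i + j)
        ⟨_, Submodule.subset_span ⟨i, j, x, g, y, h, rfl, hx, hy, rfl⟩, rfl⟩
    refine eq_top_iff.2 fun z _ => ?_
    induction z with
    | zero => exact zero_mem _
    | add a b ha hb => exact add_mem (ha trivial) (hb trivial)
    | tmul g h => exact key g h

theorem tmul_mem {R : SymbolRel K M G} {R' : SymbolRel K M' G'} {i j : ℕ} {x g y h}
    (hx : (x, g) ∈ R.rel i) (hy : (y, h) ∈ R'.rel j) :
    (x ⊗ₜ y, g ⊗ₜ h) ∈ (R.tensor R').rel (i + j) :=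
  Submodule.subset_span ⟨i, j, x, g, y, h, rfl, hx, hy, rfl⟩

/-- `f₀ : G → H` describes the effect of `f : M → N` on symbols. -/
def Lead (R : SymbolRel K M G) (R' : SymbolRel K N H) (f : M →ₗ[K] N) (f₀ : G →ₗ[K] H) : Prop :=
  ∀ ⦃n x g⦄, (x, g) ∈ R.rel n → (f x, f₀ g) ∈ R'.rel n

variable {R : SymbolRel K M G} {R' : SymbolRel K M' G'} {R'' : SymbolRel K M'' G''}
  {Q : SymbolRel K N H} {Q' : SymbolRel K N' H'}

/-- To check that a map on `M ⊗ M'` has a given effect on symbols, it is enough to look at pure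
tensors. -/
theorem Lead.of_tmul {f : M ⊗[K] M' →ₗ[K] N} {f₀ : G ⊗[K] G' →ₗ[K] H}
    (hp : ∀ ⦃i j x g y h⦄, (x, g) ∈ R.rel i → (y, h) ∈ R'.rel j →
      (f (x ⊗ₜ y), f₀ (g ⊗ₜ h)) ∈ Q.rel (i + j)) : Lead (R.tensor R') Q f f₀ := by
  intro n x g hx
  have h' : Submodule.span K (tensorSet R R' n) ≤ (Q.rel n).comap (f.prodMap f₀) := by
    refine Submodule.span_le.2 ?_
    rintro _ ⟨i, j, x, g, y, h, rfl, hx, hy, rfl⟩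
    exact hp hx hy
  exact h' hx

theorem Lead.id (R : SymbolRel K M G) : Lead R R LinearMap.id LinearMap.id := fun _ _ _ h => h

theorem Lead.comp {f : M →ₗ[K] M'} {f₀ : G →ₗ[K] G'} {g : M' →ₗ[K] M''} {g₀ : G' →ₗ[K] G''}
    (hg : Lead R' R'' g g₀) (hf : Lead R R' f f₀) : Lead R R'' (g ∘ₗ f) (g₀ ∘ₗ f₀) :=
  fun _ _ _ h => hg (hf h)

/-- The effect of a map on symbols is unique. -/
theorem Lead.ext {f f' : M →ₗ[K] N} {f₀ f₀' : G →ₗ[K] H} (hf : Lead R Q f f₀)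
    (hf' : Lead R Q f' f₀') (h : f = f') : f₀ = f₀' := by
  subst h
  have key : (⊤ : Submodule K G) ≤ LinearMap.eqLocus f₀ f₀' := by
    rw [← R.span]
    refine iSup_le fun n => ?_
    rintro _ ⟨⟨x, g⟩, hx, rfl⟩
    exact (Q.symb_eq (hf hx)).symm.trans (Q.symb_eq (hf' hx))
  exact LinearMap.ext fun g => key trivial

theorem Lead.map {f : M →ₗ[K] N} {f₀ : G →ₗ[K] H} {f' : M' →ₗ[K] N'} {f₀' : G' →ₗ[K] H'}
    (hf : Lead R Q f f₀) (hf' : Lead R' Q' f' f₀') :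
    Lead (R.tensor R') (Q.tensor Q') (TensorProduct.map f f') (TensorProduct.map f₀ f₀') :=
  Lead.of_tmul fun _ _ _ _ _ _ hx hy => tmul_mem (hf hx) (hf' hy)

theorem Lead.lTensor {f : M →ₗ[K] N} {f₀ : G →ₗ[K] H} (R' : SymbolRel K M' G')
    (hf : Lead R Q f f₀) :
    Lead (R'.tensor R) (R'.tensor Q) (f.lTensor M') (f₀.lTensor G') :=
  (Lead.id R').map hf

theorem Lead.rTensor {f : M →ₗ[K] N} {f₀ : G →ₗ[K] H} (R' : SymbolRel K M' G')
    (hf : Lead R Q f f₀) :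
    Lead (R.tensor R') (Q.tensor R') (f.rTensor M') (f₀.rTensor G') :=
  hf.map (Lead.id R')

theorem Lead.assoc (R : SymbolRel K M G) (R' : SymbolRel K M' G') (R'' : SymbolRel K M'' G'') :
    Lead ((R.tensor R').tensor R'') (R.tensor (R'.tensor R''))
      (TensorProduct.assoc K M M' M'').toLinearMap
      (TensorProduct.assoc K G G' G'').toLinearMap := by
  refine Lead.of_tmul fun k l x g z e hx hz => ?_
  have h' : Submodule.span K (tensorSet R R' k) ≤
      ((R.tensor (R'.tensor R'')).rel (k + l)).comap
        (((TensorProduct.assoc K M M' M'').toLinearMap ∘ₗ (TensorProduct.mk K _ _).flip z).prodMap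
        ((TensorProduct.assoc K G G' G'').toLinearMap ∘ₗ (TensorProduct.mk K _ _).flip e)) := by
    refine Submodule.span_le.2 ?_
    rintro _ ⟨i, j, x, g, y, h, rfl, hx, hy, rfl⟩
    rw [add_assoc]
    exact tmul_mem hx (tmul_mem hy hz)
  exact h' hx

theorem Lead.assoc_symm (R : SymbolRel K M G) (R' : SymbolRel K M' G')
    (R'' : SymbolRel K M'' G'') :
    Lead (R.tensor (R'.tensor R'')) ((R.tensor R').tensor R'')
      (TensorProduct.assoc K M M' M'').symm.toLinearMap
      (TensorProduct.assoc K G G' G'').symm.toLinearMap := by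
  refine Lead.of_tmul fun k l x g z e hx hz => ?_
  have h' : Submodule.span K (tensorSet R' R'' l) ≤
      (((R.tensor R').tensor R'').rel (k + l)).comap
        (((TensorProduct.assoc K M M' M'').symm.toLinearMap ∘ₗ TensorProduct.mk K _ _ x).prodMap
        ((TensorProduct.assoc K G G' G'').symm.toLinearMap ∘ₗ TensorProduct.mk K _ _ g)) := by
    refine Submodule.span_le.2 ?_
    rintro _ ⟨i, j, y, h, z, e, rfl, hy, hz, rfl⟩
    rw [← add_assoc]
    exact tmul_mem (tmul_mem hx hy) hz
  exact h' hz

theorem Lead.comm (R : SymbolRel K M G) (R' : SymbolRel K M' G') :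
    Lead (R.tensor R') (R'.tensor R) (TensorProduct.comm K M M').toLinearMap
      (TensorProduct.comm K G G').toLinearMap :=
  Lead.of_tmul fun i j x g y h hx hy => by
    rw [add_comm]
    exact tmul_mem hy hx

theorem Lead.lid_symm (R : SymbolRel K M G) :
    Lead R ((scalars K).tensor R) (TensorProduct.lid K M).symm.toLinearMap
      (TensorProduct.lid K G).symm.toLinearMap := fun n x g h => by
  have h₁ : ((1 : K), (1 : K)) ∈ (scalars K).rel 0 := rfl
  simpa using tmul_mem h₁ h

theorem Lead.rid_symm (R : SymbolRel K M G) :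
    Lead R (R.tensor (scalars K)) (TensorProduct.rid K M).symm.toLinearMap
      (TensorProduct.rid K G).symm.toLinearMap := fun n x g h => by
  have h₁ : ((1 : K), (1 : K)) ∈ (scalars K).rel 0 := rfl
  simpa using tmul_mem h h₁

theorem Lead.lid_scalars (K : Type*) [Field K] :
    Lead ((scalars K).tensor (scalars K)) (scalars K) (TensorProduct.lid K K).toLinearMap
      (TensorProduct.lid K K).toLinearMap :=
  Lead.of_tmul fun i j x g y h hx hy => by
    simp only [LinearEquiv.coe_coe, TensorProduct.lid_tmul, smul_eq_mul]
    cases i with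
    | zero =>
      obtain rfl : g = x := hx
      cases j with
      | zero => obtain rfl : h = y := hy; rfl
      | succ j => obtain rfl : h = 0 := hy; rw [mul_zero]; rfl
    | succ i =>
      obtain rfl : g = 0 := hx
      rw [zero_mul, show i + 1 + j = (i + j) + 1 by omega]
      rfl

end SymbolRel

end Symbols

/-! ### Braided bialgebras of symbols -/

section Transfer

open SymbolRel

variable {K M G : Type*} [Field K] [AddCommGroup M] [Module K M] [AddCommGroup G] [Module K G]
  {R : SymbolRel K M G} {D : BraidedBialgebraData K M} {E : BraidedBialgebraData K G}

/-- The structure maps of `E` describe the effect of those of `D` on symbols. -/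
structure IsSymbolStructure (R : SymbolRel K M G) (D : BraidedBialgebraData K M)
    (E : BraidedBialgebraData K G) : Prop where
  mul : Lead (R.tensor R) R D.mul E.mul
  unit : Lead (scalars K) R D.unit E.unit
  comul : Lead R (R.tensor R) D.comul E.comul
  counit : Lead R (scalars K) D.counit E.counit
  braid : Lead (R.tensor R) (R.tensor R) D.braid E.braid

theorem SymbolRel.Lead.braidFst {c : M ⊗[K] M →ₗ[K] M ⊗[K] M} {c₀ : G ⊗[K] G →ₗ[K] G ⊗[K] G}
    (h : Lead (R.tensor R) (R.tensor R) c c₀) :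
    Lead (R.tensor (R.tensor R)) (R.tensor (R.tensor R)) (braidFst c) (braidFst c₀) :=
  (Lead.assoc R R R).comp ((h.rTensor R).comp (Lead.assoc_symm R R R))

theorem SymbolRel.Lead.braidSnd {c : M ⊗[K] M →ₗ[K] M ⊗[K] M} {c₀ : G ⊗[K] G →ₗ[K] G ⊗[K] G}
    (h : Lead (R.tensor R) (R.tensor R) c c₀) :
    Lead (R.tensor (R.tensor R)) (R.tensor (R.tensor R)) (braidSnd c) (braidSnd c₀) :=
  h.lTensor R

theorem SymbolRel.Lead.midBraid {c : M ⊗[K] M →ₗ[K] M ⊗[K] M} {c₀ : G ⊗[K] G →ₗ[K] G ⊗[K] G}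
    (h : Lead (R.tensor R) (R.tensor R) c c₀) :
    Lead ((R.tensor R).tensor (R.tensor R)) ((R.tensor R).tensor (R.tensor R)) (midBraid c)
      (midBraid c₀) :=
  (Lead.assoc_symm R R (R.tensor R)).comp
    ((h.braidFst.lTensor R).comp (Lead.assoc R R (R.tensor R)))

/-- The laws of a braided bialgebra are identities between composites of the structure maps, so
they are inherited by the structure on symbols. -/
theorem IsSymbolStructure.isBraidedBialgebra (h : IsSymbolStructure R D E)
    (hD : D.IsBraidedBialgebra) : E.IsBraidedBialgebra where
  mul_assoc x y z := by
    have := Lead.ext (h.mul.comp (h.mul.rTensor R))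
      (h.mul.comp ((h.mul.lTensor R).comp (Lead.assoc R R R)))
      (TensorProduct.ext_threefold fun x y z => hD.mul_assoc x y z)
    exact LinearMap.congr_fun this ((x ⊗ₜ y) ⊗ₜ z)
  one_mul x := by
    have := Lead.ext (h.mul.comp ((h.unit.rTensor R).comp (Lead.lid_symm R))) (Lead.id R)
      (LinearMap.ext fun x => hD.one_mul x)
    exact LinearMap.congr_fun this x
  mul_one x := by
    have := Lead.ext (h.mul.comp ((h.unit.lTensor R).comp (Lead.rid_symm R))) (Lead.id R)
      (LinearMap.ext fun x => hD.mul_one x)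
    exact LinearMap.congr_fun this x
  coassoc := Lead.ext ((Lead.assoc R R R).comp ((h.comul.rTensor R).comp h.comul))
    ((h.comul.lTensor R).comp h.comul) hD.coassoc
  counit_left x := by
    have := Lead.ext ((h.counit.rTensor R).comp h.comul) (Lead.lid_symm R)
      (LinearMap.ext fun x => hD.counit_left x)
    exact LinearMap.congr_fun this x
  counit_right x := by
    have := Lead.ext ((h.counit.lTensor R).comp h.comul) (Lead.rid_symm R)
      (LinearMap.ext fun x => hD.counit_right x)
    exact LinearMap.congr_fun this x
  braiding := Lead.ext (h.braid.braidFst.comp (h.braid.braidSnd.comp h.braid.braidFst))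
    (h.braid.braidSnd.comp (h.braid.braidFst.comp h.braid.braidSnd)) hD.braiding
  braid_mul_left := Lead.ext (h.braid.comp ((h.mul.rTensor R).comp (Lead.assoc_symm R R R)))
    ((h.mul.lTensor R).comp (h.braid.braidFst.comp h.braid.braidSnd)) hD.braid_mul_left
  braid_mul_right := Lead.ext (h.braid.comp (h.mul.lTensor R))
    ((h.mul.rTensor R).comp ((Lead.assoc_symm R R R).comp
      (h.braid.braidSnd.comp h.braid.braidFst))) hD.braid_mul_right
  braid_one_left x := by
    have := Lead.ext (h.braid.comp ((h.unit.rTensor R).comp (Lead.lid_symm R)))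
      ((h.unit.lTensor R).comp (Lead.rid_symm R))
      (LinearMap.ext fun x => hD.braid_one_left x)
    exact LinearMap.congr_fun this x
  braid_one_right x := by
    have := Lead.ext (h.braid.comp ((h.unit.lTensor R).comp (Lead.rid_symm R)))
      ((h.unit.rTensor R).comp (Lead.lid_symm R))
      (LinearMap.ext fun x => hD.braid_one_right x)
    exact LinearMap.congr_fun this x
  braid_comul_left := Lead.ext ((h.comul.lTensor R).comp h.braid)
    (h.braid.braidFst.comp (h.braid.braidSnd.comp ((Lead.assoc R R R).comp (h.comul.rTensor R))))
    hD.braid_comul_left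
  braid_comul_right := Lead.ext ((Lead.assoc R R R).comp ((h.comul.rTensor R).comp h.braid))
    (h.braid.braidSnd.comp (h.braid.braidFst.comp (h.comul.lTensor R))) hD.braid_comul_right
  braid_counit_left x y := by
    have := Lead.ext ((h.counit.lTensor R).comp h.braid)
      ((Lead.comm (scalars K) R).comp (h.counit.rTensor R))
      (TensorProduct.ext' fun x y => hD.braid_counit_left x y)
    exact LinearMap.congr_fun this (x ⊗ₜ y)
  braid_counit_right x y := by
    have := Lead.ext ((h.counit.rTensor R).comp h.braid)
      ((Lead.comm R (scalars K)).comp (h.counit.lTensor R))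
      (TensorProduct.ext' fun x y => hD.braid_counit_right x y)
    exact LinearMap.congr_fun this (x ⊗ₜ y)
  comul_mul := Lead.ext (h.comul.comp h.mul)
    (((h.mul.map h.mul).comp h.braid.midBraid).comp (h.comul.map h.comul)) hD.comul_mul
  comul_one := by
    have := Lead.ext (h.comul.comp h.unit)
      ((h.unit.map h.unit).comp (Lead.lid_symm (scalars K)))
      (LinearMap.ext_ring hD.comul_one)
    exact LinearMap.congr_fun this 1
  counit_mul x y := by
    have := Lead.ext (h.counit.comp h.mul)
      ((Lead.lid_scalars K).comp (h.counit.map h.counit))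
      (TensorProduct.ext' fun x y => hD.counit_mul x y)
    exact LinearMap.congr_fun this (x ⊗ₜ y)
  counit_one := by
    have := Lead.ext (h.counit.comp h.unit) (Lead.id (scalars K))
      (LinearMap.ext_ring hD.counit_one)
    exact LinearMap.congr_fun this 1

theorem SymbolRel.mem_ofSurjective_zero {f : M →ₗ[K] G} (hf : Function.Surjective f) (x : M) :
    (x, f x) ∈ (ofSurjective f hf).rel 0 := rfl

theorem SymbolRel.mem_ofSurjective_succ {f : M →ₗ[K] G} (hf : Function.Surjective f) (n : ℕ)
    (x : M) : (x, (0 : G)) ∈ (ofSurjective f hf).rel (n + 1) := rfl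

theorem SymbolRel.mem_ofSurjective_tensor_zero {f : M →ₗ[K] G} (hf : Function.Surjective f)
    (z : M ⊗[K] M) : (z, TensorProduct.map f f z) ∈
      ((ofSurjective f hf).tensor (ofSurjective f hf)).rel 0 := by
  induction z with
  | zero => rw [map_zero]; exact zero_mem _
  | add a b ha hb => rw [map_add]; exact add_mem ha hb
  | tmul x y =>
    rw [TensorProduct.map_tmul]
    exact tmul_mem (i := 0) (j := 0) (mem_ofSurjective_zero hf x) (mem_ofSurjective_zero hf y)

theorem SymbolRel.mem_ofSurjective_tensor_succ {f : M →ₗ[K] G} (hf : Function.Surjective f)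
    (n : ℕ) (z : M ⊗[K] M) : (z, (0 : G ⊗[K] G)) ∈
      ((ofSurjective f hf).tensor (ofSurjective f hf)).rel (n + 1) := by
  induction z with
  | zero => exact zero_mem _
  | add a b ha hb => simpa using add_mem ha hb
  | tmul x y =>
    simpa using tmul_mem (mem_ofSurjective_succ hf n x) (mem_ofSurjective_zero hf y)

/-- The effect of a map on the symbols of a surjection only has to be checked in degree `0`, if
every element has the symbol `0` in positive degrees. -/
theorem SymbolRel.Lead.of_zero_succ {N H : Type*} [AddCommGroup N] [Module K N]
    [AddCommGroup H] [Module K H]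
    {f : M →ₗ[K] G} {hf : Function.Surjective f} {Q : SymbolRel K N H}
    {g : M →ₗ[K] N} {g₀ : G →ₗ[K] H} (h₀ : ∀ x, (g x, g₀ (f x)) ∈ Q.rel 0)
    (h₁ : ∀ n x, (x, 0) ∈ Q.rel (n + 1)) : Lead (ofSurjective f hf) Q g g₀ := by
  intro n x y h
  cases n with
  | zero => obtain rfl : y = f x := h; exact h₀ x
  | succ n => obtain rfl : y = 0 := h; rw [map_zero]; exact h₁ n _

theorem SymbolRel.Lead.tensor_of_zero_succ {N H : Type*}
    [AddCommGroup N] [Module K N] [AddCommGroup H] [Module K H]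
    {f : M →ₗ[K] G} {hf : Function.Surjective f} {Q : SymbolRel K N H}
    {g : M ⊗[K] M →ₗ[K] N} {g₀ : G ⊗[K] G →ₗ[K] H}
    (h₀ : ∀ x, (g x, g₀ (TensorProduct.map f f x)) ∈ Q.rel 0)
    (h₁ : ∀ n x, (x, 0) ∈ Q.rel (n + 1)) :
    Lead ((ofSurjective f hf).tensor (ofSurjective f hf)) Q g g₀ := by
  refine Lead.of_tmul fun i j x a y b hx hy => ?_
  cases i with
  | zero =>
    obtain rfl : a = f x := hx
    cases j with
    | zero => obtain rfl : b = f y := hy; exact h₀ (x ⊗ₜ y)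
    | succ j => obtain rfl : b = 0 := hy; rw [TensorProduct.tmul_zero, map_zero]; exact h₁ _ _
  | succ i =>
    obtain rfl : a = 0 := hx
    rw [TensorProduct.zero_tmul, map_zero, show i + 1 + j = i + j + 1 by omega]
    exact h₁ _ _

/-- A quotient of a braided bialgebra is a braided bialgebra. -/
theorem isBraidedBialgebra_of_surjective {f : M →ₗ[K] G} (hf : Function.Surjective f)
    (h : D.IsHom E f) (hD : D.IsBraidedBialgebra) : E.IsBraidedBialgebra := by
  refine IsSymbolStructure.isBraidedBialgebra (R := ofSurjective f hf)
    ⟨Lead.tensor_of_zero_succ (fun z => ?_) (mem_ofSurjective_succ hf),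
      Lead.of_zero_succ (fun k => ?_) (mem_ofSurjective_succ hf),
      Lead.of_zero_succ (fun x => ?_) (mem_ofSurjective_tensor_succ hf),
      Lead.of_zero_succ (fun x => ?_) (mem_ofSurjective_succ Function.surjective_id),
      Lead.tensor_of_zero_succ (fun z => ?_) (mem_ofSurjective_tensor_succ hf)⟩ hD
  · exact (LinearMap.congr_fun h.map_mul z).symm
  · exact (LinearMap.congr_fun h.map_unit k).symm
  · rw [← LinearMap.comp_apply, ← h.map_comul]
    exact mem_ofSurjective_tensor_zero hf _
  · exact LinearMap.congr_fun h.map_counit x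
  · rw [← LinearMap.comp_apply, ← h.map_braid]
    exact mem_ofSurjective_tensor_zero hf _

/-- `T(V,c)/I` is a braided bialgebra. -/
theorem BraidedBiideal.isBraidedBialgebra_data {V : Type*} [AddCommGroup V] [Module K V]
    {c : V ⊗[K] V →ₗ[K] V ⊗[K] V} (hc : IsBraiding c) (I : BraidedBiideal c) :
    I.data.IsBraidedBialgebra :=
  isBraidedBialgebra_of_surjective I.proj_surjective I.isHom_proj
    (isBraidedBialgebra_tensorData hc)

end Transfer

/-! ### The graded braided bialgebra of a filtration -/

open SymbolRel

theorem SymbolRel.unique {K M G : Type*} [Field K] [AddCommGroup M] [Module K M]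
    [AddCommGroup G] [Module K G] (R : SymbolRel K M G) {n : ℕ} {x : M} {g g' : G}
    (h : (x, g) ∈ R.rel n) (h' : (x, g') ∈ R.rel n) : g = g' :=
  (R.symb_eq h).symm.trans (R.symb_eq h')

section Graded

variable {K M : Type*} [Field K] [AddCommGroup M] [Module K M]

theorem pred_le {F : ℕ → Submodule K M} (hF : Monotone F) (n : ℕ) : pred F n ≤ F n := by
  cases n with
  | zero => exact bot_le
  | succ n => exact hF n.le_succ

theorem GrPiece.mk_surjective (F : ℕ → Submodule K M) (n : ℕ) :
    Function.Surjective (GrPiece.mk F n) :=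
  Submodule.mkQ_surjective _

theorem GrPiece.mk_eq_zero_iff {F : ℕ → Submodule K M} {n : ℕ} (x : F n) :
    GrPiece.mk F n x = 0 ↔ (x : M) ∈ pred F n :=
  Submodule.Quotient.mk_eq_zero _

theorem cls_eq_zero_iff {F : ℕ → Submodule K M} {n : ℕ} (x : F n) :
    cls F n x = 0 ↔ (x : M) ∈ pred F n := by
  rw [← GrPiece.mk_eq_zero_iff, cls, LinearMap.comp_apply]
  exact map_eq_zero_iff _ (DirectSum.of_injective n)

theorem range_cls (F : ℕ → Submodule K M) (n : ℕ) : LinearMap.range (cls F n) = grPart F n := by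
  rw [cls, LinearMap.range_comp, LinearMap.range_eq_top.2 (GrPiece.mk_surjective F n),
    Submodule.map_top, grPart]

/-- The graded space is spanned by the classes of the elements of the filtration. -/
theorem gr_hom_ext {F : ℕ → Submodule K M} {H : Type*} [AddCommGroup H] [Module K H]
    {f g : Gr F →ₗ[K] H} (h : ∀ n x, f (cls F n x) = g (cls F n x)) : f = g := by
  refine DirectSum.linearMap_ext K fun n => LinearMap.ext fun y => ?_
  obtain ⟨x, rfl⟩ := GrPiece.mk_surjective F n y
  exact h n x

/-- A linear extension of `cls F n` to all of `M`. -/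
def grSymb (F : ℕ → Submodule K M) (n : ℕ) : M →ₗ[K] Gr F :=
  Classical.choose (LinearMap.exists_extend (cls F n))

theorem grSymb_apply (F : ℕ → Submodule K M) (n : ℕ) (x : F n) :
    grSymb F n x = cls F n x :=
  LinearMap.congr_fun (Classical.choose_spec (LinearMap.exists_extend (cls F n))) x

theorem grSymb_of_mem_pred {F : ℕ → Submodule K M} (hF : Monotone F) {n : ℕ} {x : M}
    (hx : x ∈ pred F n) : grSymb F n x = 0 :=
  (grSymb_apply F n ⟨x, pred_le hF n hx⟩).trans ((cls_eq_zero_iff _).2 hx)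

theorem grSymb_of_lt {F : ℕ → Submodule K M} (hF : Monotone F) {n a : ℕ} (h : n < a) {x : M}
    (hx : x ∈ F n) : grSymb F a x = 0 := by
  refine grSymb_of_mem_pred hF ?_
  cases a with
  | zero => exact absurd h (Nat.not_lt_zero _)
  | succ a => exact hF (Nat.lt_succ_iff.1 h) hx

/-- The symbols of the elements of a filtration in the associated graded space. -/
def grRel {F : ℕ → Submodule K M} (hF : Monotone F) : SymbolRel K M (Gr F) where
  rel n := LinearMap.range ((F n).subtype.prod (cls F n))
  symb n := grSymb F n
  symb_eq := by
    rintro n _ _ ⟨x, h⟩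
    obtain ⟨rfl, rfl⟩ := Prod.mk.inj h
    exact grSymb_apply F n x
  symb_zero := by
    rintro n a _ _ ⟨x, h⟩ ha
    obtain ⟨rfl, rfl⟩ := Prod.mk.inj h
    exact grSymb_of_lt hF ha x.2
  span := by
    refine eq_top_iff.2 fun g _ => ?_
    induction g using DirectSum.induction_on with
    | zero => exact zero_mem _
    | add a b ha hb => exact add_mem (ha trivial) (hb trivial)
    | of n y =>
      obtain ⟨x, rfl⟩ := GrPiece.mk_surjective F n y
      exact Submodule.mem_iSup_of_mem n ⟨_, ⟨x, rfl⟩, rfl⟩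

theorem mem_grRel {F : ℕ → Submodule K M} (hF : Monotone F) (n : ℕ) (x : F n) :
    ((x : M), cls F n x) ∈ (grRel hF).rel n :=
  ⟨x, rfl⟩

theorem mapIncl_mem_grRel_tensor {F : ℕ → Submodule K M} (hF : Monotone F) (i j : ℕ)
    (z : F i ⊗[K] F j) :
    (TensorProduct.mapIncl (F i) (F j) z, TensorProduct.map (cls F i) (cls F j) z) ∈
      ((grRel hF).tensor (grRel hF)).rel (i + j) := by
  induction z with
  | zero => exact zero_mem _
  | add a b ha hb => rw [map_add, map_add]; exact add_mem ha hb
  | tmul x y => exact tmul_mem (mem_grRel hF i x) (mem_grRel hF j y)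

theorem mem_iSup_antidiagonal_iff {N : Type*} [AddCommGroup N] [Module K N]
    {F : ℕ → Submodule K M} {F' : ℕ → Submodule K N} {n : ℕ} {z : M ⊗[K] N} :
    z ∈ ⨆ p ∈ Finset.HasAntidiagonal.antidiagonal n,
      LinearMap.range (TensorProduct.mapIncl (F p.1) (F' p.2)) ↔
    ∃ w : ∀ p : ℕ × ℕ, F p.1 ⊗[K] F' p.2, z = ∑ p ∈ Finset.HasAntidiagonal.antidiagonal n,
      TensorProduct.mapIncl (F p.1) (F' p.2) (w p) := by
  rw [Submodule.mem_iSup_finset_iff_exists_sum]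
  constructor
  · rintro ⟨μ, rfl⟩
    choose w hw using fun p => (μ p).2
    exact ⟨w, Finset.sum_congr rfl fun p _ => (hw p).symm⟩
  · rintro ⟨w, rfl⟩
    exact ⟨fun p => ⟨_, w p, rfl⟩, rfl⟩

theorem sum_mapIncl_mem_grRel_tensor {F : ℕ → Submodule K M} (hF : Monotone F) (n : ℕ)
    (w : ∀ p : ℕ × ℕ, F p.1 ⊗[K] F p.2) :
    (∑ p ∈ Finset.HasAntidiagonal.antidiagonal n, TensorProduct.mapIncl (F p.1) (F p.2) (w p),
      ∑ p ∈ Finset.HasAntidiagonal.antidiagonal n, TensorProduct.map (cls F p.1) (cls F p.2) (w p))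
      ∈ ((grRel hF).tensor (grRel hF)).rel n := by
  have h : (∑ p ∈ Finset.HasAntidiagonal.antidiagonal n,
      TensorProduct.mapIncl (F p.1) (F p.2) (w p), ∑ p ∈ Finset.HasAntidiagonal.antidiagonal n,
      TensorProduct.map (cls F p.1) (cls F p.2) (w p)) =
      ∑ p ∈ Finset.HasAntidiagonal.antidiagonal n, (TensorProduct.mapIncl (F p.1) (F p.2) (w p),
        TensorProduct.map (cls F p.1) (cls F p.2) (w p)) :=
    Prod.ext (by rw [Prod.fst_sum]) (by rw [Prod.snd_sum])
  rw [h]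
  refine sum_mem fun p hp => ?_
  rw [Finset.HasAntidiagonal.mem_antidiagonal] at hp
  subst hp
  exact mapIncl_mem_grRel_tensor hF _ _ _

/-- The projections `F_n → F_n / F_{n-1}` have linear sections. -/
theorem exists_grPiece_section (F : ℕ → Submodule K M) :
    ∃ τ : ∀ n, GrPiece F n →ₗ[K] F n,
      ∀ n (x : F n), (x : M) - τ n (GrPiece.mk F n x) ∈ pred F n := by
  choose τ hτ using fun n => (GrPiece.mk F n).exists_rightInverse_of_surjective
    (LinearMap.range_eq_top.2 (GrPiece.mk_surjective F n))
  refine ⟨τ, fun n x => ?_⟩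
  rw [← Submodule.coe_sub, ← GrPiece.mk_eq_zero_iff, map_sub, sub_eq_zero]
  exact (LinearMap.congr_fun (hτ n) _).symm

/-- A map respecting the filtration induces a map on symbols. -/
theorem exists_lead {N H : Type*} [AddCommGroup N] [Module K N] [AddCommGroup H] [Module K H]
    {F : ℕ → Submodule K M} (hF : Monotone F) (Q : SymbolRel K N H) (f : M →ₗ[K] N)
    (hf : ∀ n, ∀ x ∈ F n, ∃ h, (f x, h) ∈ Q.rel n) : ∃ f₀, Lead (grRel hF) Q f f₀ := by
  obtain ⟨τ, hτ⟩ := exists_grPiece_section F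
  have hpred : ∀ n, ∀ x ∈ pred F n, Q.symb n (f x) = 0 := by
    intro n x hx
    cases n with
    | zero => rw [(Submodule.mem_bot K).1 hx]; simp
    | succ n =>
      obtain ⟨h, hh⟩ := hf n x hx
      exact Q.symb_zero hh n.lt_succ_self
  refine ⟨DirectSum.toModule K ℕ H fun n => Q.symb n ∘ₗ f ∘ₗ (F n).subtype ∘ₗ τ n, ?_⟩
  rintro n _ _ ⟨x, hx⟩
  obtain ⟨rfl, rfl⟩ := Prod.mk.inj hx
  obtain ⟨h, hh⟩ := hf n x x.2
  have h₁ := hpred n _ (hτ n x)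
  rw [map_sub, map_sub, sub_eq_zero, Q.symb_eq hh] at h₁
  rw [Submodule.subtype_apply]
  convert hh
  rw [h₁, cls, LinearMap.comp_apply, DirectSum.toModule_lof]
  rfl

/-- A bilinear map respecting the filtration induces a bilinear map on symbols. -/
theorem exists_lead_tensor {N H : Type*} [AddCommGroup N] [Module K N] [AddCommGroup H]
    [Module K H] {F : ℕ → Submodule K M} (hF : Monotone F) (Q : SymbolRel K N H)
    (f : M ⊗[K] M →ₗ[K] N)
    (hf : ∀ i j, ∀ x ∈ F i, ∀ y ∈ F j, ∃ h, (f (x ⊗ₜ y), h) ∈ Q.rel (i + j)) :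
    ∃ f₀, Lead ((grRel hF).tensor (grRel hF)) Q f f₀ := by
  obtain ⟨τ, hτ⟩ := exists_grPiece_section F
  have hleft : ∀ i j, ∀ x ∈ pred F i, ∀ y ∈ F j, Q.symb (i + j) (f (x ⊗ₜ y)) = 0 := by
    intro i j x hx y hy
    cases i with
    | zero => rw [(Submodule.mem_bot K).1 hx]; simp
    | succ i =>
      obtain ⟨h, hh⟩ := hf i j x hx y hy
      exact Q.symb_zero hh (by omega)
  have hright : ∀ i j, ∀ x ∈ F i, ∀ y ∈ pred F j, Q.symb (i + j) (f (x ⊗ₜ y)) = 0 := by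
    intro i j x hx y hy
    cases j with
    | zero => rw [(Submodule.mem_bot K).1 hy]; simp
    | succ j =>
      obtain ⟨h, hh⟩ := hf i j x hx y hy
      exact Q.symb_zero hh (by omega)
  refine ⟨DirectSum.toModule K (ℕ × ℕ) H (fun p => Q.symb (p.1 + p.2) ∘ₗ f ∘ₗ
    TensorProduct.map ((F p.1).subtype ∘ₗ τ p.1) ((F p.2).subtype ∘ₗ τ p.2)) ∘ₗ
    (TensorProduct.directSum K K (GrPiece F) (GrPiece F)).toLinearMap, Lead.of_tmul ?_⟩
  rintro i j _ _ _ _ ⟨x, hx⟩ ⟨y, hy⟩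
  obtain ⟨rfl, rfl⟩ := Prod.mk.inj hx
  obtain ⟨rfl, rfl⟩ := Prod.mk.inj hy
  obtain ⟨h, hh⟩ := hf i j x x.2 y y.2
  have h₁ := hleft i j _ (hτ i x) y y.2
  have h₂ := hright i j _ (τ i (GrPiece.mk F i x)).2 _ (hτ j y)
  rw [TensorProduct.sub_tmul, map_sub, map_sub, sub_eq_zero] at h₁
  rw [TensorProduct.tmul_sub, map_sub, map_sub, sub_eq_zero] at h₂
  have h₃ := Q.symb_eq hh
  rw [Submodule.subtype_apply, Submodule.subtype_apply]
  convert hh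
  rw [← h₃, h₁, h₂]
  simp only [LinearMap.comp_apply, cls, LinearEquiv.coe_coe, TensorProduct.directSum_lof_tmul_lof,
    DirectSum.toModule_lof]
  rfl

/-- The filtration `F` is respected by the structure maps of `D`. -/
structure IsCompatible (D : BraidedBialgebraData K M) (F : ℕ → Submodule K M) : Prop where
  monotone : Monotone F
  exhaustive : ⨆ n, F n = ⊤
  mul_mem : ∀ i j, ∀ x ∈ F i, ∀ y ∈ F j, D.mul (x ⊗ₜ y) ∈ F (i + j)
  one_mem : D.one ∈ F 0
  comul_mem : ∀ n, ∀ x ∈ F n, D.comul x ∈ ⨆ p ∈ Finset.HasAntidiagonal.antidiagonal n,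
    LinearMap.range (TensorProduct.mapIncl (F p.1) (F p.2))
  braid_mem : ∀ i j, ∀ x ∈ F i, ∀ y ∈ F j,
    D.braid (x ⊗ₜ y) ∈ LinearMap.range (TensorProduct.mapIncl (F j) (F i))

variable {D : BraidedBialgebraData K M} {F : ℕ → Submodule K M}

theorem IsCompatible.exists_isSymbolStructure (h : IsCompatible D F) :
    ∃ E, IsSymbolStructure (grRel h.monotone) D E := by
  obtain ⟨mul, hmul⟩ := exists_lead_tensor h.monotone (grRel h.monotone) D.mul
    fun i j x hx y hy => ⟨_, mem_grRel h.monotone _ ⟨_, h.mul_mem i j x hx y hy⟩⟩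
  obtain ⟨comul, hcomul⟩ := exists_lead h.monotone ((grRel h.monotone).tensor (grRel h.monotone))
    D.comul fun n x hx => by
      obtain ⟨w, hw⟩ := mem_iSup_antidiagonal_iff.1 (h.comul_mem n x hx)
      exact ⟨_, hw ▸ sum_mapIncl_mem_grRel_tensor h.monotone n w⟩
  obtain ⟨counit, hcounit⟩ := exists_lead h.monotone (scalars K) D.counit fun n x hx => by
    cases n with
    | zero => exact ⟨D.counit x, rfl⟩
    | succ n => exact ⟨0, rfl⟩
  obtain ⟨braid, hbraid⟩ := exists_lead_tensor h.monotone
    ((grRel h.monotone).tensor (grRel h.monotone)) D.braid fun i j x hx y hy => by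
      obtain ⟨w, hw⟩ := h.braid_mem i j x hx y hy
      rw [add_comm i j]
      exact ⟨_, hw ▸ mapIncl_mem_grRel_tensor h.monotone j i w⟩
  refine ⟨⟨mul, LinearMap.toSpanSingleton K _ (cls F 0 ⟨_, h.one_mem⟩), comul, counit, braid⟩,
    hmul, ?_, hcomul, hcounit, hbraid⟩
  intro n k g hk
  have hone : D.unit k = k • D.one := by
    rw [BraidedBialgebraData.one, ← map_smul, smul_eq_mul, mul_one]
  rw [hone]
  cases n with
  | zero =>
    obtain rfl : g = k := hk
    exact Submodule.smul_mem _ g (mem_grRel h.monotone 0 ⟨_, h.one_mem⟩)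
  | succ n =>
    obtain rfl : g = 0 := hk
    have hmem : D.one ∈ pred F (n + 1) := h.monotone n.zero_le h.one_mem
    have := mem_grRel h.monotone (n + 1) ⟨_, pred_le h.monotone _ hmem⟩
    rw [(cls_eq_zero_iff _).2 hmem] at this
    simpa using Submodule.smul_mem _ k this

variable {E : BraidedBialgebraData K (Gr F)}

/-- The structure on symbols is the one induced on the graded space of the filtration. -/
theorem IsCompatible.isInduced (h : IsCompatible D F)
    (hE : IsSymbolStructure (grRel h.monotone) D E) : IsInduced D F E where
  monotone := h.monotone
  exhaustive := h.exhaustive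
  mul_mem i j x y := h.mul_mem i j x x.2 y y.2
  mul_eq i j x y := (grRel h.monotone).unique
    (hE.mul (tmul_mem (mem_grRel h.monotone i x) (mem_grRel h.monotone j y)))
    (mem_grRel h.monotone (i + j) ⟨_, h.mul_mem i j x x.2 y y.2⟩)
  one_mem := h.one_mem
  one_eq := (grRel h.monotone).unique (x := D.one)
    (hE.unit (mem_ofSurjective_zero Function.surjective_id (1 : K)))
    (mem_grRel h.monotone 0 ⟨_, h.one_mem⟩)
  comul_mem n x := h.comul_mem n x x.2
  comul_eq n x w hw := ((grRel h.monotone).tensor (grRel h.monotone)).unique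
    (hE.comul (mem_grRel h.monotone n x)) (hw ▸ sum_mapIncl_mem_grRel_tensor h.monotone n w)
  counit_eq n x := by
    have hx := hE.counit (mem_grRel h.monotone n x)
    cases n with
    | zero => exact hx
    | succ n => exact hx
  braid_mem i j x y := h.braid_mem i j x x.2 y y.2
  braid_eq i j x y w hw := ((grRel h.monotone).tensor (grRel h.monotone)).unique
    (hE.braid (tmul_mem (mem_grRel h.monotone i x) (mem_grRel h.monotone j y)))
    (by rw [hw, add_comm i j]; exact mapIncl_mem_grRel_tensor h.monotone j i w)

theorem exists_lof_eq_cls (n : ℕ) (y : GrPiece F n) :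
    ∃ x : F n, DirectSum.lof K ℕ (GrPiece F) n y = cls F n x := by
  obtain ⟨x, rfl⟩ := GrPiece.mk_surjective F n y
  exact ⟨x, rfl⟩

theorem map_cls_mem (i j : ℕ) (w : F i ⊗[K] F j) :
    TensorProduct.map (cls F i) (cls F j) w ∈ LinearMap.range (TensorProduct.map
      (DirectSum.lof K ℕ (GrPiece F) i) (DirectSum.lof K ℕ (GrPiece F) j)) := by
  rw [cls, cls, TensorProduct.map_comp]
  exact ⟨_, rfl⟩

theorem IsInduced.isGradedBraidedBialgebra (h : IsInduced D F E) (hE : E.IsBraidedBialgebra) :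
    E.IsGradedBraidedBialgebra where
  isBraidedBialgebra := hE
  mul_mem i j x y := by
    obtain ⟨x, hx⟩ := exists_lof_eq_cls i x
    obtain ⟨y, hy⟩ := exists_lof_eq_cls j y
    rw [hx, hy, h.mul_eq]
    exact ⟨_, rfl⟩
  one_mem := by
    rw [h.one_eq]
    exact ⟨_, rfl⟩
  comul_mem n x := by
    obtain ⟨x, hx⟩ := exists_lof_eq_cls n x
    obtain ⟨w, hw⟩ := mem_iSup_antidiagonal_iff.1 (h.comul_mem n x)
    rw [hx, h.comul_eq n x w hw]
    exact sum_mem fun p hp => Submodule.mem_iSup_of_mem p (Submodule.mem_iSup_of_mem hp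
      (map_cls_mem p.1 p.2 (w p)))
  counit_eq_zero n x hn := by
    obtain ⟨x, hx⟩ := exists_lof_eq_cls n x
    rw [hx, h.counit_eq, if_neg hn]
  braid_mem i j x y := by
    obtain ⟨x, hx⟩ := exists_lof_eq_cls i x
    obtain ⟨y, hy⟩ := exists_lof_eq_cls j y
    obtain ⟨w, hw⟩ := h.braid_mem i j x y
    rw [hx, hy, h.braid_eq i j x y w hw.symm]
    exact map_cls_mem j i w

theorem grId_cls {F F' : ℕ → Submodule K M} (hle : ∀ n, F n ≤ F' n) (n : ℕ) (x : F n) :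
    grId hle (cls F n x) = cls F' n ⟨x, hle n x.2⟩ := by
  rw [grId, cls, LinearMap.comp_apply, DirectSum.lmap_lof]
  rfl

/-- The identity is compatible with symbols for comparable filtrations. -/
theorem lead_grId {F F' : ℕ → Submodule K M} (hF : Monotone F) (hF' : Monotone F')
    (hle : ∀ n, F n ≤ F' n) : Lead (grRel hF) (grRel hF') LinearMap.id (grId hle) := by
  rintro n _ _ ⟨x, hx⟩
  obtain ⟨rfl, rfl⟩ := Prod.mk.inj hx
  rw [grId_cls]
  exact mem_grRel hF' n ⟨x, hle n x.2⟩

/-- If two filtrations respected by `D` are comparable, then the identity induces a morphism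
between the graded braided bialgebras. -/
theorem isHom_grId {F' : ℕ → Submodule K M} {E' : BraidedBialgebraData K (Gr F')}
    {hF : Monotone F} {hF' : Monotone F'} (hE : IsSymbolStructure (grRel hF) D E)
    (hE' : IsSymbolStructure (grRel hF') D E') (hle : ∀ n, F n ≤ F' n) :
    E.IsHom E' (grId hle) := by
  have hid := lead_grId hF hF' hle
  refine ⟨Lead.ext (hid.comp hE.mul) (hE'.mul.comp (hid.map hid)) ?_,
    Lead.ext (hid.comp hE.unit) hE'.unit ?_,
    Lead.ext ((hid.map hid).comp hE.comul) (hE'.comul.comp hid) ?_,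
    Lead.ext (hE'.counit.comp hid) hE.counit ?_,
    Lead.ext ((hid.map hid).comp hE.braid) (hE'.braid.comp (hid.map hid)) ?_⟩ <;>
  simp [TensorProduct.map_id]

theorem grId_map_grPart_le {F F' : ℕ → Submodule K M} (hle : ∀ n, F n ≤ F' n) (n : ℕ) :
    (grPart F n).map (grId hle) ≤ grPart F' n := by
  rw [← range_cls, ← range_cls]
  rintro _ ⟨_, ⟨x, rfl⟩, rfl⟩
  exact ⟨_, (grId_cls hle n x).symm⟩

end Graded

/-! ### Subspaces of tensor products -/

section Subspaces

variable {K M N A B : Type*} [Field K] [AddCommGroup M] [Module K M] [AddCommGroup N] [Module K N]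
  [AddCommGroup A] [Module K A] [AddCommGroup B] [Module K B]

/-- The subspace `X ⊗ Y` of `M ⊗ N`. -/
abbrev tens (X : Submodule K M) (Y : Submodule K N) : Submodule K (M ⊗[K] N) :=
  LinearMap.range (TensorProduct.mapIncl X Y)

theorem tmul_mem_tens {X : Submodule K M} {Y : Submodule K N} {x : M} {y : N} (hx : x ∈ X)
    (hy : y ∈ Y) : x ⊗ₜ y ∈ tens X Y :=
  ⟨⟨x, hx⟩ ⊗ₜ ⟨y, hy⟩, rfl⟩

theorem tens_le {X : Submodule K M} {Y : Submodule K N} {S : Submodule K (M ⊗[K] N)} :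
    tens X Y ≤ S ↔ ∀ x ∈ X, ∀ y ∈ Y, x ⊗ₜ y ∈ S := by
  refine ⟨fun h x hx y hy => h (tmul_mem_tens hx hy), fun h => ?_⟩
  rintro _ ⟨z, rfl⟩
  induction z with
  | zero => rw [map_zero]; exact zero_mem _
  | add a b ha hb => rw [map_add]; exact add_mem ha hb
  | tmul x y => exact h x x.2 y y.2

theorem tens_mono {X X' : Submodule K M} {Y Y' : Submodule K N} (hX : X ≤ X') (hY : Y ≤ Y') :
    tens X Y ≤ tens X' Y' :=
  TensorProduct.range_mapIncl_mono hX hY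

/-- To map `X ⊗ Y` into a subspace, it is enough to map the pure tensors into it. -/
theorem map_mem_of_mem_tens {X : Submodule K M} {Y : Submodule K N} (f : M ⊗[K] N →ₗ[K] A)
    {S : Submodule K A} (h : ∀ x ∈ X, ∀ y ∈ Y, f (x ⊗ₜ y) ∈ S) {z : M ⊗[K] N}
    (hz : z ∈ tens X Y) : f z ∈ S :=
  (tens_le (S := S.comap f)).2 h hz

/-- The subspace `X ⊗ N + M ⊗ Y` of `M ⊗ N`. -/
def orth (X : Submodule K M) (Y : Submodule K N) : Submodule K (M ⊗[K] N) :=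
  tens ⊤ Y ⊔ tens X ⊤

theorem orth_mono {X X' : Submodule K M} {Y Y' : Submodule K N} (hX : X ≤ X') (hY : Y ≤ Y') :
    orth X Y ≤ orth X' Y' :=
  sup_le_sup (tens_mono le_rfl hY) (tens_mono hX le_rfl)

/-- The kernel of a tensor product of linear maps over a field. -/
theorem ker_map (f : M →ₗ[K] A) (g : N →ₗ[K] B) :
    LinearMap.ker (TensorProduct.map f g) = orth (LinearMap.ker f) (LinearMap.ker g) := by
  apply le_antisymm
  · intro z hz
    have hinj : Function.Injective
        (TensorProduct.map (LinearMap.range f).subtype (LinearMap.range g).subtype) :=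
      TensorProduct.map_injective_of_flat_flat _ _ (Submodule.subtype_injective _)
        (Submodule.subtype_injective _)
    have hz' : z ∈ LinearMap.ker (TensorProduct.map f.rangeRestrict g.rangeRestrict) := by
      apply hinj
      rw [map_zero, ← LinearMap.comp_apply, ← TensorProduct.map_comp]
      exact hz
    have hker := TensorProduct.map_ker
      (show Function.Exact (LinearMap.ker f).subtype f.rangeRestrict from fun x => by
        rw [Subtype.ext_iff]; simp) f.surjective_rangeRestrict
      (show Function.Exact (LinearMap.ker g).subtype g.rangeRestrict from fun x => by
        rw [Subtype.ext_iff]; simp) g.surjective_rangeRestrict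
    rw [hker] at hz'
    refine (sup_le_sup ?_ ?_ : _ ≤ orth _ _) hz'
    · rintro _ ⟨w, rfl⟩
      induction w with
      | zero => rw [map_zero]; exact zero_mem _
      | add a b ha hb => rw [map_add]; exact add_mem ha hb
      | tmul x y => exact tmul_mem_tens trivial y.2
    · rintro _ ⟨w, rfl⟩
      induction w with
      | zero => rw [map_zero]; exact zero_mem _
      | add a b ha hb => rw [map_add]; exact add_mem ha hb
      | tmul x y => exact tmul_mem_tens x.2 trivial
  · refine sup_le (tens_le.2 fun x _ y hy => ?_) (tens_le.2 fun x hx y _ => ?_)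
    · rw [LinearMap.mem_ker, TensorProduct.map_tmul, LinearMap.mem_ker.1 hy,
        TensorProduct.tmul_zero]
    · rw [LinearMap.mem_ker, TensorProduct.map_tmul, LinearMap.mem_ker.1 hx,
        TensorProduct.zero_tmul]

theorem map_eq_zero_iff_mem_orth (f : M →ₗ[K] A) (g : N →ₗ[K] B) (z : M ⊗[K] N) :
    TensorProduct.map f g z = 0 ↔ z ∈ orth (LinearMap.ker f) (LinearMap.ker g) := by
  rw [← ker_map, LinearMap.mem_ker]

theorem map_mkQ_eq_zero_iff (X : Submodule K M) (Y : Submodule K N) (z : M ⊗[K] N) :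
    TensorProduct.map X.mkQ Y.mkQ z = 0 ↔ z ∈ orth X Y := by
  rw [map_eq_zero_iff_mem_orth, Submodule.ker_mkQ, Submodule.ker_mkQ]

theorem orth_bot_left (Y : Submodule K N) : orth (⊥ : Submodule K M) Y = tens ⊤ Y := by
  refine sup_eq_left.2 (tens_le.2 fun x hx y _ => ?_)
  rw [(Submodule.mem_bot K).1 hx, TensorProduct.zero_tmul]
  exact zero_mem _

theorem orth_bot_right (X : Submodule K M) : orth X (⊥ : Submodule K N) = tens X ⊤ := by
  refine sup_eq_right.2 (tens_le.2 fun x _ y hy => ?_)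
  rw [(Submodule.mem_bot K).1 hy, TensorProduct.tmul_zero]
  exact zero_mem _

theorem lTensor_eq_zero_iff (f : N →ₗ[K] B) (z : M ⊗[K] N) :
    f.lTensor M z = 0 ↔ z ∈ tens ⊤ (LinearMap.ker f) := by
  rw [LinearMap.lTensor, map_eq_zero_iff_mem_orth, LinearMap.ker_id, orth_bot_left]

theorem rTensor_eq_zero_iff (f : M →ₗ[K] A) (z : M ⊗[K] N) :
    f.rTensor N z = 0 ↔ z ∈ tens (LinearMap.ker f) ⊤ := by
  rw [LinearMap.rTensor, map_eq_zero_iff_mem_orth, LinearMap.ker_id, orth_bot_right]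

/-- `(X ⊗ N) ∩ (M ⊗ Y) = X ⊗ Y`. -/
theorem tens_inf (X : Submodule K M) (Y : Submodule K N) {z : M ⊗[K] N} (hX : z ∈ tens X ⊤)
    (hY : z ∈ tens ⊤ Y) : z ∈ tens X Y := by
  have hY' : tens ⊤ Y ≤ LinearMap.range (Y.subtype.lTensor M) :=
    tens_le.2 fun x _ y hy => ⟨x ⊗ₜ ⟨y, hy⟩, rfl⟩
  obtain ⟨w, rfl⟩ := hY' hY
  have h₁ : X.mkQ.rTensor N (Y.subtype.lTensor M w) = 0 := by
    rw [rTensor_eq_zero_iff, Submodule.ker_mkQ]; exact hX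
  have h₂ : X.mkQ.rTensor Y w = 0 := by
    apply Module.Flat.lTensor_preserves_injective_linearMap (M := M ⧸ X) Y.subtype
      Y.subtype_injective
    rw [map_zero, ← h₁]
    exact (LinearMap.congr_fun (LinearMap.lTensor_comp_rTensor _ _ _) w).trans
      (LinearMap.congr_fun (LinearMap.rTensor_comp_lTensor _ _ _) w).symm
  rw [rTensor_eq_zero_iff, Submodule.ker_mkQ] at h₂
  exact map_mem_of_mem_tens (Y.subtype.lTensor M) (fun x hx y _ => tmul_mem_tens hx y.2) h₂

end Subspaces

/-! ### Wedges of subspaces of a coalgebra -/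

section Wedge

variable {K M : Type*} [Field K] [AddCommGroup M] [Module K M]

/-- The wedge `X ∧ Y = Δ⁻¹(X ⊗ M + M ⊗ Y)`. -/
def wedge (Δ : M →ₗ[K] M ⊗[K] M) (X Y : Submodule K M) : Submodule K M :=
  (orth X Y).comap Δ

variable {Δ : M →ₗ[K] M ⊗[K] M}

theorem wedge_mono {X X' Y Y' : Submodule K M} (hX : X ≤ X') (hY : Y ≤ Y') :
    wedge Δ X Y ≤ wedge Δ X' Y' :=
  Submodule.comap_mono (orth_mono hX hY)

theorem ker_map_mkQ_comp (X Y : Submodule K M) :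
    LinearMap.ker (TensorProduct.map X.mkQ Y.mkQ ∘ₗ Δ) = wedge Δ X Y := by
  ext x
  rw [LinearMap.mem_ker, LinearMap.comp_apply, map_mkQ_eq_zero_iff]
  rfl

theorem coradicalFiltration_succ (n : ℕ) :
    coradicalFiltration Δ (n + 1) = wedge Δ (coradicalFiltration Δ 0) (coradicalFiltration Δ n) :=
  rfl

/-- Both sides are the kernel of the map to `(M / X) ⊗ (M / Y) ⊗ (M / Z)` given by the iterated
comultiplication. -/
theorem wedge_assoc (hΔ : (TensorProduct.assoc K M M M).toLinearMap ∘ₗ Δ.rTensor M ∘ₗ Δ =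
    Δ.lTensor M ∘ₗ Δ) (X Y Z : Submodule K M) :
    wedge Δ (wedge Δ X Y) Z = wedge Δ X (wedge Δ Y Z) := by
  have h₁ : wedge Δ (wedge Δ X Y) Z = LinearMap.ker
      (TensorProduct.map (TensorProduct.map X.mkQ Y.mkQ) Z.mkQ ∘ₗ Δ.rTensor M ∘ₗ Δ) := by
    ext x
    rw [← LinearMap.comp_assoc, LinearMap.rTensor, ← TensorProduct.map_comp, LinearMap.mem_ker,
      LinearMap.comp_apply, map_eq_zero_iff_mem_orth, ker_map_mkQ_comp, LinearMap.comp_id,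
      Submodule.ker_mkQ]
    rfl
  have h₂ : wedge Δ X (wedge Δ Y Z) = LinearMap.ker
      (TensorProduct.map X.mkQ (TensorProduct.map Y.mkQ Z.mkQ) ∘ₗ Δ.lTensor M ∘ₗ Δ) := by
    ext x
    rw [← LinearMap.comp_assoc, LinearMap.lTensor, ← TensorProduct.map_comp, LinearMap.mem_ker,
      LinearMap.comp_apply, map_eq_zero_iff_mem_orth, ker_map_mkQ_comp, LinearMap.comp_id,
      Submodule.ker_mkQ]
    rfl
  have h₃ : TensorProduct.map X.mkQ (TensorProduct.map Y.mkQ Z.mkQ) ∘ₗ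
      (TensorProduct.assoc K M M M).toLinearMap ∘ₗ Δ.rTensor M ∘ₗ Δ =
      (TensorProduct.assoc K _ _ _).toLinearMap ∘ₗ
        TensorProduct.map (TensorProduct.map X.mkQ Y.mkQ) Z.mkQ ∘ₗ Δ.rTensor M ∘ₗ Δ := by
    rw [← LinearMap.comp_assoc, TensorProduct.map_map_comp_assoc_eq, LinearMap.comp_assoc]
  rw [h₁, h₂, ← hΔ, h₃, LinearEquiv.ker_comp]

theorem isSubcoalgebra_coradical : IsSubcoalgebra Δ (coradical Δ) := by
  have h : coradical Δ ≤ (tens (coradical Δ) (coradical Δ)).comap Δ := by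
    refine sSup_le fun D hD x hx => ?_
    have hle : D ≤ coradical Δ := le_sSup hD
    exact tens_mono hle hle (hD.1 x hx)
  exact h

/-- The steps of the coradical filtration are left coideals. -/
theorem coradicalFiltration_le_wedge_bot
    (hΔ : (TensorProduct.assoc K M M M).toLinearMap ∘ₗ Δ.rTensor M ∘ₗ Δ = Δ.lTensor M ∘ₗ Δ)
    (n : ℕ) : coradicalFiltration Δ n ≤ wedge Δ ⊥ (coradicalFiltration Δ n) := by
  have h₀ : coradicalFiltration Δ 0 ≤ wedge Δ ⊥ (coradicalFiltration Δ 0) := fun x hx => by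
    rw [wedge, orth_bot_left]
    exact tens_mono le_top le_rfl (isSubcoalgebra_coradical x hx)
  cases n with
  | zero => exact h₀
  | succ n =>
    rw [coradicalFiltration_succ, ← wedge_assoc hΔ]
    exact wedge_mono h₀ le_rfl

/-- By associativity of the wedge, `C_{i+j}` is contained in the wedge of `C_i` and `C_{j-1}`;
for `j = 0` the second factor is zero, and this says that `C_i` is a right coideal. -/
theorem coradicalFiltration_le_wedge_pred
    (hΔ : (TensorProduct.assoc K M M M).toLinearMap ∘ₗ Δ.rTensor M ∘ₗ Δ = Δ.lTensor M ∘ₗ Δ)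
    (i j : ℕ) : coradicalFiltration Δ (i + j) ≤
      wedge Δ (coradicalFiltration Δ i) (pred (coradicalFiltration Δ) j) := by
  induction i with
  | zero =>
    rw [zero_add]
    cases j with
    | zero =>
      intro x hx
      rw [wedge, pred, orth_bot_right]
      exact tens_mono le_rfl le_top (isSubcoalgebra_coradical x hx)
    | succ j => exact le_rfl
  | succ i ih =>
    rw [show i + 1 + j = i + j + 1 by omega, coradicalFiltration_succ, coradicalFiltration_succ,
      wedge_assoc hΔ]
    exact wedge_mono le_rfl ih

/-- If the symbol of `w ∈ F_a ⊗ F_b` in `F_a/F_{a-1} ⊗ F_b/F_{b-1}` vanishes, then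
`w ∈ F_{a-1} ⊗ F_b + F_a ⊗ F_{b-1}`. -/
theorem mapIncl_mem_of_map_cls_eq_zero {F : ℕ → Submodule K M} {a b : ℕ} {w : F a ⊗[K] F b}
    (hw : TensorProduct.map (cls F a) (cls F b) w = 0) :
    TensorProduct.mapIncl (F a) (F b) w ∈ tens (F a) (pred F b) ⊔ tens (pred F a) (F b) := by
  rw [map_eq_zero_iff_mem_orth] at hw
  have h : orth (LinearMap.ker (cls F a)) (LinearMap.ker (cls F b)) ≤
      (tens (F a) (pred F b) ⊔ tens (pred F a) (F b)).comap
        (TensorProduct.mapIncl (F a) (F b)) := by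
    refine sup_le (tens_le.2 fun x _ y hy => ?_) (tens_le.2 fun x hx y _ => ?_)
    · exact Submodule.mem_sup_left (tmul_mem_tens x.2 ((cls_eq_zero_iff y).1 hy))
    · exact Submodule.mem_sup_right (tmul_mem_tens ((cls_eq_zero_iff x).1 hx) y.2)
  exact h hw

/-- The component of degree `(a, b)` of the symbol of a sum of tensors. -/
theorem map_grSymb_sum {F : ℕ → Submodule K M} (hF : Monotone F) {n a b : ℕ} (hab : a + b = n)
    (w : ∀ p : ℕ × ℕ, F p.1 ⊗[K] F p.2) :
    TensorProduct.map (grSymb F a) (grSymb F b)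
      (∑ p ∈ Finset.HasAntidiagonal.antidiagonal n, TensorProduct.mapIncl (F p.1) (F p.2) (w p)) =
      TensorProduct.map (cls F a) (cls F b) (w (a, b)) := by
  rw [map_sum, Finset.sum_eq_single (a, b)]
  · have : TensorProduct.map (grSymb F a) (grSymb F b) ∘ₗ TensorProduct.mapIncl (F a) (F b) =
        TensorProduct.map (cls F a) (cls F b) :=
      TensorProduct.ext' fun x y => by simp [TensorProduct.mapIncl, grSymb_apply]
    exact LinearMap.congr_fun this _
  · rintro ⟨p, q⟩ hpq hne
    rw [Finset.HasAntidiagonal.mem_antidiagonal] at hpq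
    have : TensorProduct.map (grSymb F a) (grSymb F b) ∘ₗ TensorProduct.mapIncl (F p) (F q) = 0 :=
      TensorProduct.ext' fun x y => by
        dsimp only at hpq
        rw [LinearMap.comp_apply, TensorProduct.mapIncl, TensorProduct.map_tmul,
          TensorProduct.map_tmul, LinearMap.zero_apply]
        rcases lt_trichotomy p a with h | h | h
        · rw [Submodule.subtype_apply, grSymb_of_lt hF h x.2, TensorProduct.zero_tmul]
        · exact absurd (Prod.ext h (by dsimp only; omega)) hne
        · rw [Submodule.subtype_apply, Submodule.subtype_apply,
            grSymb_of_lt hF (show q < b by omega) y.2, TensorProduct.tmul_zero]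
    exact LinearMap.congr_fun this _
  · intro h
    simp [hab] at h

/-- The symbol of degree `(a, b)` vanishes on `F_{a-1} ⊗ M + M ⊗ F_{b-1}`. -/
theorem map_grSymb_eq_zero {F : ℕ → Submodule K M} (hF : Monotone F) {a b : ℕ} {z : M ⊗[K] M}
    (hz : z ∈ orth (pred F a) (pred F b)) :
    TensorProduct.map (grSymb F a) (grSymb F b) z = 0 := by
  rw [map_eq_zero_iff_mem_orth]
  exact orth_mono (fun x hx => grSymb_of_mem_pred hF hx) (fun x hx => grSymb_of_mem_pred hF hx) hz

theorem pred_mono_index {F : ℕ → Submodule K M} (hF : Monotone F) : Monotone (pred F) := by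
  refine monotone_nat_of_le_succ fun n => ?_
  exact pred_le hF n

/-- The total filtration of `M ⊗ M`. -/
def totalFiltration (F : ℕ → Submodule K M) (n : ℕ) : Submodule K (M ⊗[K] M) :=
  ⨆ p ∈ Finset.HasAntidiagonal.antidiagonal n, tens (F p.1) (F p.2)

theorem tens_le_totalFiltration {F : ℕ → Submodule K M} (hF : Monotone F) {n a b : ℕ}
    (hab : a + b ≤ n) : tens (F a) (F b) ≤ totalFiltration F n := by
  have hp : (a, n - a) ∈ Finset.HasAntidiagonal.antidiagonal n := by
    rw [Finset.HasAntidiagonal.mem_antidiagonal]; dsimp only; omega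
  intro z hz
  exact Submodule.mem_iSup_of_mem (a, n - a) (Submodule.mem_iSup_of_mem hp
    (tens_mono le_rfl (hF (show b ≤ n - a by omega)) hz))

theorem totalFiltration_mono {F : ℕ → Submodule K M} (hF : Monotone F) :
    Monotone (totalFiltration F) := fun m n hmn => by
  refine iSup₂_le fun p hp => tens_le_totalFiltration hF ?_
  rw [Finset.HasAntidiagonal.mem_antidiagonal] at hp
  omega

theorem exists_mem_of_exhaustive {F : ℕ → Submodule K M} (hF : Monotone F) (hF' : ⨆ n, F n = ⊤)
    (x : M) : ∃ n, x ∈ F n :=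
  (Submodule.mem_iSup_of_directed F hF.directed_le).1 (hF' ▸ trivial)

theorem exists_mem_totalFiltration {F : ℕ → Submodule K M} (hF : Monotone F) (hF' : ⨆ n, F n = ⊤)
    (z : M ⊗[K] M) : ∃ n, z ∈ totalFiltration F n := by
  induction z with
  | zero => exact ⟨0, zero_mem _⟩
  | add a b ha hb =>
    obtain ⟨m, hm⟩ := ha
    obtain ⟨n, hn⟩ := hb
    exact ⟨max m n, add_mem (totalFiltration_mono hF (le_max_left m n) hm)
      (totalFiltration_mono hF (le_max_right m n) hn)⟩
  | tmul x y =>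
    obtain ⟨m, hm⟩ := exists_mem_of_exhaustive hF hF' x
    obtain ⟨n, hn⟩ := exists_mem_of_exhaustive hF hF' y
    exact ⟨m + n, tens_le_totalFiltration hF le_rfl (tmul_mem_tens hm hn)⟩

/-- The intersection of the subspaces `F_{i-1} ⊗ M + M ⊗ F_{j-1}` with `i + j = n + 1` is the
`n`-th step of the total filtration: the symbols of higher total degree vanish. -/
theorem mem_totalFiltration_of_mem_orth {F : ℕ → Submodule K M} (hF : Monotone F)
    (hF' : ⨆ n, F n = ⊤) {n : ℕ} {z : M ⊗[K] M}
    (hz : ∀ i j, i + j = n + 1 → z ∈ orth (pred F i) (pred F j)) : z ∈ totalFiltration F n := by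
  obtain ⟨m, hm⟩ := exists_mem_totalFiltration hF hF' z
  induction m with
  | zero => exact totalFiltration_mono hF n.zero_le hm
  | succ m ih =>
    rcases le_or_gt (m + 1) n with h | h
    · exact totalFiltration_mono hF h hm
    · refine ih ?_
      obtain ⟨w, hw⟩ := mem_iSup_antidiagonal_iff.1 hm
      rw [hw]
      refine sum_mem ?_
      rintro ⟨a, b⟩ hab
      rw [Finset.HasAntidiagonal.mem_antidiagonal] at hab
      dsimp only at hab ⊢
      have hz' : z ∈ orth (pred F a) (pred F b) := by
        have := hz (min a (n + 1)) (n + 1 - min a (n + 1)) (by omega)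
        exact orth_mono (pred_mono_index hF (by omega)) (pred_mono_index hF (by omega)) this
      have h₀ := map_grSymb_eq_zero hF hz'
      rw [hw, map_grSymb_sum hF hab] at h₀
      refine (sup_le ?_ ?_ : tens (F a) (pred F b) ⊔ tens (pred F a) (F b) ≤ _)
        (mapIncl_mem_of_map_cls_eq_zero h₀)
      · cases b with
        | zero =>
          refine tens_le.2 fun x _ y hy => ?_
          rw [(Submodule.mem_bot K).1 hy, TensorProduct.tmul_zero]
          exact zero_mem _
        | succ b => exact tens_le_totalFiltration hF (by omega)
      · cases a with
        | zero =>
          refine tens_le.2 fun x hx y _ => ?_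
          rw [(Submodule.mem_bot K).1 hx, TensorProduct.zero_tmul]
          exact zero_mem _
        | succ a => exact tens_le_totalFiltration hF (by omega)

end Wedge

/-! ### The coradical filtration of a connected braided bialgebra -/

section Connected

variable {K M : Type*} [Field K] [AddCommGroup M] [Module K M] {D : BraidedBialgebraData K M}
  {F : ℕ → Submodule K M}

theorem eq_zero_of_comul_eq_zero (hD : D.IsBraidedBialgebra) {x : M} (hx : D.comul x = 0) :
    x = 0 := by
  have h := hD.counit_left x
  rw [hx, map_zero] at h
  simpa using congrArg (TensorProduct.lid K M) h.symm

theorem one_ne_zero_of_isBraidedBialgebra (hD : D.IsBraidedBialgebra) : D.one ≠ 0 := fun h => by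
  have h' := hD.counit_one
  rw [h, map_zero] at h'
  exact zero_ne_one h'

theorem totalFiltration_succ_le (n : ℕ) : totalFiltration F (n + 1) ≤
    tens (F 0) (F (n + 1)) ⊔ ⨆ p ∈ Finset.HasAntidiagonal.antidiagonal n,
      tens (F (p.1 + 1)) (F p.2) := by
  refine iSup₂_le ?_
  rintro ⟨a, b⟩ hab
  rw [Finset.HasAntidiagonal.mem_antidiagonal] at hab
  dsimp only at hab ⊢
  cases a with
  | zero =>
    obtain rfl : b = n + 1 := by omega
    exact le_sup_left
  | succ a =>
    have hp : (a, b) ∈ Finset.HasAntidiagonal.antidiagonal n := by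
      rw [Finset.HasAntidiagonal.mem_antidiagonal]; dsimp only; omega
    exact fun z hz => Submodule.mem_sup_right
      (Submodule.mem_iSup_of_mem (a, b) (Submodule.mem_iSup_of_mem hp hz))

/-- An element of total degree `n + 1` has its component of degree `(0, n + 1)` in `F_0 ⊗ M` and all
others in `M ⊗ F_n`. -/
theorem totalFiltration_succ_le_orth (hF : Monotone F) (n : ℕ) :
    totalFiltration F (n + 1) ≤ orth (F 0) (F n) := by
  refine (totalFiltration_succ_le n).trans (sup_le ?_ (iSup₂_le fun p hp => ?_))
  · exact (tens_mono le_rfl le_top).trans le_sup_right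
  · rw [Finset.HasAntidiagonal.mem_antidiagonal] at hp
    exact (tens_mono le_top (hF (by omega))).trans le_sup_left

theorem IsCompatible.le_wedge (hF : IsCompatible D F) (n : ℕ) :
    F (n + 1) ≤ wedge D.comul (F 0) (F n) :=
  fun x hx => totalFiltration_succ_le_orth hF.monotone n (hF.comul_mem (n + 1) x hx)

/-- If a coalgebra filtration starts with the scalars, then the scalars are the coradical. A simple
subcoalgebra not containing `1` would meet each step of the filtration trivially: on the first
nontrivial intersection `Δ` would vanish. -/
theorem coradical_eq_span_one (hD : D.IsBraidedBialgebra) (hF : IsCompatible D F)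
    (h₀ : F 0 = Submodule.span K {D.one}) :
    coradical D.comul = Submodule.span K {D.one} := by
  have hsub : IsSubcoalgebra D.comul (Submodule.span K {D.one}) := by
    intro x hx
    obtain ⟨k, rfl⟩ := Submodule.mem_span_singleton.1 hx
    rw [map_smul, hD.comul_one]
    exact Submodule.smul_mem _ _ (tmul_mem_tens (Submodule.mem_span_singleton_self _)
      (Submodule.mem_span_singleton_self _))
  have hatom := nonzero_span_atom (K := K) D.one (one_ne_zero_of_isBraidedBialgebra hD)
  apply le_antisymm
  · refine sSup_le fun C hC => ?_
    by_cases h1 : D.one ∈ C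
    · have hle : Submodule.span K {D.one} ≤ C := by
        rwa [Submodule.span_singleton_le_iff_mem]
      rcases hC.2.2 _ hle hsub with h | h
      · exact absurd h hatom.1
      · exact h.ge
    · exfalso
      have key : ∀ n, C ⊓ F n = ⊥ := by
        intro n
        induction n with
        | zero =>
          rw [h₀]
          refine disjoint_iff.1 ((IsAtom.not_le_iff_disjoint hatom).1 ?_).symm
          rwa [Submodule.span_singleton_le_iff_mem]
        | succ n ih =>
          have hzero : C ⊓ F 0 = ⊥ :=
            le_bot_iff.1 ((inf_le_inf_left C (hF.monotone n.zero_le)).trans ih.le)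
          rw [eq_bot_iff]
          rintro x ⟨hxC, hxF⟩
          obtain ⟨w, hw⟩ := hC.1 x hxC
          have hx := hF.le_wedge n hxF
          rw [wedge, Submodule.mem_comap, ← map_mkQ_eq_zero_iff, ← hw, TensorProduct.mapIncl,
            ← LinearMap.comp_apply, ← TensorProduct.map_comp] at hx
          have hinj : ∀ G : Submodule K M, C ⊓ G = ⊥ →
              Function.Injective (G.mkQ ∘ₗ C.subtype) := by
            intro G hG
            rw [← LinearMap.ker_eq_bot, eq_bot_iff]
            intro y hy
            rw [LinearMap.mem_ker, LinearMap.comp_apply, Submodule.mkQ_apply,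
              Submodule.Quotient.mk_eq_zero] at hy
            have : (y : M) ∈ C ⊓ G := ⟨y.2, hy⟩
            rw [hG, Submodule.mem_bot] at this
            exact (Submodule.mem_bot K).2 (Subtype.ext this)
          have hw0 : w = 0 := TensorProduct.map_injective_of_flat_flat _ _ (hinj _ hzero)
            (hinj _ ih) (hx.trans (map_zero _).symm)
          rw [hw0, map_zero] at hw
          exact (Submodule.mem_bot K).2 (eq_zero_of_comul_eq_zero hD hw.symm)
      refine hC.2.1 (eq_bot_iff.2 fun x hx => ?_)
      obtain ⟨n, hn⟩ := exists_mem_of_exhaustive hF.monotone hF.exhaustive x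
      rw [← key n]
      exact ⟨hx, hn⟩
  · refine le_sSup ⟨hsub, hatom.1, fun E hE _ => ?_⟩
    exact hatom.le_iff.1 hE

/-- A coalgebra filtration starting with the coradical is contained in the coradical filtration. -/
theorem IsCompatible.le_coradicalFiltration (hF : IsCompatible D F)
    (h₀ : F 0 = coradical D.comul) (n : ℕ) : F n ≤ coradicalFiltration D.comul n := by
  induction n with
  | zero => exact h₀.le
  | succ n ih => exact (hF.le_wedge n).trans (wedge_mono h₀.le ih)

theorem coradicalFiltration_mono (hD : D.IsBraidedBialgebra) :
    Monotone (coradicalFiltration D.comul) :=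
  monotone_nat_of_le_succ fun n =>
    (coradicalFiltration_le_wedge_bot hD.coassoc n).trans (wedge_mono bot_le le_rfl)

theorem comul_mem_orth_pred (hD : D.IsBraidedBialgebra) {n i j : ℕ} (hij : i + j = n + 1) {x : M}
    (hx : x ∈ coradicalFiltration D.comul n) :
    D.comul x ∈ orth (pred (coradicalFiltration D.comul) i)
      (pred (coradicalFiltration D.comul) j) := by
  cases i with
  | zero =>
    obtain rfl : j = n + 1 := by omega
    exact coradicalFiltration_le_wedge_bot hD.coassoc n hx
  | succ i =>
    obtain rfl : n = i + j := by omega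
    exact coradicalFiltration_le_wedge_pred hD.coassoc i j hx

/-- The coradical filtration is a coalgebra filtration. -/
theorem comul_mem_totalFiltration (hD : D.IsBraidedBialgebra)
    (hC : ⨆ n, coradicalFiltration D.comul n = ⊤) {n : ℕ} {x : M}
    (hx : x ∈ coradicalFiltration D.comul n) :
    D.comul x ∈ totalFiltration (coradicalFiltration D.comul) n :=
  mem_totalFiltration_of_mem_orth (coradicalFiltration_mono hD) hC fun _ _ hij =>
    comul_mem_orth_pred hD hij hx

/-- By induction on `n`: `C_{n+1}` is the kernel of the map from `U` to `(U / C_0) ⊗ (U / C_n)`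
given by `Δ`, and `Δ` is pulled across the braiding. -/
theorem braid_mem_tens_top_left (hD : D.IsBraidedBialgebra)
    (h₀ : coradical D.comul = Submodule.span K {D.one}) (n : ℕ) {x : M}
    (hx : x ∈ coradicalFiltration D.comul n) (y : M) :
    D.braid (x ⊗ₜ y) ∈ tens ⊤ (coradicalFiltration D.comul n) := by
  induction n generalizing x y with
  | zero =>
    have hx' : x ∈ Submodule.span K {D.one} := h₀ ▸ hx
    obtain ⟨k, rfl⟩ := Submodule.mem_span_singleton.1 hx'
    rw [TensorProduct.smul_tmul, hD.braid_one_left]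
    exact tmul_mem_tens trivial (h₀.ge (Submodule.mem_span_singleton_self _))
  | succ n ih =>
    set C := coradicalFiltration D.comul with hC
    set φ := TensorProduct.map (C 0).mkQ (C n).mkQ with hφ
    have hker : LinearMap.ker (φ ∘ₗ D.comul) = C (n + 1) := ker_map_mkQ_comp _ _
    rw [← hker, ← lTensor_eq_zero_iff, LinearMap.lTensor_comp_apply,
      show D.comul.lTensor M (D.braid (x ⊗ₜ y)) = _ from
        LinearMap.congr_fun hD.braid_comul_left (x ⊗ₜ y)]
    have hx' : D.comul x ∈ orth (C 0) (C n) := hx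
    let Ψ : M ⊗[K] M →ₗ[K] M ⊗[K] ((M ⧸ C 0) ⊗[K] (M ⧸ C n)) := φ.lTensor M ∘ₗ
      braidFst D.braid ∘ₗ braidSnd D.braid ∘ₗ (TensorProduct.assoc K M M M).toLinearMap ∘ₗ
        (TensorProduct.mk K (M ⊗[K] M) M).flip y
    have hle : orth (C 0) (C n) ≤ LinearMap.ker Ψ := by
      refine sup_le (tens_le.2 fun a _ b hb => ?_) (tens_le.2 fun a ha b _ => ?_)
      · change φ.lTensor M (braidFst D.braid (a ⊗ₜ D.braid (b ⊗ₜ y))) = 0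
        refine (Submodule.mem_bot K).1 (map_mem_of_mem_tens (φ.lTensor M ∘ₗ braidFst D.braid ∘ₗ
          TensorProduct.mk K _ _ a) (fun y' _ b' hb' => (Submodule.mem_bot K).2 ?_) (ih hb y))
        rw [LinearMap.comp_apply, LinearMap.comp_apply, TensorProduct.mk_apply, braidFst_tmul]
        have hb'' : (C n).mkQ b' = 0 := (Submodule.Quotient.mk_eq_zero _).2 hb'
        generalize D.braid (a ⊗ₜ y') = q
        induction q with
        | zero => simp
        | add a b ha hb => rw [TensorProduct.add_tmul, map_add, map_add, ha, hb, add_zero]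
        | tmul u v => simp [hφ, hb'']
      · have ha' : a ∈ Submodule.span K {D.one} := h₀ ▸ ha
        obtain ⟨k, rfl⟩ := Submodule.mem_span_singleton.1 ha'
        have h1 : (C 0).mkQ D.one = 0 :=
          (Submodule.Quotient.mk_eq_zero _).2 (h₀.ge (Submodule.mem_span_singleton_self _))
        rw [← TensorProduct.smul_tmul']
        refine Submodule.smul_mem _ k ?_
        change φ.lTensor M (braidFst D.braid (D.one ⊗ₜ D.braid (b ⊗ₜ y))) = 0
        generalize D.braid (b ⊗ₜ y) = q
        induction q with
        | zero => simp
        | add a b ha hb => rw [TensorProduct.tmul_add, map_add, map_add, ha, hb, add_zero]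
        | tmul u v =>
          rw [braidFst_tmul, hD.braid_one_left]
          simp [hφ, h1]
    exact hle hx'

/-- The mirror image of `braid_mem_tens_top_left`. -/
theorem braid_mem_tens_top_right (hD : D.IsBraidedBialgebra)
    (h₀ : coradical D.comul = Submodule.span K {D.one}) (n : ℕ) (x : M) {y : M}
    (hy : y ∈ coradicalFiltration D.comul n) :
    D.braid (x ⊗ₜ y) ∈ tens (coradicalFiltration D.comul n) ⊤ := by
  induction n generalizing x y with
  | zero =>
    have hy' : y ∈ Submodule.span K {D.one} := h₀ ▸ hy
    obtain ⟨k, rfl⟩ := Submodule.mem_span_singleton.1 hy'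
    rw [TensorProduct.tmul_smul, map_smul, hD.braid_one_right]
    exact Submodule.smul_mem _ k
      (tmul_mem_tens (h₀.ge (Submodule.mem_span_singleton_self _)) trivial)
  | succ n ih =>
    set C := coradicalFiltration D.comul with hC
    set φ := TensorProduct.map (C 0).mkQ (C n).mkQ with hφ
    have hker : LinearMap.ker (φ ∘ₗ D.comul) = C (n + 1) := ker_map_mkQ_comp _ _
    have hcomul : D.comul.rTensor M (D.braid (x ⊗ₜ y)) = (TensorProduct.assoc K M M M).symm
        (braidSnd D.braid (braidFst D.braid (x ⊗ₜ D.comul y))) := by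
      rw [LinearEquiv.eq_symm_apply]
      exact LinearMap.congr_fun hD.braid_comul_right (x ⊗ₜ y)
    rw [← hker, ← rTensor_eq_zero_iff, LinearMap.rTensor_comp_apply, hcomul]
    have hy' : D.comul y ∈ orth (C 0) (C n) := hy
    let Ψ : M ⊗[K] M →ₗ[K] ((M ⧸ C 0) ⊗[K] (M ⧸ C n)) ⊗[K] M := φ.rTensor M ∘ₗ
      (TensorProduct.assoc K M M M).symm.toLinearMap ∘ₗ braidSnd D.braid ∘ₗ
        braidFst D.braid ∘ₗ TensorProduct.mk K M (M ⊗[K] M) x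
    have hle : orth (C 0) (C n) ≤ LinearMap.ker Ψ := by
      refine sup_le (tens_le.2 fun a _ b hb => ?_) (tens_le.2 fun a ha b _ => ?_)
      · change φ.rTensor M ((TensorProduct.assoc K M M M).symm (braidSnd D.braid
          (TensorProduct.assoc K M M M (D.braid (x ⊗ₜ a) ⊗ₜ b)))) = 0
        generalize D.braid (x ⊗ₜ a) = q
        induction q with
        | zero => simp
        | add a b ha hb => simp only [TensorProduct.add_tmul, map_add, ha, hb, add_zero]
        | tmul u v =>
          rw [TensorProduct.assoc_tmul, braidSnd_tmul]
          have h := map_mem_of_mem_tens (S := ⊥)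
            (A := ((M ⧸ C 0) ⊗[K] (M ⧸ C n)) ⊗[K] M) (φ.rTensor M ∘ₗ
            (TensorProduct.assoc K M M M).symm.toLinearMap ∘ₗ TensorProduct.mk K _ _ u)
            (fun b' hb' v' _ => (Submodule.mem_bot K).2 (by
              have hb'' : (C n).mkQ b' = 0 := (Submodule.Quotient.mk_eq_zero _).2 hb'
              simp [hφ, hb''])) (ih v hb)
          exact (Submodule.mem_bot K).1 h
      · have ha' : a ∈ Submodule.span K {D.one} := h₀ ▸ ha
        obtain ⟨k, rfl⟩ := Submodule.mem_span_singleton.1 ha'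
        have h1 : (C 0).mkQ D.one = 0 :=
          (Submodule.Quotient.mk_eq_zero _).2 (h₀.ge (Submodule.mem_span_singleton_self _))
        rw [← TensorProduct.smul_tmul']
        refine Submodule.smul_mem _ k ?_
        change φ.rTensor M ((TensorProduct.assoc K M M M).symm (braidSnd D.braid
          (TensorProduct.assoc K M M M (D.braid (x ⊗ₜ D.one) ⊗ₜ b)))) = 0
        rw [hD.braid_one_right, TensorProduct.assoc_tmul, braidSnd_tmul]
        generalize D.braid (x ⊗ₜ b) = q
        induction q with
        | zero => simp
        | add a b ha hb => simp only [TensorProduct.tmul_add, map_add, ha, hb, add_zero]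
        | tmul u v => simp [hφ, h1]
    exact hle hy'

theorem braid_mem_tens (hD : D.IsBraidedBialgebra)
    (h₀ : coradical D.comul = Submodule.span K {D.one}) (i j : ℕ) {x y : M}
    (hx : x ∈ coradicalFiltration D.comul i) (hy : y ∈ coradicalFiltration D.comul j) :
    D.braid (x ⊗ₜ y) ∈ tens (coradicalFiltration D.comul j) (coradicalFiltration D.comul i) :=
  tens_inf _ _ (braid_mem_tens_top_right hD h₀ j x hy) (braid_mem_tens_top_left hD h₀ i hx y)

theorem braidedMul_mem_tens {X Y X' Y' P Q : Submodule K M}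
    (hc : ∀ y ∈ Y, ∀ x' ∈ X', D.braid (y ⊗ₜ x') ∈ tens X' Y)
    (hP : ∀ x ∈ X, ∀ x' ∈ X', D.mul (x ⊗ₜ x') ∈ P)
    (hQ : ∀ y ∈ Y, ∀ y' ∈ Y', D.mul (y ⊗ₜ y') ∈ Q) {u v : M ⊗[K] M} (hu : u ∈ tens X Y)
    (hv : v ∈ tens X' Y') : D.braidedMul (u ⊗ₜ v) ∈ tens P Q := by
  refine map_mem_of_mem_tens (D.braidedMul ∘ₗ (TensorProduct.mk K _ _).flip v)
    (fun x hx y hy => ?_) hu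
  refine map_mem_of_mem_tens (D.braidedMul ∘ₗ TensorProduct.mk K _ _ (x ⊗ₜ y))
    (fun x' hx' y' hy' => ?_) hv
  change TensorProduct.map D.mul D.mul (midBraid D.braid ((x ⊗ₜ y) ⊗ₜ (x' ⊗ₜ y'))) ∈ _
  rw [midBraid_tmul]
  refine map_mem_of_mem_tens (TensorProduct.map D.mul D.mul ∘ₗ
    (TensorProduct.assoc K M M (M ⊗[K] M)).symm.toLinearMap ∘ₗ TensorProduct.mk K _ _ x ∘ₗ
    (TensorProduct.assoc K M M M).toLinearMap ∘ₗ (TensorProduct.mk K _ _).flip y')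
    (fun x₁ hx₁ y₁ hy₁ => ?_) (hc y hy x' hx')
  exact tmul_mem_tens (hP x hx x₁ hx₁) (hQ y₁ hy₁ y' hy')

/-- By induction on `i + j`: in `Δ(x y) = Δ(x) Δ(y)` the terms with left factor in `C_0 C_0` stay in
`C_0 ⊗ U`, and in all others the right factors have smaller total degree. -/
theorem mul_mem_coradicalFiltration (hD : D.IsBraidedBialgebra)
    (h₀ : coradical D.comul = Submodule.span K {D.one})
    (hC : ⨆ n, coradicalFiltration D.comul n = ⊤) (i j : ℕ) {x y : M}
    (hx : x ∈ coradicalFiltration D.comul i) (hy : y ∈ coradicalFiltration D.comul j) :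
    D.mul (x ⊗ₜ y) ∈ coradicalFiltration D.comul (i + j) := by
  obtain ⟨n, hn⟩ : ∃ n, n = i + j := ⟨_, rfl⟩
  induction n using Nat.strong_induction_on generalizing i j x y with
  | _ n ih =>
  have hzero : ∀ x ∈ coradicalFiltration D.comul 0, ∀ y ∈ coradicalFiltration D.comul 0,
      D.mul (x ⊗ₜ y) ∈ coradicalFiltration D.comul 0 := by
    intro x hx y hy
    have hx' : x ∈ Submodule.span K {D.one} := h₀ ▸ hx
    obtain ⟨k, rfl⟩ := Submodule.mem_span_singleton.1 hx'
    rw [← TensorProduct.smul_tmul', map_smul, hD.one_mul]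
    exact Submodule.smul_mem _ k hy
  cases n with
  | zero =>
    obtain rfl : i = 0 := by omega
    obtain rfl : j = 0 := by omega
    exact hzero x hx y hy
  | succ n =>
    rw [← hn]
    change D.comul (D.mul (x ⊗ₜ y)) ∈
      orth (coradicalFiltration D.comul 0) (coradicalFiltration D.comul n)
    rw [show D.comul (D.mul (x ⊗ₜ y)) = D.braidedMul (D.comul x ⊗ₜ D.comul y) from
      LinearMap.congr_fun hD.comul_mul (x ⊗ₜ y)]
    obtain ⟨u, hu⟩ := mem_iSup_antidiagonal_iff.1 (comul_mem_totalFiltration hD hC hx)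
    obtain ⟨v, hv⟩ := mem_iSup_antidiagonal_iff.1 (comul_mem_totalFiltration hD hC hy)
    rw [hu, hv, TensorProduct.sum_tmul, map_sum]
    refine sum_mem ?_
    rintro ⟨a, a'⟩ ha
    rw [Finset.HasAntidiagonal.mem_antidiagonal] at ha
    rw [TensorProduct.tmul_sum, map_sum]
    refine sum_mem ?_
    rintro ⟨b, b'⟩ hb
    rw [Finset.HasAntidiagonal.mem_antidiagonal] at hb
    dsimp only at ha hb ⊢
    have hbr : ∀ y ∈ coradicalFiltration D.comul a', ∀ x' ∈ coradicalFiltration D.comul b,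
        D.braid (y ⊗ₜ x') ∈
          tens (coradicalFiltration D.comul b) (coradicalFiltration D.comul a') :=
      fun y hy x' hx' => braid_mem_tens hD h₀ a' b hy hx'
    rcases Nat.eq_zero_or_pos (a + b) with h | h
    · obtain rfl : a = 0 := by omega
      obtain rfl : b = 0 := by omega
      exact Submodule.mem_sup_right (braidedMul_mem_tens (Q := ⊤) hbr hzero (fun _ _ _ _ => trivial)
        ⟨_, rfl⟩ ⟨_, rfl⟩)
    · refine Submodule.mem_sup_left (braidedMul_mem_tens (P := ⊤) hbr (fun _ _ _ _ => trivial)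
        (fun y hy y' hy' => ?_) ⟨_, rfl⟩ ⟨_, rfl⟩)
      exact coradicalFiltration_mono hD (show a' + b' ≤ n by omega)
        (ih (a' + b') (by omega) a' b' hy hy' rfl)

theorem isCompatible_coradicalFiltration (hD : D.IsBraidedBialgebra)
    (h₀ : coradical D.comul = Submodule.span K {D.one})
    (hC : ⨆ n, coradicalFiltration D.comul n = ⊤) :
    IsCompatible D (coradicalFiltration D.comul) where
  monotone := coradicalFiltration_mono hD
  exhaustive := hC
  mul_mem i j _ hx _ hy := mul_mem_coradicalFiltration hD h₀ hC i j hx hy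
  one_mem := h₀.ge (Submodule.mem_span_singleton_self _)
  comul_mem _ _ hx := comul_mem_totalFiltration hD hC hx
  braid_mem i j _ hx _ hy := braid_mem_tens hD h₀ i j hx hy

end Connected

/-! ### Comparison of a filtration with the coradical filtration -/

section Comparison

variable {K M : Type*} [Field K] [AddCommGroup M] [Module K M]

theorem GrPiece.map_mk {F F' : ℕ → Submodule K M} (hle : ∀ n, F n ≤ F' n) (n : ℕ) (x : F n) :
    GrPiece.map hle n (GrPiece.mk F n x) = GrPiece.mk F' n ⟨x, hle n x.2⟩ := rfl

theorem grId_injective_iff {F F' : ℕ → Submodule K M} (hF : Monotone F) (hle : ∀ n, F n ≤ F' n) :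
    Function.Injective (grId hle) ↔ ∀ n, F n ⊓ pred F' n = pred F n := by
  rw [grId, DirectSum.lmap_injective]
  refine forall_congr' fun n => ?_
  rw [injective_iff_map_eq_zero]
  constructor
  · intro h
    refine le_antisymm ?_ (le_inf (pred_le hF n) (pred_mono hle n))
    rintro x ⟨hx, hx'⟩
    have := h (GrPiece.mk F n ⟨x, hx⟩) (by
      rw [GrPiece.map_mk, GrPiece.mk_eq_zero_iff]; exact hx')
    rwa [GrPiece.mk_eq_zero_iff] at this
  · intro h y hy
    obtain ⟨x, rfl⟩ := GrPiece.mk_surjective F n y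
    rw [GrPiece.map_mk, GrPiece.mk_eq_zero_iff] at hy
    rw [GrPiece.mk_eq_zero_iff, ← h]
    exact ⟨x.2, hy⟩

theorem grId_surjective_iff {F F' : ℕ → Submodule K M} (hF' : Monotone F')
    (hle : ∀ n, F n ≤ F' n) :
    Function.Surjective (grId hle) ↔ ∀ n, F' n = F n ⊔ pred F' n := by
  rw [grId, DirectSum.lmap_surjective]
  refine forall_congr' fun n => ?_
  constructor
  · intro h
    refine le_antisymm (fun x hx => ?_) (sup_le (hle n) (pred_le hF' n))
    obtain ⟨y, hy⟩ := h (GrPiece.mk F' n ⟨x, hx⟩)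
    obtain ⟨y, rfl⟩ := GrPiece.mk_surjective F n y
    rw [GrPiece.map_mk, ← sub_eq_zero, ← map_sub, GrPiece.mk_eq_zero_iff] at hy
    refine Submodule.mem_sup.2 ⟨y, y.2, x - y, ?_, by abel⟩
    rw [← neg_sub]
    exact neg_mem hy
  · intro h y
    obtain ⟨⟨x, hx⟩, rfl⟩ := GrPiece.mk_surjective F' n y
    rw [h] at hx
    obtain ⟨y, hy, z, hz, rfl⟩ := Submodule.mem_sup.1 hx
    refine ⟨GrPiece.mk F n ⟨y, hy⟩, ?_⟩
    rw [GrPiece.map_mk, ← sub_eq_zero, ← map_sub, GrPiece.mk_eq_zero_iff]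
    change y - (y + z) ∈ pred F' n
    rw [sub_add_cancel_left]
    exact neg_mem hz

/-- An exhaustive filtration `F ⊆ F'` for which the comparison of graded spaces is injective is
equal to `F'`: an element of `F'_n` lies in some `F_m`, and as long as `m > n` it lies in
`F_{m-1}`. -/
theorem eq_of_inf_pred_eq {F F' : ℕ → Submodule K M} (hF : Monotone F) (hF₁ : ⨆ n, F n = ⊤)
    (hF' : Monotone F') (hle : ∀ n, F n ≤ F' n) (h : ∀ n, F n ⊓ pred F' n = pred F n) (n : ℕ) :
    F' n = F n := by
  refine le_antisymm (fun x hx => ?_) (hle n)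
  obtain ⟨m, hm⟩ := exists_mem_of_exhaustive hF hF₁ x
  induction m with
  | zero => exact hF n.zero_le hm
  | succ m ih =>
    rcases le_or_gt (m + 1) n with hmn | hmn
    · exact hF hmn hm
    · have : x ∈ pred F (m + 1) := by
        rw [← h]
        exact ⟨hm, hF' (Nat.lt_succ_iff.1 hmn) hx⟩
      exact ih this

/-- If the comparison of graded spaces is surjective, then `F = F'` by induction on the degree. -/
theorem eq_of_eq_sup_pred {F F' : ℕ → Submodule K M} (hF : Monotone F)
    (h : ∀ n, F' n = F n ⊔ pred F' n) (n : ℕ) : F' n = F n := by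
  induction n with
  | zero => rw [h 0]; exact sup_bot_eq _
  | succ n ih =>
    rw [h (n + 1), pred, ih]
    exact sup_eq_left.2 (hF n.le_succ)

variable {D : BraidedBialgebraData K M} {F : ℕ → Submodule K M}

theorem mem_primitives_iff {x : M} :
    x ∈ D.primitives ↔ D.comul x = x ⊗ₜ D.one + D.one ⊗ₜ x := Iff.rfl

theorem counit_eq_zero_of_mem_primitives (hD : D.IsBraidedBialgebra) {x : M}
    (hx : x ∈ D.primitives) : D.counit x = 0 := by
  have h := hD.counit_left x
  rw [mem_primitives_iff.1 hx, map_add, LinearMap.rTensor_tmul, LinearMap.rTensor_tmul,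
    hD.counit_one, add_eq_right] at h
  have h' := congrArg (TensorProduct.lid K M) h
  rw [TensorProduct.lid_tmul, map_zero] at h'
  exact (smul_eq_zero.1 h').resolve_right (one_ne_zero_of_isBraidedBialgebra hD)

/-- If `Δ x = 1 ⊗ a + b ⊗ 1`, then the counit laws show that `a` and `b` differ from `x` by
scalars. -/
theorem mem_primitives_of_comul_eq (hD : D.IsBraidedBialgebra) {x a b : M}
    (hε : D.counit x = 0) (hx : D.comul x = D.one ⊗ₜ a + b ⊗ₜ D.one) : x ∈ D.primitives := by
  have h₁ := congrArg (TensorProduct.lid K M) (hD.counit_left x)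
  have h₂ := congrArg (TensorProduct.rid K M) (hD.counit_right x)
  simp only [hx, map_add, LinearMap.rTensor_tmul, LinearMap.lTensor_tmul, hD.counit_one,
    TensorProduct.lid_tmul, TensorProduct.rid_tmul, one_smul] at h₁ h₂
  -- Here `h₁` says `a + ε(b) 1 = x`, and `h₂` says `ε(a) 1 + b = x`.
  have h₃ : D.counit a + D.counit b = 0 := by
    have := congrArg D.counit h₁
    rwa [map_add, map_smul, hD.counit_one, hε, smul_eq_mul, mul_one] at this
  rw [mem_primitives_iff, hx]
  have ha : a = x - D.counit b • D.one := by rw [← h₁]; abel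
  have hb : b = x - D.counit a • D.one := by rw [← h₂]; abel
  have h₄ : D.counit a • (D.one ⊗ₜ[K] D.one) + D.counit b • (D.one ⊗ₜ[K] D.one) = 0 := by
    rw [← add_smul, h₃, zero_smul]
  have ha' : D.one ⊗ₜ[K] a = D.one ⊗ₜ x - D.counit b • (D.one ⊗ₜ D.one) := by
    conv_lhs => rw [ha]
    rw [TensorProduct.tmul_sub, TensorProduct.tmul_smul]
  have hb' : b ⊗ₜ[K] D.one = x ⊗ₜ D.one - D.counit a • (D.one ⊗ₜ D.one) := by
    conv_lhs => rw [hb]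
    rw [TensorProduct.sub_tmul, TensorProduct.smul_tmul']
  rw [ha', hb', ← sub_eq_zero, ← neg_eq_zero.2 h₄]
  abel

variable {E : BraidedBialgebraData K (Gr F)}

theorem exists_map_cls_zero_left (hE : IsInduced D F E) (h₀ : F 0 = Submodule.span K {D.one})
    (n : ℕ) (z : F 0 ⊗[K] F n) :
    ∃ a, TensorProduct.map (cls F 0) (cls F n) z = E.one ⊗ₜ a := by
  induction z with
  | zero => exact ⟨0, by simp⟩
  | add u v hu hv =>
    obtain ⟨a, ha⟩ := hu
    obtain ⟨b, hb⟩ := hv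
    exact ⟨a + b, by rw [map_add, ha, hb, TensorProduct.tmul_add]⟩
  | tmul x y =>
    obtain ⟨k, hk⟩ := Submodule.mem_span_singleton.1 (h₀.le x.2)
    have hx : x = k • (⟨D.one, hE.one_mem⟩ : F 0) := Subtype.ext hk.symm
    exact ⟨k • cls F n y, by
      rw [hx, TensorProduct.map_tmul, map_smul, ← hE.one_eq, TensorProduct.smul_tmul]⟩

theorem exists_map_cls_zero_right (hE : IsInduced D F E) (h₀ : F 0 = Submodule.span K {D.one})
    (n : ℕ) (z : F n ⊗[K] F 0) :
    ∃ a, TensorProduct.map (cls F n) (cls F 0) z = a ⊗ₜ E.one := by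
  induction z with
  | zero => exact ⟨0, by simp⟩
  | add u v hu hv =>
    obtain ⟨a, ha⟩ := hu
    obtain ⟨b, hb⟩ := hv
    exact ⟨a + b, by rw [map_add, ha, hb, TensorProduct.add_tmul]⟩
  | tmul x y =>
    obtain ⟨k, hk⟩ := Submodule.mem_span_singleton.1 (h₀.le y.2)
    have hy : y = k • (⟨D.one, hE.one_mem⟩ : F 0) := Subtype.ext hk.symm
    exact ⟨k • cls F n x, by
      rw [hy, TensorProduct.map_tmul, map_smul, ← hE.one_eq, TensorProduct.tmul_smul,
        TensorProduct.smul_tmul']⟩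

/-- The class of an element of positive degree is primitive as soon as the inner components of the
comultiplication vanish. -/
theorem cls_mem_primitives (hE : IsInduced D F E) (hE' : E.IsBraidedBialgebra)
    (h₀ : F 0 = Submodule.span K {D.one}) {n : ℕ} (hn : n ≠ 0) (x : F n)
    {w : ∀ p : ℕ × ℕ, F p.1 ⊗[K] F p.2}
    (hw : D.comul x = ∑ p ∈ Finset.HasAntidiagonal.antidiagonal n,
      TensorProduct.mapIncl (F p.1) (F p.2) (w p))
    (hmid : ∀ a b, a + b = n → a ≠ 0 → b ≠ 0 →
      TensorProduct.map (cls F a) (cls F b) (w (a, b)) = 0) :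
    cls F n x ∈ E.primitives := by
  obtain ⟨a, ha⟩ := exists_map_cls_zero_left hE h₀ n (w (0, n))
  obtain ⟨b, hb⟩ := exists_map_cls_zero_right hE h₀ n (w (n, 0))
  refine mem_primitives_of_comul_eq hE' (a := a) (b := b) ?_ ?_
  · rw [hE.counit_eq, if_neg hn]
  · rw [hE.comul_eq n x w hw, ← ha, ← hb]
    refine Finset.sum_eq_add (0, n) (n, 0) (by simp [Ne.symm hn]) ?_ ?_ ?_
    · rintro ⟨i, j⟩ hij hne
      rw [Finset.HasAntidiagonal.mem_antidiagonal] at hij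
      dsimp only at hij
      refine hmid i j hij ?_ ?_
      · rintro rfl
        exact hne.1 (by simpa using hij)
      · rintro rfl
        exact hne.2 (by simpa using hij)
    · exact fun h => absurd (by simp) h
    · exact fun h => absurd (by simp) h

/-- If the only primitive elements of the graded braided bialgebra have degree one, then the
symbols of elements of the filtration do not degenerate in the coradical filtration: the class
of an element of minimal degree for which they would is primitive of degree at least two. -/
theorem inf_pred_le_of_primitives_le (hD : D.IsBraidedBialgebra) (hF : IsCompatible D F)
    (h₀ : F 0 = Submodule.span K {D.one}) (hE : IsInduced D F E) (hE' : E.IsBraidedBialgebra)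
    (hP : E.primitives ≤ grPart F 1) (n : ℕ) :
    F n ⊓ pred (coradicalFiltration D.comul) n ≤ pred F n := by
  have hC₀ : F 0 = coradical D.comul := h₀.trans (coradical_eq_span_one hD hF h₀).symm
  have hle := hF.le_coradicalFiltration hC₀
  have hC := coradicalFiltration_mono hD
  set C := coradicalFiltration D.comul
  induction n using Nat.strong_induction_on with
  | _ n ih =>
  rintro x ⟨hx, hx'⟩
  match n, ih, hx, hx' with
  | 0, _, _, hx' => exact hx'
  | 1, _, _, hx' => exact hC₀.ge hx'
  | n + 2, ih, hx, hx' =>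
    obtain ⟨w, hw⟩ := mem_iSup_antidiagonal_iff.1 (hF.comul_mem (n + 2) x hx)
    have hprim : cls F (n + 2) ⟨x, hx⟩ ∈ E.primitives := by
      refine cls_mem_primitives hE hE' h₀ (by omega) ⟨x, hx⟩ hw fun a b hab ha hb => ?_
      let w' : ∀ p : ℕ × ℕ, C p.1 ⊗[K] C p.2 := fun p =>
        TensorProduct.map (Submodule.inclusion (hle p.1)) (Submodule.inclusion (hle p.2)) (w p)
      have hw' : D.comul x = ∑ p ∈ Finset.HasAntidiagonal.antidiagonal (n + 2),
          TensorProduct.mapIncl (C p.1) (C p.2) (w' p) := by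
        rw [hw]
        refine Finset.sum_congr rfl fun p _ => ?_
        simp only [w', TensorProduct.mapIncl]
        rw [← LinearMap.comp_apply, ← TensorProduct.map_comp]
        rfl
      have hzero := map_grSymb_eq_zero hC (comul_mem_orth_pred hD hab hx')
      rw [hw', map_grSymb_sum hC hab] at hzero
      simp only [w'] at hzero
      rw [← LinearMap.comp_apply, ← TensorProduct.map_comp, map_eq_zero_iff_mem_orth] at hzero
      rw [map_eq_zero_iff_mem_orth]
      -- By the induction hypothesis the symbols of degree less than `n + 2` do not degenerate.
      have hker : ∀ i < n + 2, LinearMap.ker (cls C i ∘ₗ Submodule.inclusion (hle i)) ≤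
          LinearMap.ker (cls F i) := fun i hi y hy =>
        (cls_eq_zero_iff y).2 (ih i hi ⟨y.2, (cls_eq_zero_iff _).1 hy⟩)
      exact orth_mono (hker a (by omega)) (hker b (by omega)) hzero
    obtain ⟨y, hy⟩ := hP hprim
    have h₁ := congrArg (DirectSum.component K ℕ (GrPiece F) (n + 2)) hy
    rw [cls, LinearMap.comp_apply, DirectSum.component.lof_self, DirectSum.component.of,
      dif_neg (by omega), eq_comm, GrPiece.mk_eq_zero_iff] at h₁
    exact h₁

theorem component_cls_of_ne {m n : ℕ} (h : m ≠ n) (x : F m) :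
    DirectSum.component K ℕ (GrPiece F) n (cls F m x) = 0 := by
  rw [cls, LinearMap.comp_apply, DirectSum.component.of, dif_neg h]

theorem component_cls_self (n : ℕ) (x : F n) :
    DirectSum.component K ℕ (GrPiece F) n (cls F n x) = GrPiece.mk F n x := by
  rw [cls, LinearMap.comp_apply, DirectSum.component.lof_self]

theorem grPart_one_le_primitives (hF : IsCompatible D F)
    (h₀ : F 0 = Submodule.span K {D.one}) (hE : IsInduced D F E) (hE' : E.IsBraidedBialgebra) :
    grPart F 1 ≤ E.primitives := by
  rw [← range_cls]
  rintro _ ⟨x, rfl⟩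
  obtain ⟨w, hw⟩ := mem_iSup_antidiagonal_iff.1 (hF.comul_mem 1 x x.2)
  exact cls_mem_primitives hE hE' h₀ one_ne_zero x hw fun a b hab ha hb => by omega

/-- The component of degree `(a, b)` of the comultiplication of a class of degree `n`. -/
theorem map_component_comul_cls (hE : IsInduced D F E) {n a b : ℕ} (x : F n)
    {w : ∀ p : ℕ × ℕ, F p.1 ⊗[K] F p.2}
    (hw : D.comul x = ∑ p ∈ Finset.HasAntidiagonal.antidiagonal n,
      TensorProduct.mapIncl (F p.1) (F p.2) (w p)) :
    TensorProduct.map (DirectSum.component K ℕ (GrPiece F) a)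
      (DirectSum.component K ℕ (GrPiece F) b) (E.comul (cls F n x)) =
      if a + b = n then TensorProduct.map (GrPiece.mk F a) (GrPiece.mk F b) (w (a, b)) else 0 := by
  have hne : ∀ i j, (i, j) ≠ (a, b) → ∀ z : F i ⊗[K] F j,
      TensorProduct.map (DirectSum.component K ℕ (GrPiece F) a)
        (DirectSum.component K ℕ (GrPiece F) b)
        (TensorProduct.map (cls F i) (cls F j) z) = 0 := by
    intro i j hij z
    induction z with
    | zero => simp
    | add u v hu hv => rw [map_add, map_add, hu, hv, add_zero]
    | tmul u v =>
      rw [TensorProduct.map_tmul, TensorProduct.map_tmul]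
      by_cases hi : i = a
      · have hj : j ≠ b := fun hj => hij (by rw [hi, hj])
        rw [component_cls_of_ne hj, TensorProduct.tmul_zero]
      · rw [component_cls_of_ne hi, TensorProduct.zero_tmul]
  rw [hE.comul_eq n x w hw, map_sum]
  split_ifs with hab
  · rw [Finset.sum_eq_single (a, b) (fun p _ hp => hne p.1 p.2 hp _)
      (fun h => absurd (Finset.HasAntidiagonal.mem_antidiagonal.2 hab) h),
      ← LinearMap.comp_apply, ← TensorProduct.map_comp]
    congr 2 <;> exact LinearMap.ext fun y => component_cls_self _ y
  · refine Finset.sum_eq_zero fun p hp => hne p.1 p.2 (fun h => hab ?_) _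
    obtain ⟨rfl, rfl⟩ := Prod.mk.inj h
    exact Finset.HasAntidiagonal.mem_antidiagonal.1 hp

/-- The counit is injective on the component of degree zero. -/
theorem component_zero_of_counit_eq_zero (hD : D.IsBraidedBialgebra)
    (h₀ : F 0 = Submodule.span K {D.one}) (hE : IsInduced D F E) {g : Gr F}
    (hg : E.counit g = 0) : DirectSum.component K ℕ (GrPiece F) 0 g = 0 := by
  have h : E.counit = E.counit ∘ₗ DirectSum.lof K ℕ (GrPiece F) 0 ∘ₗ
      DirectSum.component K ℕ (GrPiece F) 0 := by
    refine gr_hom_ext fun n x => ?_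
    rw [LinearMap.comp_apply, LinearMap.comp_apply]
    by_cases hn : n = 0
    · subst hn
      rw [component_cls_self]
      rfl
    · rw [component_cls_of_ne hn, map_zero, map_zero, hE.counit_eq, if_neg hn]
  obtain ⟨x, hx⟩ := GrPiece.mk_surjective F 0 (DirectSum.component K ℕ (GrPiece F) 0 g)
  rw [h, LinearMap.comp_apply, LinearMap.comp_apply, ← hx] at hg
  have hg' : E.counit (cls F 0 x) = 0 := hg
  rw [hE.counit_eq, if_pos rfl] at hg'
  obtain ⟨k, hk⟩ := Submodule.mem_span_singleton.1 (h₀.le x.2)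
  rw [← hk, map_smul, hD.counit_one, smul_eq_mul, mul_one] at hg'
  rw [← hx, GrPiece.mk_eq_zero_iff, ← hk, hg', zero_smul]
  exact zero_mem _

/-- If the wedge of `F₀` and `F_m` is contained in `F_{m+1}` for all `m`, then the primitive
elements of the graded braided bialgebra have degree one. For a primitive element the component of
degree `(1, m + 1)` of the comultiplication vanishes, which puts a representative of the component
of degree `m + 2` into the wedge of `F₀` and `F_m`. -/
theorem primitives_le_grPart_one (hD : D.IsBraidedBialgebra) (hF : IsCompatible D F)
    (h₀ : F 0 = Submodule.span K {D.one}) (hE : IsInduced D F E) (hE' : E.IsBraidedBialgebra)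
    (hwedge : ∀ m, wedge D.comul (F 0) (F m) ≤ F (m + 1)) : E.primitives ≤ grPart F 1 := by
  intro g hg
  have hone : ∀ n, n ≠ 0 → DirectSum.component K ℕ (GrPiece F) n E.one = 0 := fun n hn => by
    rw [hE.one_eq, component_cls_of_ne (Ne.symm hn)]
  have hcomp : ∀ n, n ≠ 1 → DirectSum.component K ℕ (GrPiece F) n g = 0 := by
    intro n hn
    match n, hn with
    | 0, _ =>
      exact component_zero_of_counit_eq_zero hD h₀ hE (counit_eq_zero_of_mem_primitives hE' hg)
    | m + 2, _ =>
      -- The component of degree `(1, m + 1)` of the comultiplication only depends on the component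
      -- of degree `m + 2`.
      let Φ := TensorProduct.map (DirectSum.component K ℕ (GrPiece F) 1)
        (DirectSum.component K ℕ (GrPiece F) (m + 1)) ∘ₗ E.comul
      have hΦ : ∀ h, Φ h = Φ (DirectSum.lof K ℕ (GrPiece F) (m + 2)
          (DirectSum.component K ℕ (GrPiece F) (m + 2) h)) := by
        refine LinearMap.congr_fun (g := Φ ∘ₗ DirectSum.lof K ℕ (GrPiece F) (m + 2) ∘ₗ
          DirectSum.component K ℕ (GrPiece F) (m + 2)) (gr_hom_ext fun n x => ?_)
        change Φ (cls F n x) = Φ (DirectSum.lof K ℕ (GrPiece F) (m + 2)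
          (DirectSum.component K ℕ (GrPiece F) (m + 2) (cls F n x)))
        by_cases hn : n = m + 2
        · subst hn
          rw [component_cls_self]
          rfl
        · rw [component_cls_of_ne hn, map_zero, map_zero]
          obtain ⟨w, hw⟩ := mem_iSup_antidiagonal_iff.1 (hF.comul_mem n x x.2)
          exact (map_component_comul_cls hE x hw).trans (if_neg (by omega))
      obtain ⟨x, hx⟩ := GrPiece.mk_surjective F (m + 2)
        (DirectSum.component K ℕ (GrPiece F) (m + 2) g)
      have hg₀ : Φ g = 0 := by
        change TensorProduct.map _ _ (E.comul g) = 0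
        rw [mem_primitives_iff.1 hg, map_add, TensorProduct.map_tmul, TensorProduct.map_tmul,
          hone _ one_ne_zero, hone _ (Nat.succ_ne_zero m), TensorProduct.tmul_zero,
          TensorProduct.zero_tmul, add_zero]
      rw [hΦ, ← hx] at hg₀
      obtain ⟨w, hw⟩ := mem_iSup_antidiagonal_iff.1 (hF.comul_mem (m + 2) x x.2)
      have hw₁ : TensorProduct.map (GrPiece.mk F 1) (GrPiece.mk F (m + 1)) (w (1, m + 1)) = 0 :=
        ((map_component_comul_cls hE x hw).trans (if_pos (by omega))).symm.trans hg₀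
      have hw₂ : TensorProduct.map (cls F 1) (cls F (m + 1)) (w (1, m + 1)) = 0 := by
        rw [cls, cls, TensorProduct.map_comp, LinearMap.comp_apply, hw₁, map_zero]
      rw [← hx, GrPiece.mk_eq_zero_iff]
      refine hwedge m ?_
      change D.comul x ∈ orth (F 0) (F m)
      rw [hw]
      refine sum_mem ?_
      rintro ⟨a, b⟩ hab
      rw [Finset.HasAntidiagonal.mem_antidiagonal] at hab
      dsimp only at hab ⊢
      match a, b, hab with
      | 0, b, _ => exact Submodule.mem_sup_right (tens_mono le_rfl le_top ⟨_, rfl⟩)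
      | 1, b, hab =>
        obtain rfl : b = m + 1 := by omega
        have hmem := mapIncl_mem_of_map_cls_eq_zero hw₂
        have hle : tens (F 1) (F m) ⊔ tens (F 0) (F (m + 1)) ≤ orth (F 0) (F m) :=
          sup_le_sup (tens_mono le_top le_rfl) (tens_mono le_rfl le_top)
        exact hle hmem
      | a + 2, b, hab =>
        exact Submodule.mem_sup_left (tens_mono le_top (hF.monotone (by omega)) ⟨_, rfl⟩)
  refine ⟨DirectSum.component K ℕ (GrPiece F) 1 g, ?_⟩
  refine DirectSum.ext_component K fun n => ?_
  by_cases hn : n = 1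
  · subst hn
    rw [DirectSum.component.lof_self]
  · rw [DirectSum.component.of, dif_neg (Ne.symm hn), hcomp n hn]

/-- The conditions are equivalent for every filtration `F` of a braided bialgebra that starts
with the scalars and is respected by the structure; the subspaces `W n` generate `F_n` modulo
`F_{n-1}`. -/
theorem tfae_eq_coradicalFiltration (hD : D.IsBraidedBialgebra) (hF : IsCompatible D F)
    (h₀ : F 0 = Submodule.span K {D.one}) (hE : IsInduced D F E) (hE' : E.IsBraidedBialgebra)
    (hle : ∀ n, F n ≤ coradicalFiltration D.comul n) {W : ℕ → Submodule K M}
    (hW : ∀ n, F n = W n ⊔ pred F n) :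
    List.TFAE [
      Function.Bijective (grId hle),
      Function.Surjective (grId hle),
      Function.Injective (grId hle),
      ∀ n, F n ⊓ pred (coradicalFiltration D.comul) n = pred F n,
      ∀ n, coradicalFiltration D.comul n = F n ⊔ pred (coradicalFiltration D.comul) n,
      ∀ n, coradicalFiltration D.comul n = F n,
      E.primitives = grPart F 1,
      ∀ n, W n ⊓ pred (coradicalFiltration D.comul) n ≤ pred F n] := by
  have hC := coradicalFiltration_mono hD
  tfae_have 1 → 2 := fun h => h.surjective
  tfae_have 1 → 3 := fun h => h.injective
  tfae_have 2 ↔ 5 := grId_surjective_iff hC hle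
  tfae_have 3 ↔ 4 := grId_injective_iff hF.monotone hle
  tfae_have 4 → 6 := eq_of_inf_pred_eq hF.monotone hF.exhaustive hC hle
  tfae_have 5 → 6 := eq_of_eq_sup_pred hF.monotone
  tfae_have 6 → 1 := fun h => by
    have hCF : coradicalFiltration D.comul = F := funext h
    exact ⟨(grId_injective_iff hF.monotone hle).2 fun n => by
        rw [hCF]; exact inf_eq_right.2 (pred_le hF.monotone n),
      (grId_surjective_iff hC hle).2 fun n => by
        rw [hCF]; exact (sup_eq_left.2 (pred_le hF.monotone n)).symm⟩
  tfae_have 4 → 8 := fun h n =>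
    (inf_le_inf_right _ (le_sup_left.trans (hW n).ge)).trans (h n).le
  tfae_have 8 → 4 := fun h n => by
    refine le_antisymm ?_ (le_inf (pred_le hF.monotone n) (pred_mono hle n))
    -- The modular law, since `F_{n-1}` is contained in the `n - 1`-st step of the coradical
    -- filtration.
    rw [hW n, sup_comm, sup_inf_assoc_of_le _ (pred_mono hle n)]
    exact sup_le le_rfl (h n)
  tfae_have 7 → 4 := fun h n =>
    le_antisymm (inf_pred_le_of_primitives_le hD hF h₀ hE hE' h.le n)
      (le_inf (pred_le hF.monotone n) (pred_mono hle n))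
  tfae_have 6 → 7 := fun h => by
    refine le_antisymm (primitives_le_grPart_one hD hF h₀ hE hE' fun m => ?_)
      (grPart_one_le_primitives hF h₀ hE hE')
    rw [← h 0, ← h m, ← h (m + 1), coradicalFiltration_succ]
  tfae_finish

end Comparison

/-! ### The standard filtration -/

/-- The braided multiplication of `U ⊗ U` respects the total filtration. -/
theorem braidedMul_mem_totalFiltration {K M : Type*} [Field K] [AddCommGroup M] [Module K M]
    {D : BraidedBialgebraData K M} {F : ℕ → Submodule K M} (hF : Monotone F)
    (hmul : ∀ i j, ∀ x ∈ F i, ∀ y ∈ F j, D.mul (x ⊗ₜ y) ∈ F (i + j))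
    (hbraid : ∀ i j, ∀ x ∈ F i, ∀ y ∈ F j, D.braid (x ⊗ₜ y) ∈ tens (F j) (F i)) {m n : ℕ}
    {u v : M ⊗[K] M} (hu : u ∈ totalFiltration F m) (hv : v ∈ totalFiltration F n) :
    D.braidedMul (u ⊗ₜ v) ∈ totalFiltration F (m + n) := by
  suffices h : totalFiltration F m ≤ (totalFiltration F (m + n)).comap
      (D.braidedMul ∘ₗ (TensorProduct.mk K _ _).flip v) from h hu
  refine iSup₂_le fun p hp u hu => ?_
  suffices h : totalFiltration F n ≤ (totalFiltration F (m + n)).comap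
      (D.braidedMul ∘ₗ TensorProduct.mk K _ _ u) from h hv
  refine iSup₂_le fun q hq v hv => ?_
  rw [Finset.HasAntidiagonal.mem_antidiagonal] at hp hq
  exact tens_le_totalFiltration hF (show p.1 + q.1 + (p.2 + q.2) ≤ m + n by omega)
    (braidedMul_mem_tens (hbraid p.2 q.1) (hmul p.1 q.1) (hmul p.2 q.2) hu hv)

section Standard

variable {K V : Type*} [Field K] [AddCommGroup V] [Module K V] {c : V ⊗[K] V →ₗ[K] V ⊗[K] V}

theorem comulT_ι (v : V) : comulT c (TensorAlgebra.ι K v) =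
    TensorAlgebra.ι K v ⊗ₜ 1 + 1 ⊗ₜ TensorAlgebra.ι K v := by
  have h := comulT_ι_mul (c := c) v 1
  rw [mul_one, comulT_one, primMul_tmul, braidVT_one] at h
  simpa [ιMul] using h

namespace BraidedBiideal

variable (I : BraidedBiideal c)

theorem data_one : I.data.one = 1 := map_one (algebraMap K I.Quo)

theorem braid_mem_tens_imageV {x y : I.Quo} (hx : x ∈ I.imageV) (hy : y ∈ I.imageV) :
    I.data.braid (x ⊗ₜ y) ∈ tens I.imageV I.imageV := by
  obtain ⟨v, rfl⟩ := hx
  obtain ⟨w, rfl⟩ := hy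
  change I.proj₂ (braidTT c (TensorAlgebra.ι K v ⊗ₜ TensorAlgebra.ι K w)) ∈ _
  rw [braidTT_ι_left, braidVT_ι]
  generalize c (v ⊗ₜ w) = z
  induction z with
  | zero => simp
  | add a b ha hb => simp only [map_add]; exact add_mem ha hb
  | tmul x y => exact tmul_mem_tens ⟨x, rfl⟩ ⟨y, rfl⟩

theorem comul_incl (v : V) :
    I.data.comul (I.incl v) = I.incl v ⊗ₜ I.data.one + I.data.one ⊗ₜ I.incl v := by
  change I.proj₂ (comulT c (TensorAlgebra.ι K v)) = _
  rw [comulT_ι, map_add, data_one, ← map_one I.proj]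
  rfl

/-- The spaces `A` such that the braiding maps `A ⊗ Y` into `Y ⊗ A` are closed under products. -/
theorem braid_mem_tens_mul_left (hc : IsBraiding c) {A A' Y : Submodule K I.Quo}
    (hA : ∀ a ∈ A, ∀ y ∈ Y, I.data.braid (a ⊗ₜ y) ∈ tens Y A)
    (hA' : ∀ a ∈ A', ∀ y ∈ Y, I.data.braid (a ⊗ₜ y) ∈ tens Y A') :
    ∀ a ∈ A * A', ∀ y ∈ Y, I.data.braid (a ⊗ₜ y) ∈ tens Y (A * A') := by
  intro a ha y hy
  suffices h : A * A' ≤ (tens Y (A * A')).comap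
      (I.data.braid ∘ₗ (TensorProduct.mk K _ _).flip y) from h ha
  refine Submodule.mul_le.2 fun a ha a' ha' => ?_
  have h : I.data.braid ((a * a') ⊗ₜ y) = I.data.mul.lTensor _ (braidFst I.data.braid
      (a ⊗ₜ I.data.braid (a' ⊗ₜ y))) :=
    LinearMap.congr_fun (I.isBraidedBialgebra_data hc).braid_mul_left (a ⊗ₜ (a' ⊗ₜ y))
  change I.data.braid ((a * a') ⊗ₜ y) ∈ tens Y (A * A')
  rw [h]
  refine map_mem_of_mem_tens (I.data.mul.lTensor _ ∘ₗ braidFst I.data.braid ∘ₗ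
    TensorProduct.mk K _ _ a) (fun y₁ hy₁ a₁ ha₁ => ?_) (hA' a' ha' y hy)
  change I.data.mul.lTensor _ (braidFst I.data.braid (a ⊗ₜ (y₁ ⊗ₜ a₁))) ∈ _
  rw [braidFst_tmul]
  exact map_mem_of_mem_tens (I.data.mul.lTensor _ ∘ₗ
    (TensorProduct.assoc K _ _ _).toLinearMap ∘ₗ (TensorProduct.mk K _ _).flip a₁)
    (fun y₂ hy₂ a₂ ha₂ => tmul_mem_tens hy₂ (Submodule.mul_mem_mul ha₂ ha₁)) (hA a ha y₁ hy₁)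

theorem braid_mem_tens_mul_right (hc : IsBraiding c) {A Y Y' : Submodule K I.Quo}
    (hY : ∀ a ∈ A, ∀ y ∈ Y, I.data.braid (a ⊗ₜ y) ∈ tens Y A)
    (hY' : ∀ a ∈ A, ∀ y ∈ Y', I.data.braid (a ⊗ₜ y) ∈ tens Y' A) :
    ∀ a ∈ A, ∀ y ∈ Y * Y', I.data.braid (a ⊗ₜ y) ∈ tens (Y * Y') A := by
  intro a ha y hy
  suffices h : Y * Y' ≤ (tens (Y * Y') A).comap
      (I.data.braid ∘ₗ TensorProduct.mk K _ _ a) from h hy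
  refine Submodule.mul_le.2 fun y hy y' hy' => ?_
  have h : I.data.braid (a ⊗ₜ (y * y')) = I.data.mul.rTensor _
      ((TensorProduct.assoc K _ _ _).symm (braidSnd I.data.braid (braidFst I.data.braid
        (a ⊗ₜ (y ⊗ₜ y'))))) :=
    LinearMap.congr_fun (I.isBraidedBialgebra_data hc).braid_mul_right (a ⊗ₜ (y ⊗ₜ y'))
  change I.data.braid (a ⊗ₜ (y * y')) ∈ tens (Y * Y') A
  rw [h, braidFst_tmul]
  refine map_mem_of_mem_tens (I.data.mul.rTensor _ ∘ₗ
    (TensorProduct.assoc K _ _ _).symm.toLinearMap ∘ₗ braidSnd I.data.braid ∘ₗ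
    (TensorProduct.assoc K _ _ _).toLinearMap ∘ₗ (TensorProduct.mk K _ _).flip y')
    (fun y₁ hy₁ a₁ ha₁ => ?_) (hY a ha y hy)
  exact map_mem_of_mem_tens (I.data.mul.rTensor _ ∘ₗ
    (TensorProduct.assoc K _ _ _).symm.toLinearMap ∘ₗ TensorProduct.mk K _ _ y₁)
    (fun y₂ hy₂ a₂ ha₂ => tmul_mem_tens (Submodule.mul_mem_mul hy₁ hy₂) ha₂) (hY' a₁ ha₁ y' hy')

theorem braid_mem_tens_one_left (hc : IsBraiding c) (Y : Submodule K I.Quo) :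
    ∀ a ∈ (1 : Submodule K I.Quo), ∀ y ∈ Y, I.data.braid (a ⊗ₜ y) ∈ tens Y 1 := by
  intro a ha y hy
  obtain ⟨k, rfl⟩ := Submodule.mem_one.1 ha
  rw [Algebra.algebraMap_eq_smul_one, ← data_one, TensorProduct.smul_tmul,
    (I.isBraidedBialgebra_data hc).braid_one_left, data_one]
  exact tmul_mem_tens (Y.smul_mem k hy) (Submodule.one_le.1 le_rfl)

theorem braid_mem_tens_one_right (hc : IsBraiding c) (A : Submodule K I.Quo) :
    ∀ a ∈ A, ∀ y ∈ (1 : Submodule K I.Quo), I.data.braid (a ⊗ₜ y) ∈ tens 1 A := by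
  intro a ha y hy
  obtain ⟨k, rfl⟩ := Submodule.mem_one.1 hy
  rw [Algebra.algebraMap_eq_smul_one, ← data_one, ← TensorProduct.smul_tmul,
    (I.isBraidedBialgebra_data hc).braid_one_right, data_one]
  exact tmul_mem_tens (Submodule.one_le.1 le_rfl) (A.smul_mem k ha)

theorem braid_mem_tens_pow (hc : IsBraiding c) (i j : ℕ) :
    ∀ a ∈ I.imageV ^ i, ∀ y ∈ I.imageV ^ j,
      I.data.braid (a ⊗ₜ y) ∈ tens (I.imageV ^ j) (I.imageV ^ i) := by
  have h : ∀ a ∈ I.imageV ^ i, ∀ y ∈ I.imageV,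
      I.data.braid (a ⊗ₜ y) ∈ tens I.imageV (I.imageV ^ i) := by
    induction i with
    | zero => rw [pow_zero]; exact I.braid_mem_tens_one_left hc _
    | succ i ih =>
      rw [pow_succ]
      exact I.braid_mem_tens_mul_left hc ih fun _ hx _ hy => I.braid_mem_tens_imageV hx hy
  induction j with
  | zero => rw [pow_zero]; exact I.braid_mem_tens_one_right hc _
  | succ j ih =>
    rw [pow_succ]
    exact I.braid_mem_tens_mul_right hc ih h

end BraidedBiideal

namespace Bracket

variable (b : Bracket c)

theorem stdFiltration_eq_iSup (n : ℕ) :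
    b.stdFiltration n = ⨆ i ∈ Finset.range (n + 1), b.imV ^ i := by
  rw [stdFiltration, Submodule.map_iSup]
  refine iSup_congr fun i => ?_
  rw [Submodule.map_iSup]
  refine iSup_congr fun _ => ?_
  rw [Submodule.map_pow, ← LinearMap.range_comp]
  rfl

theorem pow_le_stdFiltration {i n : ℕ} (h : i ≤ n) : b.imV ^ i ≤ b.stdFiltration n := by
  rw [stdFiltration_eq_iSup]
  exact le_iSup₂_of_le i (Finset.mem_range.2 (Nat.lt_succ_iff.2 h)) le_rfl

theorem stdFiltration_le {n : ℕ} {X : Submodule K b.U} (h : ∀ i ≤ n, b.imV ^ i ≤ X) :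
    b.stdFiltration n ≤ X := by
  rw [stdFiltration_eq_iSup]
  exact iSup₂_le fun i hi => h i (Nat.lt_succ_iff.1 (Finset.mem_range.1 hi))

theorem monotone_stdFiltration : Monotone b.stdFiltration := fun _ _ hmn =>
  b.stdFiltration_le fun _ hi => b.pow_le_stdFiltration (hi.trans hmn)

theorem stdFiltration_zero : b.stdFiltration 0 = Submodule.span K {b.data.one} := by
  rw [stdFiltration_eq_iSup, show b.data.one = 1 from b.limit.data_one, ← Submodule.one_eq_span]
  simp

theorem stdFiltration_eq_pow_sup_pred (n : ℕ) :
    b.stdFiltration n = b.imV ^ n ⊔ pred b.stdFiltration n := by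
  refine le_antisymm (b.stdFiltration_le fun i hi => ?_)
    (sup_le (b.pow_le_stdFiltration le_rfl) (pred_le b.monotone_stdFiltration n))
  rcases hi.eq_or_lt with rfl | h
  · exact le_sup_left
  · cases n with
    | zero => exact absurd h (Nat.not_lt_zero _)
    | succ n => exact (b.pow_le_stdFiltration (Nat.lt_succ_iff.1 h)).trans le_sup_right

theorem mul_mem_stdFiltration (i j : ℕ) :
    ∀ x ∈ b.stdFiltration i, ∀ y ∈ b.stdFiltration j,
      b.data.mul (x ⊗ₜ y) ∈ b.stdFiltration (i + j) := by
  intro x hx y hy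
  suffices h : b.stdFiltration i ≤ (b.stdFiltration (i + j)).comap
      (b.data.mul ∘ₗ (TensorProduct.mk K _ _).flip y) from h hx
  refine b.stdFiltration_le fun p hp x hx => ?_
  suffices h : b.stdFiltration j ≤ (b.stdFiltration (i + j)).comap
      (b.data.mul ∘ₗ TensorProduct.mk K _ _ x) from h hy
  refine b.stdFiltration_le fun q hq y hy => ?_
  refine b.pow_le_stdFiltration (show p + q ≤ i + j by omega) ?_
  rw [pow_add]
  exact Submodule.mul_mem_mul hx hy

theorem braid_mem_stdFiltration (hc : IsBraiding c) (i j : ℕ) :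
    ∀ x ∈ b.stdFiltration i, ∀ y ∈ b.stdFiltration j,
      b.data.braid (x ⊗ₜ y) ∈ tens (b.stdFiltration j) (b.stdFiltration i) := by
  intro x hx y hy
  suffices h : b.stdFiltration i ≤ (tens (b.stdFiltration j) (b.stdFiltration i)).comap
      (b.data.braid ∘ₗ (TensorProduct.mk K _ _).flip y) from h hx
  refine b.stdFiltration_le fun p hp x hx => ?_
  suffices h : b.stdFiltration j ≤ (tens (b.stdFiltration j) (b.stdFiltration i)).comap
      (b.data.braid ∘ₗ TensorProduct.mk K _ _ x) from h hy
  refine b.stdFiltration_le fun q hq y hy => ?_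
  exact tens_mono (b.pow_le_stdFiltration hq) (b.pow_le_stdFiltration hp)
    (b.limit.braid_mem_tens_pow hc p q x hx y hy)

theorem iSup_stdFiltration : ⨆ n, b.stdFiltration n = ⊤ := by
  refine eq_top_iff.2 fun x _ => ?_
  obtain ⟨t, rfl⟩ := b.limit.proj_surjective x
  suffices h : ∃ n, b.limit.proj t ∈ b.stdFiltration n from
    h.elim fun n hn => Submodule.mem_iSup_of_mem n hn
  clear * -
  induction t using tensorAlgebra_induction_left with
  | one =>
    rw [map_one]
    exact ⟨0, b.pow_le_stdFiltration le_rfl (by rw [pow_zero]; exact Submodule.one_le.1 le_rfl)⟩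
  | ι_mul v t ih =>
    obtain ⟨n, hn⟩ := ih
    refine ⟨1 + n, ?_⟩
    have hv : b.iU v ∈ b.stdFiltration 1 := by
      refine b.pow_le_stdFiltration le_rfl ?_
      rw [pow_one]
      exact ⟨v, rfl⟩
    rw [map_mul]
    exact b.mul_mem_stdFiltration 1 n (b.iU v) hv (b.limit.proj t) hn
  | add s t hs ht =>
    obtain ⟨m, hm⟩ := hs
    obtain ⟨n, hn⟩ := ht
    rw [map_add]
    exact ⟨max m n, add_mem (b.monotone_stdFiltration (le_max_left m n) hm)
      (b.monotone_stdFiltration (le_max_right m n) hn)⟩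
  | smul k t ht =>
    obtain ⟨n, hn⟩ := ht
    rw [map_smul]
    exact ⟨n, Submodule.smul_mem _ k hn⟩

/-- `Δ(v x) = Δ(v) Δ(x)`, where `Δ(v) = v ⊗ 1 + 1 ⊗ v` has total degree one. -/
theorem comul_mem_of_mem_pow (hc : IsBraiding c) (n : ℕ) :
    ∀ x ∈ b.imV ^ n, b.data.comul x ∈ totalFiltration b.stdFiltration n := by
  have hD : b.data.IsBraidedBialgebra := b.limit.isBraidedBialgebra_data hc
  have hone : b.data.one ∈ b.stdFiltration 0 :=
    b.stdFiltration_zero.ge (Submodule.mem_span_singleton_self _)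
  induction n with
  | zero =>
    intro x hx
    have hx' : x ∈ Submodule.span K {b.data.one} :=
      b.stdFiltration_zero.le (b.pow_le_stdFiltration le_rfl hx)
    obtain ⟨k, rfl⟩ := Submodule.mem_span_singleton.1 hx'
    rw [map_smul, hD.comul_one]
    have h : b.data.one ⊗ₜ[K] b.data.one ∈ totalFiltration b.stdFiltration 0 :=
      tens_le_totalFiltration (a := 0) (b := 0) b.monotone_stdFiltration le_rfl
        (tmul_mem_tens hone hone)
    exact Submodule.smul_mem _ k h
  | succ n ih =>
    suffices h : b.imV ^ (n + 1) ≤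
        (totalFiltration b.stdFiltration (n + 1)).comap b.data.comul from fun x hx => h hx
    rw [pow_succ']
    refine Submodule.mul_le.2 ?_
    rintro _ ⟨v, rfl⟩ x hx
    have hv : b.iU v ∈ b.stdFiltration 1 := by
      refine b.pow_le_stdFiltration le_rfl ?_
      rw [pow_one]
      exact ⟨v, rfl⟩
    have hΔv : b.data.comul (b.iU v) ∈ totalFiltration b.stdFiltration 1 := by
      rw [show b.data.comul (b.iU v) = _ from b.limit.comul_incl v]
      have h₁ : b.iU v ⊗ₜ[K] b.data.one ∈ totalFiltration b.stdFiltration 1 :=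
        tens_le_totalFiltration (a := 1) (b := 0) b.monotone_stdFiltration le_rfl
          (tmul_mem_tens hv hone)
      have h₂ : b.data.one ⊗ₜ[K] b.iU v ∈ totalFiltration b.stdFiltration 1 :=
        tens_le_totalFiltration (a := 0) (b := 1) b.monotone_stdFiltration le_rfl
          (tmul_mem_tens hone hv)
      exact add_mem h₁ h₂
    rw [Submodule.mem_comap, show b.data.comul (b.iU v * x) =
      b.data.braidedMul (b.data.comul (b.iU v) ⊗ₜ b.data.comul x) from
      LinearMap.congr_fun hD.comul_mul (b.iU v ⊗ₜ x), add_comm n 1]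
    exact braidedMul_mem_totalFiltration b.monotone_stdFiltration b.mul_mem_stdFiltration
      (b.braid_mem_stdFiltration hc) hΔv (ih x hx)

theorem isCompatible_stdFiltration (hc : IsBraiding c) : IsCompatible b.data b.stdFiltration where
  monotone := b.monotone_stdFiltration
  exhaustive := b.iSup_stdFiltration
  mul_mem := b.mul_mem_stdFiltration
  one_mem := b.stdFiltration_zero.ge (Submodule.mem_span_singleton_self _)
  comul_mem n := by
    suffices h : b.stdFiltration n ≤ (totalFiltration b.stdFiltration n).comap b.data.comul from
      fun x hx => h hx
    exact b.stdFiltration_le fun i hi x hx =>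
      totalFiltration_mono b.monotone_stdFiltration hi (b.comul_mem_of_mem_pow hc i x hx)
  braid_mem := b.braid_mem_stdFiltration hc

end Bracket

end Standard

end

end BraidedLie

theorem mainTheorem7 {K : Type*} [Field K] {V : Type*} [AddCommGroup V] [Module K V]
    (c : V ⊗[K] V →ₗ[K] V ⊗[K] V) (b : BraidedLie.Bracket c)
    (hb : BraidedLie.IsBraidedLieAlgebra c b) :
    b.data.IsBraidedBialgebra ∧
    ∃ (hle : ∀ n, b.stdFiltration n ≤ b.corFiltration n)
      (𝔊 : BraidedLie.BraidedBialgebraData K (BraidedLie.Gr b.stdFiltration))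
      (gr : BraidedLie.BraidedBialgebraData K (BraidedLie.Gr b.corFiltration)),
      BraidedLie.IsInduced b.data b.stdFiltration 𝔊 ∧ 𝔊.IsGradedBraidedBialgebra ∧
      BraidedLie.IsInduced b.data b.corFiltration gr ∧ gr.IsGradedBraidedBialgebra ∧
      𝔊.IsHom gr (BraidedLie.grId hle) ∧
      (∀ n, (BraidedLie.grPart b.stdFiltration n).map (BraidedLie.grId hle) ≤
        BraidedLie.grPart b.corFiltration n) ∧
      List.TFAE [
        Function.Bijective (BraidedLie.grId hle),
        Function.Surjective (BraidedLie.grId hle),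
        Function.Injective (BraidedLie.grId hle),
        ∀ n, b.stdFiltration n ⊓ BraidedLie.pred b.corFiltration n =
          BraidedLie.pred b.stdFiltration n,
        ∀ n, b.corFiltration n = b.stdFiltration n ⊔ BraidedLie.pred b.corFiltration n,
        b.IsStrictlyGenerated,
        𝔊.primitives = BraidedLie.grPart b.stdFiltration 1,
        ∀ n, b.imV ^ n ⊓ BraidedLie.pred b.corFiltration n ≤
          BraidedLie.pred b.stdFiltration n] := by
  have hc := hb.isBraiding
  have hD : b.data.IsBraidedBialgebra := b.limit.isBraidedBialgebra_data hc
  have hF := b.isCompatible_stdFiltration hc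
  have h₀ := BraidedLie.coradical_eq_span_one hD hF b.stdFiltration_zero
  have hle : ∀ n, b.stdFiltration n ≤ b.corFiltration n :=
    hF.le_coradicalFiltration (b.stdFiltration_zero.trans h₀.symm)
  have hC : BraidedLie.IsCompatible b.data b.corFiltration :=
    BraidedLie.isCompatible_coradicalFiltration hD h₀
      (eq_top_iff.2 (hF.exhaustive.ge.trans (iSup_mono hle)))
  obtain ⟨𝔊, h𝔊⟩ := hF.exists_isSymbolStructure
  obtain ⟨gr, hgr⟩ := hC.exists_isSymbolStructure
  have h𝔊D := h𝔊.isBraidedBialgebra hD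
  have hgrD := hgr.isBraidedBialgebra hD
  have h𝔊I := hF.isInduced h𝔊
  have hgrI := hC.isInduced hgr
  exact ⟨hD, hle, 𝔊, gr, h𝔊I, h𝔊I.isGradedBraidedBialgebra h𝔊D, hgrI,
    hgrI.isGradedBraidedBialgebra hgrD, BraidedLie.isHom_grId h𝔊 hgr hle,
    BraidedLie.grId_map_grPart_le hle,
    BraidedLie.tfae_eq_coradicalFiltration hD hF b.stdFiltration_zero h𝔊I h𝔊D hle
      b.stdFiltration_eq_pow_sup_pred⟩
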